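/- **Setting.** Let $(X,Y)$ be random variables on a probability space with values in $\mathbb{R}^d\times\mathbb{R}$, with $\mathbb{E}\|X\|^2<\infty$, $\mathbb{E}[Y^2]<\infty$ and $\mathbb{E}[Y]=0$. Let $\mu$ be a Borel probability measure on $\mathbb{R}$ whose support is compact and contained in $(0,\infty)$, and consider the $\ell_1$-type kernel $K(x,x')=\int_0^\infty e^{-t\|x-x'\|_1}\,\mu(dt)$. With $q_t(\omega)=\prod_{j=1}^d\frac{2t}{4\pi^2\omega_j^2+t^2}$, its spectral density is $k(\omega)=\int_0^\infty q_t(\omega)\,\mu(dt)$, and its reproducing kernel Hilbert space is $$H=\Big\{f\in C(\mathbb{R}^d)\cap L_2(\mathbb{R}^d)\ \text{real-valued}:\ \|f\|_H^2=\int_{\mathbb{R}^d}\frac{|\hat f(\omega)|^2}{k(\omega)}\,d\omega<\infty\Big\},\qquad \hat f(\omega)=\int f(x)e^{-2\pi i\langle x,\omega\rangle}dx .$$ For $\beta\in\mathbb{R}^d$ and $\lambda>0$ let $(\beta\circ x)_j=\beta_jx_j$, $\operatorname{supp}(\beta)=\{j:\beta_j\ne0\}$, and $$\mathcal{J}(\beta,\lambda)=\min_{f\in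 H}\ \mathbb{E}\big[(Y-f(\beta\circ X))^2\big]+\lambda\|f\|_H^2,\qquad \mathrm{D}\mathcal{J}(\beta,\lambda)[v]=\lim_{s\to0^+}\frac{\mathcal{J}(\beta+sv,\lambda)-\mathcal{J}(\beta,\lambda)}{s}.$$ A point $\beta$ is a directional stationary point of $\mathcal{J}(\cdot,\lambda)$ if $\mathrm{D}\mathcal{J}(\beta,\lambda)[v]$ exists and is $\ge0$ for every $v\in\mathbb{R}^d$. For $S\subseteq\{1,\dots,d\}$ write $X_S=(X_j)_{j\in S}$, and let $S_*$ be the intersection of all $S$ with $\mathbb{E}[Y|X]=\mathbb{E}[Y|X_S]$ almost surely. For $i\in\{1,\dots,d\}$ put $$\mathcal{M}_i(\beta)=\int_0^\infty\!\int_{\mathbb{R}^d}\!\int_{\mathbb{R}}\Big|\mathbb{E}\big[(Y-\mathbb{E}[Y|X_{\operatorname{supp}(\beta)}])\,e^{-2\pi i\langle\omega,\beta\circ X\rangle}e^{-2\pi i\zeta X_i}\big]\Big|^2\frac{d\zeta}{2\pi^2\zeta^2}\; t\,q_t(\omega)\,d\omega\,\mu(dt)\in[0,\infty],$$ where the $i$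 in the factor $2\pi i$ of the exponents is the imaginary unit. **Assumptions.** The core sufficient feature set exists, i.e. $\mathbb{E}[Y|X]=\mathbb{E}[Y|X_{S_*}]$ almost surely; $X_{S_*}$ and $X_{S_*^c}$ are independent; the variables $(X_j)_{j\in S_*}$ are mutually independent; and $i\in S_*$ has a main effect, i.e. it is not the case that $\mathbb{E}[Y|X_i]=0$ almost surely. **Theorem.** 1. For every compact set $C\subset\{\beta\in\mathbb{R}^d:\beta_i=0\}$, $\mathcal{M}_i$ is finite on $C$ and $\inf_{\beta\in C}\mathcal{M}_i(\beta)>0$. Moreover there are $\varepsilon>0$ and $\lambda_0>0$ such that for all $\lambda\in(0,\lambda_0)$ and all $\beta\in C$ the directional derivative $\mathrm{D}\mathcal{J}(\beta,\lambda)[e_i]$ exists and $$\lambda\cdot\mathrm{D}\mathcal{J}(\beta,\lambda)[e_i]\le-\varepsilon .$$ 2. For every compact set $C\subset\mathbb{R}^d$ there is $\lambda_0>0$ such that for all $\lambda\in(0,\lambda_0)$, every directional stationary point $\beta$ of $\mathcal{J}(\cdot,\lambda)$ satisfies $i\in\operatorname{supp}(\beta)$ or $\beta\notin C$. -/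

import Mathlib

open MeasureTheory ProbabilityTheory Filter Topology
open scoped FourierTransform ENNReal RealInnerProductSpace

namespace CompositionalKernel

noncomputable section

/-- The coordinatewise (Hadamard) product `β ∘ x`. -/
def had {d : ℕ} (β x : EuclideanSpace ℝ (Fin d)) : EuclideanSpace ℝ (Fin d) :=
  WithLp.toLp 2 (fun j => β j * x j)

/-- The support of a vector. -/
def supp {d : ℕ} (β : EuclideanSpace ℝ (Fin d)) : Set (Fin d) := {j | β j ≠ 0}

/-! ### The translation-invariant space `H` -/

/-- The (Plancherel) Fourier transform of a square-integrable function on `ℝ^d`; on integrable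
functions it is `f̂(ω) = ∫ f(x) exp (-2πi⟨x, ω⟩) dx`. -/
def fourierL2 {d : ℕ} (f : EuclideanSpace ℝ (Fin d) → ℂ) (hf : MemLp f 2 volume) :
    EuclideanSpace ℝ (Fin d) → ℂ :=
  ((𝓕 (hf.toLp f : Lp ℂ 2 (volume : Measure (EuclideanSpace ℝ (Fin d)))) :
    Lp ℂ 2 (volume : Measure (EuclideanSpace ℝ (Fin d)))))

/-- The space `H` attached to a spectral density `k`: the real-valued continuous
square-integrable functions `f` on `ℝ^d` with `∫ |f̂(ω)|² / k(ω) dω < ∞`. -/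
structure FourierRKHS {d : ℕ} (k : EuclideanSpace ℝ (Fin d) → ℝ) where
  toFun : EuclideanSpace ℝ (Fin d) → ℝ
  continuous_toFun : Continuous toFun
  memLp_toFun : MemLp (fun x => (toFun x : ℂ)) 2 volume
  energy_lt_top :
    ∫⁻ ω, ‖fourierL2 (fun x => (toFun x : ℂ)) memLp_toFun ω‖ₑ ^ 2 / ENNReal.ofReal (k ω) < ∞

/-- The squared norm `‖f‖_H² = ∫ |f̂(ω)|² / k(ω) dω`. -/
def FourierRKHS.normSq {d : ℕ} {k : EuclideanSpace ℝ (Fin d) → ℝ} (f : FourierRKHS k) : ℝ :=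
  (∫⁻ ω, ‖fourierL2 (fun x => (f.toFun x : ℂ)) f.memLp_toFun ω‖ₑ ^ 2
    / ENNReal.ofReal (k ω)).toReal

/-- The Fourier transform `q_t` of `x ↦ exp (-t ‖x‖₁)`. -/
def laplaceDensity {d : ℕ} (t : ℝ) (ω : EuclideanSpace ℝ (Fin d)) : ℝ :=
  ∏ j, 2 * t / (4 * Real.pi ^ 2 * ω j ^ 2 + t ^ 2)

/-- The spectral density of the `ℓ₁`-type kernel `K(x, x') = ∫ exp (-t ‖x - x'‖₁) μ(dt)`. -/
def lOneDensity (d : ℕ) (μ : Measure ℝ) (ω : EuclideanSpace ℝ (Fin d)) : ℝ :=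
  ∫ t, laplaceDensity t ω ∂μ

/-! ### Kernel ridge regression and the reduced objective -/

variable {Ω : Type*} [MeasurableSpace Ω] {d : ℕ}

/-- `I(f, β, λ) = E[(Y - f(β ∘ X))²] + λ ‖f‖_H²`. -/
def krrRisk (P : Measure Ω) (X : Ω → EuclideanSpace ℝ (Fin d)) (Y : Ω → ℝ)
    {k : EuclideanSpace ℝ (Fin d) → ℝ} (f : FourierRKHS k) (β : EuclideanSpace ℝ (Fin d))
    (lam : ℝ) : ℝ :=
  (∫ w, (Y w - f.toFun (had β (X w))) ^ 2 ∂P) + lam * f.normSq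

/-- `J(β, λ)`, the minimal value of `I(f, β, λ)` over `f ∈ H`. -/
def objective (P : Measure Ω) (X : Ω → EuclideanSpace ℝ (Fin d)) (Y : Ω → ℝ)
    (k : EuclideanSpace ℝ (Fin d) → ℝ) (β : EuclideanSpace ℝ (Fin d)) (lam : ℝ) : ℝ :=
  ⨅ f : FourierRKHS k, krrRisk P X Y f β lam

/-- `g` has one-sided directional derivative `D` at `β` in the direction `v`:
`D = lim_{s → 0⁺} (g(β + s v) - g(β)) / s`. -/
def HasDirDeriv (g : EuclideanSpace ℝ (Fin d) → ℝ) (β v : EuclideanSpace ℝ (Fin d))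
    (D : ℝ) : Prop :=
  Tendsto (fun s : ℝ => (g (β + s • v) - g β) / s) (𝓝[>] 0) (𝓝 D)

/-- `β` is a directional stationary point of `g`: every directional derivative of `g` at `β`
is nonnegative. -/
def IsDirStationary (g : EuclideanSpace ℝ (Fin d) → ℝ) (β : EuclideanSpace ℝ (Fin d)) : Prop :=
  ∀ v, ∃ D, HasDirDeriv g β v D ∧ 0 ≤ D

/-! ### Feature sets -/

/-- The σ-algebra generated by the coordinates `X_S = (X_j)_{j ∈ S}`. -/
abbrev sigmaCoord (X : Ω → EuclideanSpace ℝ (Fin d)) (S : Set (Fin d)) : MeasurableSpace Ω :=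
  MeasurableSpace.comap (fun w (j : S) => X w j) inferInstance

/-- `E[Y | X_S]`. -/
def condCoord (P : Measure Ω) (X : Ω → EuclideanSpace ℝ (Fin d)) (Y : Ω → ℝ)
    (S : Set (Fin d)) : Ω → ℝ :=
  P[Y | sigmaCoord X S]

/-- `E[Y | X] = E[Y | X_S]` almost surely. -/
def IsSufficient (P : Measure Ω) (X : Ω → EuclideanSpace ℝ (Fin d)) (Y : Ω → ℝ)
    (S : Set (Fin d)) : Prop :=
  P[Y | MeasurableSpace.comap X inferInstance] =ᵐ[P] condCoord P X Y S

/-- The set `S_*`, the intersection of all `S` with `E[Y | X] = E[Y | X_S]`. It is the core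
sufficient feature set when it is itself sufficient. -/
def coreSet (P : Measure Ω) (X : Ω → EuclideanSpace ℝ (Fin d)) (Y : Ω → ℝ) : Set (Fin d) :=
  ⋂₀ {S | IsSufficient P X Y S}

/-! ### The leading term -/

/-- The quantity `M_i(β)`, as an element of `[0, ∞]`:
`∭ |E[(Y - E[Y | X_{supp β}]) e^{-2πi⟨ω, β ∘ X⟩} e^{-2πi ζ X_i}]|² / (2π²ζ²) dζ t q_t(ω) dω μ(dt)`.
-/
def leadingTerm (P : Measure Ω) (X : Ω → EuclideanSpace ℝ (Fin d)) (Y : Ω → ℝ)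
    (μ : Measure ℝ) (i : Fin d) (β : EuclideanSpace ℝ (Fin d)) : ℝ≥0∞ :=
  ∫⁻ t, (∫⁻ ω : EuclideanSpace ℝ (Fin d), (∫⁻ ζ : ℝ,
      ‖∫ w, ((Y w - condCoord P X Y (supp β) w : ℝ) : ℂ)
          * Complex.exp (-(2 * Real.pi * Complex.I * ((⟪ω, had β (X w)⟫ : ℝ) : ℂ)))
          * Complex.exp (-(2 * Real.pi * Complex.I * ((ζ * X w i : ℝ) : ℂ))) ∂P‖ₑ ^ 2
        * ENNReal.ofReal (1 / (2 * Real.pi ^ 2 * ζ ^ 2)))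
      * ENNReal.ofReal (t * laplaceDensity t ω)) ∂μ

end

end CompositionalKernel

open CompositionalKernel

set_option linter.unusedSectionVars false

namespace CompositionalKernel

/-! ### Fourier inversion on `L¹ ∩ L²`. -/

section L2Fourier

variable {V : Type*} [NormedAddCommGroup V] [InnerProductSpace ℝ V] [FiniteDimensional ℝ V]
  [MeasurableSpace V] [BorelSpace V]

/-! Ridge regression at `β` is solved by duality. Let `g` be the `L²(P)` solution of `Y = T_β g + λ
g`, where `T_β` is the integral operator with kernel `K(β ∘ (X - X'))`. Fourier inversion on `H`
gives `2 E[f g] ≤ ‖f‖² + E[K g g']`, with equality for `f = T_β g`, so the minimal value is `J(β, λ)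
= λ E[Y g]` (`objective_eq_of_dual`). A change `δ` of the kernel changes this value by `-λ E[δ g
g']`, up to an error quadratic in the Hilbert–Schmidt norm of `δ` (`abs_perturbation_le`).

If `β_i = 0`, a step `s` along `e_i` increases `‖β ∘ (X - X')‖₁` by exactly `s |X_i - X_i'|`. With
the residual `r = λ g` this gives `λ DJ[e_i] = E[|X_i - X_i'| K₁ r r']`, where `K₁` is the kernel of
the measure `t μ(dt)` (`hasDirDeriv_objective`).

The sign comes from the negative definiteness of `|x|`. Replacing `|x|` by `(1 - exp(-τ|x|)) / τ`
turns the form into a small error plus `(E[K₁ r r'] - E[exp(-τ|X_i - X_i'|) K₁ r r']) / τ`. The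
first expectation is `O(λ)`, because optimality bounds `E[K r r']` by `λ E[Y²]` and `K₁` is
spectrally dominated by `K`. The second is the integral of `|E[r e^{-2πi(⟨ω, β ∘ X⟩ + ζ X_i)}]|²`
against a positive spectral density, and it has to stay away from zero.

This is where the main effect enters. Since `X_i` is independent of the coordinates seen by `β`, the
fitted function contributes to the frequency `ζ` of `X_i` only through its mean, which equals minus
the mean of `r` and is small for small `λ`. Hence `r` inherits the nonzero transform `E[Y
e^{-2πiζX_i}]` on an interval of `ζ`. Continuity in `ω`, uniform over bounded `β`, extends this to a
ball of frequencies (`exists_uniform_descent`). All constants depend on `β` only through a bound on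
`‖β‖`.

The same lower bound applied to `Y - E[Y | X_{supp β}]` gives positivity of `M_i`. Finiteness holds
because this residual is orthogonal to functions of `β ∘ X`, so its transform is `O(|ζ|)` and
compensates `1/ζ²`. The second assertion follows because a strictly negative derivative along `e_i`
excludes stationarity. -/

theorem integral_fourierInv_mul_eq_flip {f g : V → ℂ} (hf : Integrable f) (hg : Integrable g) :
    ∫ x, 𝓕⁻ f x * g x = ∫ x, f x * 𝓕⁻ g x := by
  have h := VectorFourier.integral_fourierIntegral_smul_eq_flip (e := Real.fourierChar)
    (μ := (volume : Measure V)) (ν := volume) (L := -innerₗ V) Real.continuous_fourierChar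
    (by simp only [LinearMap.neg_apply, innerₗ_apply_apply]; fun_prop) hf hg
  have hflip : (-innerₗ V).flip = -innerₗ V := by
    ext x y; simp [real_inner_comm]
  rw [hflip] at h
  exact h

/-- On `L¹ ∩ L²` the Plancherel inverse Fourier transform is given by the integral. -/
theorem fourierInv_toLp_ae_eq {h : V → ℂ} (h1 : Integrable h) (h2 : MemLp h 2) :
    ((𝓕⁻ (h2.toLp h : Lp ℂ 2 (volume : Measure V)) : Lp ℂ 2 (volume : Measure V)) : V → ℂ)
      =ᵐ[volume] 𝓕⁻ h := by
  set G : Lp ℂ 2 (volume : Measure V) := 𝓕⁻ (h2.toLp h : Lp ℂ 2 (volume : Measure V)) with hG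
  have hcont : Continuous (𝓕⁻ h) := by
    have := VectorFourier.fourierIntegral_continuous (e := Real.fourierChar)
      (μ := (volume : Measure V)) (L := -innerₗ V) Real.continuous_fourierChar
      (by simp only [LinearMap.neg_apply, innerₗ_apply_apply]; fun_prop) h1
    exact this
  refine ae_eq_of_integral_contDiff_smul_eq
    ((Lp.memLp G).locallyIntegrable (by norm_num)) hcont.locallyIntegrable ?_
  intro φ hφ hφc
  have hφ' : ContDiff ℝ (⊤ : ℕ∞) (fun x => (φ x : ℂ)) := Complex.ofRealCLM.contDiff.comp hφ
  have hφc' : HasCompactSupport (fun x => (φ x : ℂ)) :=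
    hφc.comp_left (g := fun r : ℝ => (r : ℂ)) (by simp)
  let ψ : SchwartzMap V ℂ := hφc'.toSchwartzMap hφ'
  have hψ : ∀ x, ψ x = (φ x : ℂ) := fun x => rfl
  -- The Plancherel transform agrees with the distributional one, so testing against `ψ` moves the
  -- inverse transform onto a Schwartz function, where it is given by the integral.
  have key := congrArg (fun T : TemperedDistribution V ℂ => T ψ)
    (Lp.fourierInv_toTemperedDistribution_eq (h2.toLp h))
  simp only [TemperedDistribution.fourierInv_apply, Lp.toTemperedDistribution_apply] at key
  calc ∫ x, φ x • G x = ∫ x, ψ x • G x := by simp [hψ]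
    _ = ∫ x, (𝓕⁻ ψ) x • (h2.toLp h : V → ℂ) x := key.symm
    _ = ∫ x, 𝓕⁻ (ψ : V → ℂ) x * h x := by
        refine integral_congr_ae ?_
        filter_upwards [h2.coeFn_toLp] with x hx
        rw [hx, SchwartzMap.fourierInv_coe, smul_eq_mul]
    _ = ∫ x, ψ x * 𝓕⁻ h x := integral_fourierInv_mul_eq_flip ψ.integrable h1
    _ = ∫ x, φ x • 𝓕⁻ h x := by simp [hψ]

end L2Fourier

/-! ### The Fourier pair of `exp(-t‖x‖₁)` and `q_t`. -/

section Laplace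

/-- The Fourier transform of `x ↦ exp (-t |x|)` on the line. -/
noncomputable def laplaceDensity₁ (t ζ : ℝ) : ℝ := 2 * t / (4 * Real.pi ^ 2 * ζ ^ 2 + t ^ 2)

theorem laplaceDensity₁_nonneg {t : ℝ} (ht : 0 ≤ t) (ζ : ℝ) : 0 ≤ laplaceDensity₁ t ζ := by
  unfold laplaceDensity₁; positivity

theorem laplaceDensity₁_eq {t : ℝ} (ht : 0 < t) (ζ : ℝ) :
    laplaceDensity₁ t ζ = 2 / t * (1 + (2 * Real.pi / t * ζ) ^ 2)⁻¹ := by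
  unfold laplaceDensity₁; field_simp; ring

theorem laplaceDensity₁_le {t : ℝ} (ht : 0 < t) (ζ : ℝ) : laplaceDensity₁ t ζ ≤ 2 / t := by
  rw [laplaceDensity₁_eq ht]
  refine mul_le_of_le_one_right (by positivity) (inv_le_one_of_one_le₀ ?_)
  nlinarith [sq_nonneg (2 * Real.pi / t * ζ)]

theorem integrable_laplaceDensity₁ {t : ℝ} (ht : 0 < t) : Integrable (laplaceDensity₁ t) := by
  have h := (integrable_inv_one_add_sq.comp_mul_left' (R := 2 * Real.pi / t)
    (by positivity)).const_mul (2 / t)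
  exact h.congr (Eventually.of_forall fun ζ => (laplaceDensity₁_eq ht ζ).symm)

theorem integrableOn_Ioi_exp_abs_mul {t : ℝ} (ht : 0 < t) (ζ : ℝ) :
    IntegrableOn (fun x : ℝ => (Real.exp (-(t * |x|)) : ℂ) *
      Complex.exp (-(2 * Real.pi * Complex.I * ((ζ * x : ℝ) : ℂ)))) (Set.Ioi 0) ∧
    ∫ x in Set.Ioi (0 : ℝ), (Real.exp (-(t * |x|)) : ℂ) *
      Complex.exp (-(2 * Real.pi * Complex.I * ((ζ * x : ℝ) : ℂ)))
      = 1 / (t + 2 * Real.pi * Complex.I * ζ) := by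
  have ha : (-((t : ℂ) + 2 * Real.pi * Complex.I * ζ)).re < 0 := by simp [ht]
  have heq : Set.EqOn (fun x : ℝ => Complex.exp (-((t : ℂ) + 2 * Real.pi * Complex.I * ζ) * x))
      (fun x : ℝ => (Real.exp (-(t * |x|)) : ℂ) *
      Complex.exp (-(2 * Real.pi * Complex.I * ((ζ * x : ℝ) : ℂ)))) (Set.Ioi 0) := by
    intro x hx
    simp only [abs_of_pos (Set.mem_Ioi.1 hx), Complex.ofReal_exp, ← Complex.exp_add]
    congr 1; push_cast; ring
  refine ⟨(integrableOn_exp_mul_complex_Ioi ha 0).congr_fun heq measurableSet_Ioi, ?_⟩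
  rw [← setIntegral_congr_fun measurableSet_Ioi heq, integral_exp_mul_complex_Ioi ha 0]
  simp only [Complex.ofReal_zero, mul_zero, Complex.exp_zero]
  rw [neg_div_neg_eq]

theorem integrable_exp_abs_mul {t : ℝ} (ht : 0 < t) (ζ : ℝ) :
    Integrable (fun x : ℝ => (Real.exp (-(t * |x|)) : ℂ) *
      Complex.exp (-(2 * Real.pi * Complex.I * ((ζ * x : ℝ) : ℂ)))) ∧
    ∫ x : ℝ, (Real.exp (-(t * |x|)) : ℂ) *
      Complex.exp (-(2 * Real.pi * Complex.I * ((ζ * x : ℝ) : ℂ))) = laplaceDensity₁ t ζ := by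
  obtain ⟨hi, hv⟩ := integrableOn_Ioi_exp_abs_mul ht ζ
  obtain ⟨hi', hv'⟩ := integrableOn_Ioi_exp_abs_mul ht (-ζ)
  set F : ℝ → ℂ := fun x => (Real.exp (-(t * |x|)) : ℂ) *
      Complex.exp (-(2 * Real.pi * Complex.I * ((ζ * x : ℝ) : ℂ))) with hF
  have hneg : (fun x : ℝ => (Real.exp (-(t * |x|)) : ℂ) *
      Complex.exp (-(2 * Real.pi * Complex.I * ((-ζ * x : ℝ) : ℂ)))) = fun x => F (-x) := by
    funext x; simp only [hF, abs_neg]; congr 3; push_cast; ring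
  rw [hneg] at hi' hv'
  have hIic : IntegrableOn F (Set.Iic 0) := by
    rw [integrableOn_Iic_iff_integrableOn_Iio]
    rw [← neg_zero] at hi'
    have h := IntegrableOn.comp_neg_Iio hi'
    simp only [neg_neg] at h
    exact h
  have hint : Integrable F := by
    have h := hIic.union hi
    rwa [Set.Iic_union_Ioi, integrableOn_univ] at h
  refine ⟨hint, ?_⟩
  rw [← intervalIntegral.integral_Iic_add_Ioi hIic hi, hv]
  have h0 : ∫ x in Set.Iic (0 : ℝ), F x = 1 / (t + 2 * Real.pi * Complex.I * (-ζ : ℝ)) := by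
    rw [← hv', integral_comp_neg_Ioi]; simp
  rw [h0]
  have h1 : (t : ℂ) + 2 * Real.pi * Complex.I * ζ ≠ 0 := by
    intro h; have := congrArg Complex.re h; simp at this; exact ht.ne' this
  have h2 : (t : ℂ) + 2 * Real.pi * Complex.I * (-ζ : ℝ) ≠ 0 := by
    intro h; have := congrArg Complex.re h; simp at this; exact ht.ne' this
  have h3 : ((4 * Real.pi ^ 2 * ζ ^ 2 + t ^ 2 : ℝ) : ℂ)
      = (t + 2 * Real.pi * Complex.I * ζ) * (t + 2 * Real.pi * Complex.I * (-ζ : ℝ)) := by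
    push_cast; ring_nf; rw [Complex.I_sq]; ring
  rw [laplaceDensity₁, Complex.ofReal_div, h3]
  field_simp
  push_cast; ring

theorem fourier_exp_neg_mul_abs {t : ℝ} (ht : 0 < t) :
    𝓕 (fun x : ℝ => (Real.exp (-(t * |x|)) : ℂ)) = fun ζ => (laplaceDensity₁ t ζ : ℂ) := by
  funext ζ
  rw [Real.fourier_real_eq_integral_exp_smul, ← (integrable_exp_abs_mul ht ζ).2]
  refine integral_congr_ae (Eventually.of_forall fun x => ?_)
  simp only [smul_eq_mul]
  rw [mul_comm]; congr 2; push_cast; ring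

theorem integral_laplaceDensity₁_mul_exp {t : ℝ} (ht : 0 < t) (x : ℝ) :
    ∫ ζ : ℝ, (laplaceDensity₁ t ζ : ℂ) * Complex.exp (2 * Real.pi * Complex.I * ((ζ * x : ℝ) : ℂ))
      = Real.exp (-(t * |x|)) := by
  have hc : Continuous (fun x : ℝ => (Real.exp (-(t * |x|)) : ℂ)) := by fun_prop
  have hi : Integrable (fun x : ℝ => (Real.exp (-(t * |x|)) : ℂ)) := by
    simpa using (integrable_exp_abs_mul ht 0).1
  have hF : Integrable (𝓕 (fun x : ℝ => (Real.exp (-(t * |x|)) : ℂ))) := by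
    rw [fourier_exp_neg_mul_abs ht]; exact (integrable_laplaceDensity₁ ht).ofReal
  have h := congrFun (hc.fourierInv_fourier_eq hi hF) x
  rw [fourier_exp_neg_mul_abs ht, Real.fourierInv_eq'] at h
  rw [← h]
  refine integral_congr_ae (Eventually.of_forall fun ζ => ?_)
  simp only [smul_eq_mul]
  rw [mul_comm]; congr 2
  simp only [RCLike.inner_apply, conj_trivial]; push_cast; ring

variable {d : ℕ}

theorem laplaceDensity_eq_prod (t : ℝ) (ω : EuclideanSpace ℝ (Fin d)) :
    laplaceDensity t ω = ∏ j, laplaceDensity₁ t (ω j) := rfl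

theorem integrable_laplaceDensity {t : ℝ} (ht : 0 < t) :
    Integrable (laplaceDensity (d := d) t) := by
  have h := Integrable.fintype_prod (f := fun _ : Fin d => laplaceDensity₁ t)
    (μ := fun _ => (volume : Measure ℝ)) (fun _ => integrable_laplaceDensity₁ ht)
  exact ((PiLp.volume_preserving_ofLp (Fin d)).integrable_comp_emb
    (MeasurableEquiv.toLp 2 (Fin d → ℝ)).symm.measurableEmbedding).2 h

theorem integral_laplaceDensity_mul_exp {t : ℝ} (ht : 0 < t) (y : EuclideanSpace ℝ (Fin d)) :
    ∫ ω : EuclideanSpace ℝ (Fin d), (laplaceDensity t ω : ℂ) *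
      Complex.exp (2 * Real.pi * Complex.I * ((⟪ω, y⟫ : ℝ) : ℂ))
      = Real.exp (-(t * ∑ j, |y j|)) := by
  have h := integral_fintype_prod_volume_eq_prod (𝕜 := ℂ) (ι := Fin d) (E := fun _ => ℝ)
    (fun j ζ => (laplaceDensity₁ t ζ : ℂ) *
      Complex.exp (2 * Real.pi * Complex.I * ((ζ * y j : ℝ) : ℂ)))
  have h2 := (PiLp.volume_preserving_ofLp (Fin d)).integral_comp
    (MeasurableEquiv.toLp 2 (Fin d → ℝ)).symm.measurableEmbedding
    (fun x : Fin d → ℝ => ∏ j, ((laplaceDensity₁ t (x j) : ℂ) *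
      Complex.exp (2 * Real.pi * Complex.I * ((x j * y j : ℝ) : ℂ))))
  rw [h] at h2
  simp only [integral_laplaceDensity₁_mul_exp ht] at h2
  rw [Finset.mul_sum, ← Finset.sum_neg_distrib, Real.exp_sum, Complex.ofReal_prod, ← h2]
  refine integral_congr_ae (Eventually.of_forall fun ω => ?_)
  change (laplaceDensity t ω : ℂ) *
    Complex.exp (2 * Real.pi * Complex.I * ((⟪ω, y⟫ : ℝ) : ℂ)) = ∏ j, _
  rw [Finset.prod_mul_distrib, ← Complex.exp_sum, laplaceDensity_eq_prod, Complex.ofReal_prod]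
  congr 2
  rw [← Finset.mul_sum, ← Complex.ofReal_sum]
  rw [PiLp.inner_apply]
  simp only [RCLike.inner_apply, conj_trivial, mul_comm]

end Laplace

/-! ### The character `exp(2πix)`. -/

section Character

/-- The character `x ↦ exp (2πix)` of the line. -/
noncomputable def echar (x : ℝ) : ℂ := Complex.exp (2 * Real.pi * Complex.I * (x : ℂ))

theorem norm_echar (x : ℝ) : ‖echar x‖ = 1 := by
  rw [echar, Complex.norm_exp]; simp

theorem echar_zero : echar 0 = 1 := by simp [echar]

theorem echar_add (x y : ℝ) : echar (x + y) = echar x * echar y := by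
  rw [echar, echar, echar, ← Complex.exp_add]; congr 1; push_cast; ring

theorem echar_neg (x : ℝ) :
    echar (-x) = Complex.exp (-(2 * Real.pi * Complex.I * (x : ℂ))) := by
  rw [echar]; congr 1; push_cast; ring

theorem conj_echar (x : ℝ) : (starRingEnd ℂ) (echar x) = echar (-x) := by
  rw [echar, echar, ← Complex.exp_conj]; congr 1; simp [map_ofNat]

@[fun_prop]
theorem continuous_echar : Continuous echar := by unfold echar; fun_prop

@[fun_prop]
theorem measurable_echar : Measurable echar := continuous_echar.measurable

theorem norm_echar_sub_one_le (x : ℝ) : ‖echar x - 1‖ ≤ 2 * Real.pi * |x| := by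
  have h := Real.norm_exp_I_mul_ofReal_sub_one_le (x := 2 * Real.pi * x)
  have h2 : Complex.I * ((2 * Real.pi * x : ℝ) : ℂ) = 2 * Real.pi * Complex.I * (x : ℂ) := by
    push_cast; ring
  rw [h2] at h
  refine h.trans (le_of_eq ?_)
  rw [Real.norm_eq_abs, abs_mul, abs_of_pos (by positivity)]

end Character

/-! ### The spectral density of the `ℓ₁`-type kernel. -/

section Density

variable {d : ℕ}

@[fun_prop]
theorem measurable_uncurry_laplaceDensity :
    Measurable (fun p : ℝ × EuclideanSpace ℝ (Fin d) => laplaceDensity p.1 p.2) := by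
  unfold laplaceDensity; fun_prop

theorem laplaceDensity_nonneg {t : ℝ} (ht : 0 ≤ t) (ω : EuclideanSpace ℝ (Fin d)) :
    0 ≤ laplaceDensity t ω := by
  unfold laplaceDensity; positivity

theorem laplaceDensity_le {a t : ℝ} (ha : 0 < a) (hat : a ≤ t) (ω : EuclideanSpace ℝ (Fin d)) :
    laplaceDensity t ω ≤ (2 / a) ^ d := by
  rw [laplaceDensity_eq_prod]
  calc ∏ j, laplaceDensity₁ t (ω j) ≤ ∏ _j : Fin d, (2 / a) := by
        refine Finset.prod_le_prod (fun j _ => laplaceDensity₁_nonneg (ha.le.trans hat) _)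
          (fun j _ => (laplaceDensity₁_le (ha.trans_le hat) _).trans ?_)
        gcongr
    _ = (2 / a) ^ d := by rw [Finset.prod_const, Finset.card_univ, Fintype.card_fin]

/-- The bound does not depend on `t`; it yields positivity of `k` and the lower bounds on balls of
frequencies used for strict descent. -/
theorem le_laplaceDensity {a b t : ℝ} (ha : 0 < a) (ht : t ∈ Set.Icc a b)
    (ω : EuclideanSpace ℝ (Fin d)) :
    ∏ j, 2 * a / (4 * Real.pi ^ 2 * ω j ^ 2 + b ^ 2) ≤ laplaceDensity t ω := by
  have h1 := ht.1
  have h2 := ht.2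
  have h3 : 0 < t := ha.trans_le h1
  unfold laplaceDensity
  refine Finset.prod_le_prod (fun j _ => by positivity) (fun j _ => ?_)
  gcongr

theorem lintegral_laplaceDensity {t : ℝ} (ht : 0 < t) :
    ∫⁻ ω : EuclideanSpace ℝ (Fin d), ENNReal.ofReal (laplaceDensity t ω) = 1 := by
  rw [← ofReal_integral_eq_lintegral_ofReal (integrable_laplaceDensity ht)
    (Eventually.of_forall fun ω => laplaceDensity_nonneg ht.le ω)]
  have h := integral_laplaceDensity_mul_exp ht (0 : EuclideanSpace ℝ (Fin d))
  simp only [inner_zero_right, Complex.ofReal_zero, mul_zero, Complex.exp_zero, mul_one,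
    PiLp.zero_apply, abs_zero, Finset.sum_const_zero, neg_zero, Real.exp_zero,
    Complex.ofReal_one] at h
  rw [integral_complex_ofReal] at h
  rw [Complex.ofReal_eq_one.1 h, ENNReal.ofReal_one]

/-- The profile `y ↦ ∫ exp (-t ‖y‖₁) μ(dt)` of the `ℓ₁`-type kernel. -/
noncomputable def lOneKernel (μ : Measure ℝ) (y : EuclideanSpace ℝ (Fin d)) : ℝ :=
  ∫ t, Real.exp (-(t * ∑ j, |y j|)) ∂μ

/-- `k` is a bounded positive integrable density on `ℝ^d` with Fourier transform `K`. -/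
structure IsSpectralDensity (k K : EuclideanSpace ℝ (Fin d) → ℝ) : Prop where
  measurable : Measurable k
  integrable : Integrable k
  pos : ∀ ω, 0 < k ω
  bounded : ∃ M, ∀ ω, k ω ≤ M
  eq_integral : ∀ y, (K y : ℂ) = ∫ ω, (k ω : ℂ) * echar ⟪ω, y⟫

variable {μ : Measure ℝ} [IsFiniteMeasure μ] {a b : ℝ}

theorem integrable_prod_laplaceDensity (ha : 0 < a) (hμ : ∀ᵐ t ∂μ, t ∈ Set.Icc a b) :
    Integrable (fun p : ℝ × EuclideanSpace ℝ (Fin d) => laplaceDensity p.1 p.2)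
      (μ.prod volume) := by
  rw [integrable_prod_iff measurable_uncurry_laplaceDensity.aestronglyMeasurable]
  have hpos : ∀ᵐ t ∂μ, 0 < t := hμ.mono fun t ht => ha.trans_le ht.1
  refine ⟨hpos.mono fun t ht => integrable_laplaceDensity ht, ?_⟩
  refine (integrable_const (1 : ℝ)).congr ?_
  filter_upwards [hpos] with t ht
  rw [integral_norm_eq_lintegral_enorm (integrable_laplaceDensity ht).aestronglyMeasurable]
  rw [lintegral_congr (g := fun ω : EuclideanSpace ℝ (Fin d) =>
    ENNReal.ofReal (laplaceDensity t ω))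
    (fun ω => Real.enorm_of_nonneg (laplaceDensity_nonneg ht.le ω)), lintegral_laplaceDensity ht]
  simp

theorem ae_integrable_laplaceDensity_apply (ha : 0 < a) (hμ : ∀ᵐ t ∂μ, t ∈ Set.Icc a b)
    (ω : EuclideanSpace ℝ (Fin d)) : Integrable (fun t => laplaceDensity t ω) μ := by
  refine Integrable.of_bound
    (measurable_uncurry_laplaceDensity.comp measurable_prodMk_right).aestronglyMeasurable
    ((2 / a) ^ d) ?_
  filter_upwards [hμ] with t ht
  rw [Real.norm_of_nonneg (laplaceDensity_nonneg (ha.le.trans ht.1) ω)]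
  exact laplaceDensity_le ha ht.1 ω

theorem measurable_lOneDensity : Measurable (lOneDensity d μ) := by
  have h : StronglyMeasurable (fun p : EuclideanSpace ℝ (Fin d) × ℝ => laplaceDensity p.2 p.1) :=
    (measurable_uncurry_laplaceDensity.comp measurable_swap).stronglyMeasurable
  exact h.integral_prod_right.measurable

theorem le_lOneDensity (ha : 0 < a) (hμ : ∀ᵐ t ∂μ, t ∈ Set.Icc a b)
    (ω : EuclideanSpace ℝ (Fin d)) :
    μ.real Set.univ * ∏ j, 2 * a / (4 * Real.pi ^ 2 * ω j ^ 2 + b ^ 2) ≤ lOneDensity d μ ω := by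
  rw [← smul_eq_mul, ← integral_const]
  refine integral_mono_ae (integrable_const _) (ae_integrable_laplaceDensity_apply ha hμ ω) ?_
  filter_upwards [hμ] with t ht using le_laplaceDensity ha ht ω

theorem lOneDensity_le (ha : 0 < a) (hμ : ∀ᵐ t ∂μ, t ∈ Set.Icc a b)
    (ω : EuclideanSpace ℝ (Fin d)) :
    lOneDensity d μ ω ≤ μ.real Set.univ * (2 / a) ^ d := by
  rw [← smul_eq_mul, ← integral_const]
  refine integral_mono_ae (ae_integrable_laplaceDensity_apply ha hμ ω) (integrable_const _) ?_
  filter_upwards [hμ] with t ht using laplaceDensity_le ha ht.1 ω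

theorem isSpectralDensity_lOneDensity (ha : 0 < a) (hab : a ≤ b)
    (hμ : ∀ᵐ t ∂μ, t ∈ Set.Icc a b) (hμ0 : μ ≠ 0) :
    IsSpectralDensity (lOneDensity d μ) (lOneKernel μ) where
  measurable := measurable_lOneDensity
  integrable := (integrable_prod_laplaceDensity ha hμ).integral_prod_right
  pos ω := by
    refine lt_of_lt_of_le ?_ (le_lOneDensity ha hμ ω)
    have hb : 0 < b := ha.trans_le hab
    have : 0 < μ.real Set.univ := by
      simpa [Measure.real, ENNReal.toReal_pos_iff, pos_iff_ne_zero] using hμ0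
    positivity
  bounded := ⟨_, lOneDensity_le ha hμ⟩
  eq_integral y := by
    have hi : Integrable (Function.uncurry fun (t : ℝ) (ω : EuclideanSpace ℝ (Fin d)) =>
        (laplaceDensity t ω : ℂ) * echar ⟪ω, y⟫) (μ.prod volume) := by
      refine ((integrable_prod_laplaceDensity (d := d) ha hμ).ofReal (𝕜 := ℂ)).mul_bdd
        (c := 1) (by fun_prop) (Eventually.of_forall fun p => (norm_echar _).le)
    have h := integral_integral_swap hi
    have h1 : ∀ᵐ t ∂μ, (∫ ω : EuclideanSpace ℝ (Fin d), (laplaceDensity t ω : ℂ) * echar ⟪ω, y⟫)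
        = ((Real.exp (-(t * ∑ j, |y j|)) : ℝ) : ℂ) := by
      filter_upwards [hμ] with t ht
      exact integral_laplaceDensity_mul_exp (ha.trans_le ht.1) y
    rw [lOneKernel, ← integral_complex_ofReal, ← integral_congr_ae h1, h]
    refine integral_congr_ae (Eventually.of_forall fun ω => ?_)
    simp only [lOneDensity]
    rw [integral_mul_const, integral_complex_ofReal]

end Density

/-! ### Continuity and boundedness of a kernel with a spectral density. -/

section SpectralDensity

variable {d : ℕ} {k K : EuclideanSpace ℝ (Fin d) → ℝ}

theorem IsSpectralDensity.continuous (h : IsSpectralDensity k K) : Continuous K := by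
  have h1 : Continuous (fun y => (K y : ℂ)) := by
    simp_rw [h.eq_integral]
    refine continuous_of_dominated (bound := k) (fun y => ?_) (fun y => ?_) h.integrable ?_
    · have := h.measurable
      exact Measurable.aestronglyMeasurable (by fun_prop)
    · refine Eventually.of_forall fun ω => ?_
      rw [norm_mul, norm_echar, mul_one, Complex.norm_of_nonneg (h.pos ω).le]
    · exact Eventually.of_forall fun ω => by fun_prop
  exact Complex.continuous_re.comp h1

theorem IsSpectralDensity.abs_le (h : IsSpectralDensity k K) (y : EuclideanSpace ℝ (Fin d)) :
    |K y| ≤ ∫ ω, k ω := by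
  rw [← Real.norm_eq_abs, ← Complex.norm_real, h.eq_integral]
  refine norm_integral_le_of_norm_le h.integrable (Eventually.of_forall fun ω => ?_)
  rw [norm_mul, norm_echar, mul_one, Complex.norm_of_nonneg (h.pos ω).le]

end SpectralDensity

/-! ### Quadratic forms of kernels over independent copies. -/

section QuadraticForm

variable {Ω : Type*} [MeasurableSpace Ω] {P : Measure Ω}

/-- The bilinear form `(g, g') ↦ E[κ(w, w') g(w) g'(w')]` over independent copies `w, w'`. -/
noncomputable def kernelForm (P : Measure Ω) (κ : Ω × Ω → ℝ) (g g' : Ω → ℝ) : ℝ :=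
  ∫ p, κ p * (g p.1 * g' p.2) ∂(P.prod P)

variable [IsProbabilityMeasure P] {Z : Type*} [MeasurableSpace Z] {ν : Measure Z}
  [IsFiniteMeasure ν] {g : Ω → ℝ} {θ : Ω → Z → ℝ}

theorem norm_integral_mul_echar_le (g : Ω → ℝ) (φ : Ω → ℝ) :
    ‖∫ w, (g w : ℂ) * echar (φ w) ∂P‖ ≤ ∫ w, |g w| ∂P := by
  refine (norm_integral_le_integral_norm _).trans (le_of_eq ?_)
  congr 1; funext w
  rw [norm_mul, norm_echar, mul_one, Complex.norm_real, Real.norm_eq_abs]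

theorem aestronglyMeasurable_integral_mul_echar (hg : Integrable g P)
    (hθ : Measurable (Function.uncurry θ)) :
    AEStronglyMeasurable (fun z => ∫ w, (g w : ℂ) * echar (-θ w z) ∂P) ν := by
  have h : AEStronglyMeasurable (fun p : Z × Ω => (g p.2 : ℂ) * echar (-θ p.2 p.1))
      (ν.prod P) := by
    refine AEStronglyMeasurable.mul
      (Complex.continuous_ofReal.comp_aestronglyMeasurable hg.aestronglyMeasurable.comp_snd) ?_
    exact (measurable_echar.comp (hθ.comp measurable_swap).neg).aestronglyMeasurable
  exact h.integral_prod_right'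

theorem integrable_normSq_integral_mul_echar (hg : Integrable g P)
    (hθ : Measurable (Function.uncurry θ)) :
    Integrable (fun z => ‖∫ w, (g w : ℂ) * echar (-θ w z) ∂P‖ ^ 2) ν := by
  refine Integrable.of_bound
    ((aestronglyMeasurable_integral_mul_echar hg hθ).norm.pow 2) ((∫ w, |g w| ∂P) ^ 2)
    (Eventually.of_forall fun z => ?_)
  rw [norm_pow, norm_norm]
  exact pow_le_pow_left₀ (norm_nonneg _) (norm_integral_mul_echar_le g _) 2

theorem integrable_kernelForm {g' : Ω → ℝ} {κ : Ω × Ω → ℝ} {M : ℝ} (hg : Integrable g P)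
    (hg' : Integrable g' P) (hκ : Measurable κ) (hM : ∀ p, |κ p| ≤ M) :
    Integrable (fun p : Ω × Ω => κ p * (g p.1 * g' p.2)) (P.prod P) :=
  (hg.mul_prod hg').bdd_mul hκ.aestronglyMeasurable (Eventually.of_forall hM)

/-- The quadratic form of a kernel with spectral measure `ν`. -/
theorem kernelForm_self_eq_integral_normSq (hg : Integrable g P)
    (hθ : Measurable (Function.uncurry θ)) {κ : Ω × Ω → ℝ}
    (hκ : ∀ p : Ω × Ω, (κ p : ℂ) = ∫ z, echar (θ p.1 z - θ p.2 z) ∂ν) :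
    kernelForm P κ g g = ∫ z, ‖∫ w, (g w : ℂ) * echar (-θ w z) ∂P‖ ^ 2 ∂ν := by
  have hgc : Integrable (fun w => (g w : ℂ)) P := hg.ofReal
  have h1 : Measurable (fun q : (Ω × Ω) × Z => θ q.1.1 q.2) :=
    hθ.comp ((measurable_fst.comp measurable_fst).prodMk measurable_snd)
  have h2 : Measurable (fun q : (Ω × Ω) × Z => θ q.1.2 q.2) :=
    hθ.comp ((measurable_snd.comp measurable_fst).prodMk measurable_snd)
  have hint : Integrable (Function.uncurry fun (p : Ω × Ω) (z : Z) =>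
      echar (θ p.1 z - θ p.2 z) * ((g p.1 : ℂ) * (g p.2 : ℂ))) ((P.prod P).prod ν) := by
    refine Integrable.bdd_mul (c := 1) ((hgc.mul_prod hgc).comp_fst ν)
      (measurable_echar.comp (h1.sub h2)).aestronglyMeasurable
      (Eventually.of_forall fun q => (norm_echar _).le)
  have hc : ((kernelForm P κ g g : ℝ) : ℂ)
      = ((∫ z, ‖∫ w, (g w : ℂ) * echar (-θ w z) ∂P‖ ^ 2 ∂ν : ℝ) : ℂ) := by
    rw [kernelForm, ← integral_complex_ofReal, ← integral_complex_ofReal]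
    calc ∫ p : Ω × Ω, ((κ p * (g p.1 * g p.2) : ℝ) : ℂ) ∂(P.prod P)
        = ∫ p : Ω × Ω, ∫ z, echar (θ p.1 z - θ p.2 z) * ((g p.1 : ℂ) * (g p.2 : ℂ)) ∂ν
            ∂(P.prod P) := by
          refine integral_congr_ae (Eventually.of_forall fun p => ?_)
          simp only
          rw [integral_mul_const, ← hκ]; push_cast; ring
      _ = ∫ z, ∫ p : Ω × Ω, echar (θ p.1 z - θ p.2 z) * ((g p.1 : ℂ) * (g p.2 : ℂ))
            ∂(P.prod P) ∂ν := integral_integral_swap hint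
      _ = _ := by
          refine integral_congr_ae (Eventually.of_forall fun z => ?_)
          simp only
          rw [Complex.ofReal_pow, ← Complex.conj_mul', ← integral_conj, ← integral_prod_mul]
          refine integral_congr_ae (Eventually.of_forall fun p => ?_)
          simp only [map_mul, Complex.conj_ofReal, conj_echar, neg_neg]
          rw [sub_eq_add_neg, echar_add]; ring
  exact_mod_cast hc

end QuadraticForm

/-! ### Fourier inversion and duality on `H`. -/

section RKHS

variable {Ω : Type*} [MeasurableSpace Ω] {P : Measure Ω} [IsProbabilityMeasure P] {d : ℕ}
  {k K : EuclideanSpace ℝ (Fin d) → ℝ} {Z : Ω → EuclideanSpace ℝ (Fin d)} {g : Ω → ℝ}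

/-- The random feature `ω ↦ E[g exp (-2πi⟨ω, Z⟩)]`. -/
noncomputable def featureTransform (P : Measure Ω) (Z : Ω → EuclideanSpace ℝ (Fin d))
    (g : Ω → ℝ) (ω : EuclideanSpace ℝ (Fin d)) : ℂ :=
  ∫ w, (g w : ℂ) * echar (-⟪ω, Z w⟫) ∂P

theorem measurable_uncurry_inner (hZ : Measurable Z) :
    Measurable (Function.uncurry fun (w : Ω) (ω : EuclideanSpace ℝ (Fin d)) => ⟪ω, Z w⟫) := by
  unfold Function.uncurry
  exact Measurable.inner measurable_snd (hZ.comp measurable_fst)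

theorem norm_featureTransform_le (ω : EuclideanSpace ℝ (Fin d)) :
    ‖featureTransform P Z g ω‖ ≤ ∫ w, |g w| ∂P :=
  norm_integral_mul_echar_le g _

theorem norm_integral_mul_echar_pos (ω : EuclideanSpace ℝ (Fin d)) :
    ‖∫ w, (g w : ℂ) * echar ⟪ω, Z w⟫ ∂P‖ = ‖featureTransform P Z g ω‖ := by
  rw [featureTransform, ← RCLike.norm_conj (K := ℂ), ← integral_conj]
  simp only [map_mul, Complex.conj_ofReal, conj_echar]

theorem aestronglyMeasurable_featureTransform (hg : Integrable g P) (hZ : Measurable Z) :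
    AEStronglyMeasurable (featureTransform P Z g) volume := by
  have h : AEStronglyMeasurable (fun p : EuclideanSpace ℝ (Fin d) × Ω =>
      (g p.2 : ℂ) * echar (-⟪p.1, Z p.2⟫)) (volume.prod P) := by
    refine AEStronglyMeasurable.mul
      (Complex.continuous_ofReal.comp_aestronglyMeasurable hg.aestronglyMeasurable.comp_snd) ?_
    exact (measurable_echar.comp
      ((measurable_uncurry_inner hZ).comp measurable_swap).neg).aestronglyMeasurable
  exact h.integral_prod_right'

/-- The quadratic form of `K(Z - Z')` in terms of the spectral density. -/
theorem IsSpectralDensity.integral_normSq_featureTransform (h : IsSpectralDensity k K)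
    (hg : Integrable g P) (hZ : Measurable Z) :
    Integrable (fun ω => ‖featureTransform P Z g ω‖ ^ 2 * k ω) ∧
    ∫ ω, ‖featureTransform P Z g ω‖ ^ 2 * k ω
      = kernelForm P (fun p => K (Z p.1 - Z p.2)) g g := by
  have hb : Integrable (fun ω => ‖featureTransform P Z g ω‖ ^ 2 * k ω) := by
    refine h.integrable.bdd_mul (c := (∫ w, |g w| ∂P) ^ 2)
      ((aestronglyMeasurable_featureTransform hg hZ).norm.pow 2)
      (Eventually.of_forall fun z => ?_)
    rw [norm_pow, norm_norm]
    exact pow_le_pow_left₀ (norm_nonneg _) (norm_featureTransform_le _) 2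
  refine ⟨hb, ?_⟩
  have hfin : IsFiniteMeasure (volume.withDensity fun ω => ENNReal.ofReal (k ω)) :=
    isFiniteMeasure_withDensity_ofReal h.integrable.2
  have hkm : Measurable fun ω => (k ω).toNNReal := h.measurable.real_toNNReal
  rw [kernelForm_self_eq_integral_normSq (ν := volume.withDensity fun ω => ENNReal.ofReal (k ω))
    hg (measurable_uncurry_inner hZ)]
  · refine Eq.trans ?_ (integral_withDensity_eq_integral_smul hkm _).symm
    refine integral_congr_ae (Eventually.of_forall fun ω => ?_)
    simp only [NNReal.smul_def, Real.coe_toNNReal _ (h.pos ω).le, smul_eq_mul]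
    rw [mul_comm]; rfl
  · intro p
    rw [h.eq_integral]
    refine Eq.trans ?_ (integral_withDensity_eq_integral_smul hkm _).symm
    refine integral_congr_ae (Eventually.of_forall fun ω => ?_)
    simp only [NNReal.smul_def, Real.coe_toNNReal _ (h.pos ω).le, inner_sub_right]
    rw [Complex.real_smul]

theorem FourierRKHS.normSq_eq (hk : IsSpectralDensity k K) (f : FourierRKHS k) :
    Integrable (fun ω => ‖fourierL2 (fun x => (f.toFun x : ℂ)) f.memLp_toFun ω‖ ^ 2 / k ω) ∧
    f.normSq = ∫ ω, ‖fourierL2 (fun x => (f.toFun x : ℂ)) f.memLp_toFun ω‖ ^ 2 / k ω := by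
  set F := fourierL2 (fun x => (f.toFun x : ℂ)) f.memLp_toFun with hF
  have hFm : AEStronglyMeasurable F volume := (Lp.memLp _).1
  have hm : AEStronglyMeasurable (fun ω => ‖F ω‖ ^ 2 / k ω) volume :=
    ((hFm.norm.pow 2).aemeasurable.div hk.measurable.aemeasurable).aestronglyMeasurable
  have hnn : ∀ ω, 0 ≤ ‖F ω‖ ^ 2 / k ω := fun ω => div_nonneg (by positivity) (hk.pos ω).le
  have heq : ∀ ω, ‖F ω‖ₑ ^ 2 / ENNReal.ofReal (k ω) = ENNReal.ofReal (‖F ω‖ ^ 2 / k ω) := by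
    intro ω
    rw [ENNReal.ofReal_div_of_pos (hk.pos ω), ENNReal.ofReal_pow (norm_nonneg _), ofReal_norm]
  have hlt : ∫⁻ ω, ENNReal.ofReal (‖F ω‖ ^ 2 / k ω) < ∞ := by
    simpa only [← hF, heq] using f.energy_lt_top
  refine ⟨⟨hm, ?_⟩, ?_⟩
  · rwa [hasFiniteIntegral_iff_ofReal (Eventually.of_forall hnn)]
  · rw [integral_eq_lintegral_of_nonneg_ae (Eventually.of_forall hnn) hm, FourierRKHS.normSq]
    simp only [← hF, heq]

/-- Fourier inversion on `H`. -/
theorem FourierRKHS.eq_fourierInv (hk : IsSpectralDensity k K) (f : FourierRKHS k) :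
    Integrable (fourierL2 (fun x => (f.toFun x : ℂ)) f.memLp_toFun) ∧
    ∀ y, (f.toFun y : ℂ) =
      ∫ ω, fourierL2 (fun x => (f.toFun x : ℂ)) f.memLp_toFun ω * echar ⟪ω, y⟫ := by
  set F := fourierL2 (fun x => (f.toFun x : ℂ)) f.memLp_toFun with hF
  have hF2 : MemLp F 2 volume := Lp.memLp _
  -- Finite energy gives integrability through `|F| ≤ |F|²/k + k`.
  have hF1 : Integrable F := by
    refine Integrable.mono' ((f.normSq_eq hk).1.add hk.integrable) hF2.1
      (Eventually.of_forall fun ω => ?_)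
    have h0 := hk.pos ω
    simp only [Pi.add_apply, ← hF]
    rw [div_add' _ _ _ h0.ne', le_div_iff₀ h0]
    nlinarith [sq_nonneg (‖F ω‖ - k ω), norm_nonneg (F ω)]
  refine ⟨hF1, ?_⟩
  have hae : (fun x => (f.toFun x : ℂ)) =ᵐ[volume] 𝓕⁻ F := by
    have h1 := fourierInv_toLp_ae_eq hF1 hF2
    have h2 : hF2.toLp F = 𝓕 (f.memLp_toFun.toLp _ :
        Lp ℂ 2 (volume : Measure (EuclideanSpace ℝ (Fin d)))) := Lp.toLp_coeFn _ _
    rw [h2, FourierTransform.fourierInv_fourier_eq] at h1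
    exact f.memLp_toFun.coeFn_toLp.symm.trans h1
  have hrep : ∀ y, 𝓕⁻ F y = ∫ ω, F ω * echar ⟪ω, y⟫ := by
    intro y
    rw [Real.fourierInv_eq']
    refine integral_congr_ae (Eventually.of_forall fun ω => ?_)
    simp only [smul_eq_mul, echar]
    rw [mul_comm]; congr 2; push_cast; ring
  have hc : Continuous (𝓕⁻ F) := by
    have : 𝓕⁻ F = fun y => ∫ ω, F ω * echar ⟪ω, y⟫ := funext hrep
    rw [this]
    refine continuous_of_dominated (bound := fun ω => ‖F ω‖) (fun y => ?_) (fun y => ?_)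
      hF1.norm ?_
    · exact hF1.1.mul (Measurable.aestronglyMeasurable (by fun_prop))
    · exact Eventually.of_forall fun ω => by rw [norm_mul, norm_echar, mul_one]
    · exact Eventually.of_forall fun ω => by fun_prop
  have hfc : Continuous (fun x => (f.toFun x : ℂ)) :=
    Complex.continuous_ofReal.comp f.continuous_toFun
  intro y
  rw [← hrep]
  exact congrFun ((hfc.ae_eq_iff_eq volume hc).1 hae) y

theorem FourierRKHS.memLp_comp (hk : IsSpectralDensity k K) (f : FourierRKHS k)
    (hZ : Measurable Z) : MemLp (fun w => f.toFun (Z w)) 2 P := by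
  obtain ⟨hF1, hf⟩ := f.eq_fourierInv hk
  refine MemLp.of_bound (f.continuous_toFun.measurable.comp hZ).aestronglyMeasurable
    (∫ ω, ‖fourierL2 (fun x => (f.toFun x : ℂ)) f.memLp_toFun ω‖)
    (Eventually.of_forall fun w => ?_)
  rw [← Complex.norm_real, hf]
  refine norm_integral_le_of_norm_le hF1.norm (Eventually.of_forall fun ω => ?_)
  rw [norm_mul, norm_echar, mul_one]

/-- Duality between `H` and the quadratic form of its kernel. -/
theorem FourierRKHS.two_mul_integral_comp_mul_le (hk : IsSpectralDensity k K) (f : FourierRKHS k)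
    (hZ : Measurable Z) (hg : Integrable g P) :
    2 * ∫ w, f.toFun (Z w) * g w ∂P
      ≤ f.normSq + kernelForm P (fun p => K (Z p.1 - Z p.2)) g g := by
  obtain ⟨hF1, hf⟩ := f.eq_fourierInv hk
  obtain ⟨hN, hNeq⟩ := f.normSq_eq hk
  obtain ⟨hQ, hQeq⟩ := hk.integral_normSq_featureTransform hg hZ
  set F := fourierL2 (fun x => (f.toFun x : ℂ)) f.memLp_toFun with hF
  have hint : Integrable (Function.uncurry fun (w : Ω) (ω : EuclideanSpace ℝ (Fin d)) =>
      echar ⟪ω, Z w⟫ * ((g w : ℂ) * F ω)) (P.prod volume) :=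
    Integrable.bdd_mul (c := 1) ((hg.ofReal (𝕜 := ℂ)).mul_prod hF1)
      (measurable_echar.comp (measurable_uncurry_inner hZ)).aestronglyMeasurable
      (Eventually.of_forall fun q => (norm_echar _).le)
  have hswap : ((∫ w, f.toFun (Z w) * g w ∂P : ℝ) : ℂ)
      = ∫ ω, F ω * ∫ w, (g w : ℂ) * echar ⟪ω, Z w⟫ ∂P := by
    rw [← integral_complex_ofReal]
    calc ∫ w, ((f.toFun (Z w) * g w : ℝ) : ℂ) ∂P
        = ∫ w, (∫ ω, echar ⟪ω, Z w⟫ * ((g w : ℂ) * F ω)) ∂P := by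
          refine integral_congr_ae (Eventually.of_forall fun w => ?_)
          simp only
          rw [Complex.ofReal_mul, hf, ← integral_mul_const]
          congr 1; funext ω; ring
      _ = ∫ ω, ∫ w, echar ⟪ω, Z w⟫ * ((g w : ℂ) * F ω) ∂P := integral_integral_swap hint
      _ = _ := by
          congr 1; funext ω
          rw [← integral_const_mul]; congr 1; funext w; ring
  calc 2 * ∫ w, f.toFun (Z w) * g w ∂P
      ≤ 2 * ‖((∫ w, f.toFun (Z w) * g w ∂P : ℝ) : ℂ)‖ := by
        rw [Complex.norm_real]
        exact mul_le_mul_of_nonneg_left (Real.le_norm_self _) zero_le_two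
    _ ≤ 2 * ∫ ω, (‖F ω‖ ^ 2 / k ω + ‖featureTransform P Z g ω‖ ^ 2 * k ω) / 2 := by
        rw [hswap]
        refine mul_le_mul_of_nonneg_left (norm_integral_le_of_norm_le
          ((hN.add hQ).div_const 2) (Eventually.of_forall fun ω => ?_)) zero_le_two
        rw [norm_mul, norm_integral_mul_echar_pos]
        have h0 := hk.pos ω
        -- Young's inequality weighted by `k`; equality holds when `F = Φ k` with `Φ` the feature
        -- transform, which is the case for the representer.
        have h1 : ‖F ω‖ ^ 2 / k ω + ‖featureTransform P Z g ω‖ ^ 2 * k ω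
            - 2 * (‖F ω‖ * ‖featureTransform P Z g ω‖)
            = (‖F ω‖ - ‖featureTransform P Z g ω‖ * k ω) ^ 2 / k ω := by
          field_simp; ring
        have h2 : 0 ≤ (‖F ω‖ - ‖featureTransform P Z g ω‖ * k ω) ^ 2 / k ω := by positivity
        linarith
    _ = _ := by
        rw [integral_div, integral_add hN hQ, ← hNeq, hQeq]; ring

end RKHS

/-! ### Representers, the dual equation and the optimal value. -/

section Representer

variable {Ω : Type*} [MeasurableSpace Ω] {P : Measure Ω} [IsProbabilityMeasure P] {d : ℕ}
  {k K : EuclideanSpace ℝ (Fin d) → ℝ} {Z : Ω → EuclideanSpace ℝ (Fin d)} {g : Ω → ℝ}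

theorem IsSpectralDensity.integrable_kernel_mul (hk : IsSpectralDensity k K) (hZ : Measurable Z)
    (hg : Integrable g P) (y : EuclideanSpace ℝ (Fin d)) :
    Integrable (fun w => K (y - Z w) * g w) P :=
  hg.bdd_mul (hk.continuous.measurable.comp (measurable_const.sub hZ)).aestronglyMeasurable
    (Eventually.of_forall fun w => hk.abs_le (y - Z w))

/-- The function `y ↦ E[K(y - Z) g]` belongs to `H`. -/
theorem IsSpectralDensity.exists_representer (hk : IsSpectralDensity k K) (hZ : Measurable Z)
    (hg : Integrable g P) :
    ∃ f : FourierRKHS k, (∀ y, f.toFun y = ∫ w, K (y - Z w) * g w ∂P) ∧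
      f.normSq = kernelForm P (fun p => K (Z p.1 - Z p.2)) g g := by
  obtain ⟨hQ, hQeq⟩ := hk.integral_normSq_featureTransform hg hZ
  obtain ⟨M, hM⟩ := hk.bounded
  set Φ := featureTransform P Z g with hΦ
  have hΦm : AEStronglyMeasurable Φ volume := aestronglyMeasurable_featureTransform hg hZ
  set h : EuclideanSpace ℝ (Fin d) → ℂ := fun ω => Φ ω * (k ω : ℂ) with hh
  have hh1 : Integrable h := (hk.integrable.ofReal (𝕜 := ℂ)).bdd_mul hΦm
    (Eventually.of_forall fun ω => norm_featureTransform_le ω)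
  have hh2 : MemLp h 2 volume := by
    rw [memLp_two_iff_integrable_sq_norm hh1.1]
    refine Integrable.mono' (hQ.mul_const M) (hh1.1.norm.pow 2) (Eventually.of_forall fun ω => ?_)
    have h0 := (hk.pos ω).le
    simp only [hh]
    rw [norm_pow, norm_norm, norm_mul, Complex.norm_of_nonneg h0, mul_pow, mul_assoc, sq (k ω)]
    exact mul_le_mul_of_nonneg_left (mul_le_mul_of_nonneg_left (hM ω) h0) (by positivity)
  set F : EuclideanSpace ℝ (Fin d) → ℝ := fun y => ∫ w, K (y - Z w) * g w ∂P with hF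
  have hFc : Continuous F := by
    refine continuous_of_dominated (bound := fun w => (∫ ω, k ω) * |g w|) (fun y => ?_)
      (fun y => ?_) (hg.abs.const_mul _) ?_
    · exact (hk.integrable_kernel_mul hZ hg y).1
    · refine Eventually.of_forall fun w => ?_
      rw [norm_mul]
      exact mul_le_mul_of_nonneg_right (hk.abs_le _) (norm_nonneg _)
    · exact Eventually.of_forall fun w => by have := hk.continuous; fun_prop
  have hrep : ∀ y, (F y : ℂ) = 𝓕⁻ h y := by
    intro y
    have hint : Integrable (Function.uncurry fun (w : Ω) (ω : EuclideanSpace ℝ (Fin d)) =>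
        echar (⟪ω, y⟫ - ⟪ω, Z w⟫) * ((g w : ℂ) * (k ω : ℂ))) (P.prod volume) := by
      refine Integrable.bdd_mul (c := 1)
        ((hg.ofReal (𝕜 := ℂ)).mul_prod (hk.integrable.ofReal (𝕜 := ℂ)))
        (measurable_echar.comp ?_).aestronglyMeasurable
        (Eventually.of_forall fun q => (norm_echar _).le)
      exact Measurable.sub (by fun_prop) (measurable_uncurry_inner hZ)
    calc (F y : ℂ) = ∫ w, ((K (y - Z w) * g w : ℝ) : ℂ) ∂P := integral_complex_ofReal.symm
      _ = ∫ w, (∫ ω, echar (⟪ω, y⟫ - ⟪ω, Z w⟫) * ((g w : ℂ) * (k ω : ℂ))) ∂P := by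
          refine integral_congr_ae (Eventually.of_forall fun w => ?_)
          simp only
          rw [Complex.ofReal_mul, hk.eq_integral, ← integral_mul_const]
          congr 1; funext ω
          rw [inner_sub_right]; ring
      _ = ∫ ω, (∫ w, echar (⟪ω, y⟫ - ⟪ω, Z w⟫) * ((g w : ℂ) * (k ω : ℂ)) ∂P) :=
          integral_integral_swap hint
      _ = 𝓕⁻ h y := by
          rw [Real.fourierInv_eq']
          refine integral_congr_ae (Eventually.of_forall fun ω => ?_)
          have he : Complex.exp (((2 * Real.pi * ⟪ω, y⟫ : ℝ) : ℂ) * Complex.I)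
              = echar ⟪ω, y⟫ := by
            rw [echar]; congr 1; push_cast; ring
          simp only [smul_eq_mul, he, hh, hΦ, featureTransform]
          rw [← integral_mul_const, ← integral_const_mul]
          congr 1; funext w
          rw [sub_eq_add_neg, echar_add]; ring
  have hae : (fun x => (F x : ℂ)) =ᵐ[volume]
      ((𝓕⁻ (hh2.toLp h : Lp ℂ 2 (volume : Measure (EuclideanSpace ℝ (Fin d)))) :
        Lp ℂ 2 (volume : Measure (EuclideanSpace ℝ (Fin d)))) :
        EuclideanSpace ℝ (Fin d) → ℂ) := by
    rw [show (fun x => (F x : ℂ)) = 𝓕⁻ h from funext hrep]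
    exact (fourierInv_toLp_ae_eq hh1 hh2).symm
  have hF2 : MemLp (fun x => (F x : ℂ)) 2 volume := (Lp.memLp _).ae_eq hae.symm
  have hFF : fourierL2 (fun x => (F x : ℂ)) hF2 =ᵐ[volume] h := by
    have h1 : hF2.toLp _ = 𝓕⁻ (hh2.toLp h :
        Lp ℂ 2 (volume : Measure (EuclideanSpace ℝ (Fin d)))) :=
      Lp.ext (hF2.coeFn_toLp.trans hae)
    unfold fourierL2
    rw [h1, FourierTransform.fourier_fourierInv_eq]
    exact hh2.coeFn_toLp
  -- The transform of the representer is `Φ k`, so its energy density `|Φ k|² / k` is the density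
  -- `|Φ|² k` of the quadratic form.
  have hval : ∀ᵐ ω ∂volume, ‖fourierL2 (fun x => (F x : ℂ)) hF2 ω‖ₑ ^ 2 / ENNReal.ofReal (k ω)
      = ENNReal.ofReal (‖Φ ω‖ ^ 2 * k ω) := by
    filter_upwards [hFF] with ω hω
    have h0 := hk.pos ω
    rw [hω, ← ofReal_norm, ← ENNReal.ofReal_pow (norm_nonneg _), ← ENNReal.ofReal_div_of_pos h0]
    simp only [hh]
    rw [norm_mul, Complex.norm_of_nonneg h0.le]
    congr 1; field_simp
  have henergy : ∫⁻ ω, ‖fourierL2 (fun x => (F x : ℂ)) hF2 ω‖ₑ ^ 2 / ENNReal.ofReal (k ω)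
      = ENNReal.ofReal (kernelForm P (fun p => K (Z p.1 - Z p.2)) g g) := by
    rw [lintegral_congr_ae hval, ← hQeq, ofReal_integral_eq_lintegral_ofReal hQ]
    exact Eventually.of_forall fun ω => mul_nonneg (by positivity) (hk.pos ω).le
  refine ⟨⟨F, hFc, hF2, henergy ▸ ENNReal.ofReal_lt_top⟩, fun y => rfl, ?_⟩
  rw [FourierRKHS.normSq]
  simp only
  rw [henergy, ENNReal.toReal_ofReal]
  rw [← hQeq]
  exact integral_nonneg fun ω => mul_nonneg (by positivity) (hk.pos ω).le

theorem kernelForm_eq_integral_mul (hk : IsSpectralDensity k K) (hZ : Measurable Z)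
    {g g' : Ω → ℝ} (hg : Integrable g P) (hg' : Integrable g' P) :
    kernelForm P (fun p => K (Z p.1 - Z p.2)) g g'
      = ∫ w, (∫ w', K (Z w - Z w') * g' w' ∂P) * g w ∂P := by
  have hint := integrable_kernelForm (M := ∫ ω, k ω) hg hg'
    (κ := fun p : Ω × Ω => K (Z p.1 - Z p.2))
    (hk.continuous.measurable.comp ((hZ.comp measurable_fst).sub (hZ.comp measurable_snd)))
    (fun p => hk.abs_le _)
  rw [kernelForm, integral_prod _ hint]
  refine integral_congr_ae (Eventually.of_forall fun w => ?_)
  simp only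
  rw [← integral_mul_const]
  congr 1; funext w'; ring

theorem IsSpectralDensity.kernelForm_nonneg (hk : IsSpectralDensity k K) (hZ : Measurable Z)
    (hg : Integrable g P) : 0 ≤ kernelForm P (fun p => K (Z p.1 - Z p.2)) g g := by
  rw [← (hk.integral_normSq_featureTransform hg hZ).2]
  exact integral_nonneg fun ω => mul_nonneg (by positivity) (hk.pos ω).le

/-- Existence of the dual solution of kernel ridge regression. -/
theorem IsSpectralDensity.exists_dual (hk : IsSpectralDensity k K) (hZ : Measurable Z)
    {Y : Ω → ℝ} (hY : MemLp Y 2 P) {lam : ℝ} (hlam : 0 < lam) :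
    ∃ g : Ω → ℝ, MemLp g 2 P ∧
      ∀ᵐ w ∂P, Y w = (∫ w', K (Z w - Z w') * g w' ∂P) + lam * g w := by
  set M := ∫ ω, k ω with hM
  have hM0 : 0 ≤ M := integral_nonneg fun ω => (hk.pos ω).le
  have hint : ∀ u : Lp ℝ 2 P, Integrable u P := fun u => (Lp.memLp u).integrable one_le_two
  have hmem : ∀ u : Lp ℝ 2 P, MemLp (fun w => ∫ w', K (Z w - Z w') * u w' ∂P) 2 P ∧
      ∀ w, ‖∫ w', K (Z w - Z w') * u w' ∂P‖ ≤ M * ‖u‖ := by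
    intro u
    obtain ⟨f, hf, -⟩ := hk.exists_representer hZ (hint u)
    have hb : ∀ w, ‖∫ w', K (Z w - Z w') * u w' ∂P‖ ≤ M * ‖u‖ := by
      intro w
      calc ‖∫ w', K (Z w - Z w') * u w' ∂P‖ ≤ ∫ w', M * ‖u w'‖ ∂P := by
            refine norm_integral_le_of_norm_le ((hint u).norm.const_mul M)
              (Eventually.of_forall fun w' => ?_)
            rw [norm_mul]
            exact mul_le_mul_of_nonneg_right (hk.abs_le _) (norm_nonneg _)
        _ ≤ M * ‖u‖ := by
            rw [integral_const_mul]
            refine mul_le_mul_of_nonneg_left ?_ hM0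
            rw [integral_norm_eq_lintegral_enorm (hint u).1, ← eLpNorm_one_eq_lintegral_enorm,
              Lp.norm_def]
            exact ENNReal.toReal_mono (Lp.eLpNorm_ne_top u)
              (eLpNorm_le_eLpNorm_of_exponent_le one_le_two (Lp.memLp u).1)
    refine ⟨MemLp.of_bound ?_ (M * ‖u‖) (Eventually.of_forall hb), hb⟩
    simp_rw [← hf]
    exact (f.continuous_toFun.measurable.comp hZ).aestronglyMeasurable
  let T : Lp ℝ 2 P →L[ℝ] Lp ℝ 2 P := LinearMap.mkContinuous
    { toFun := fun u => (hmem u).1.toLp _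
      map_add' := fun u v => by
        rw [← MemLp.toLp_add]
        refine MemLp.toLp_congr _ _ (Eventually.of_forall fun w => ?_)
        simp only [Pi.add_apply]
        rw [← integral_add (hk.integrable_kernel_mul hZ (hint u) _)
          (hk.integrable_kernel_mul hZ (hint v) _)]
        refine integral_congr_ae ?_
        filter_upwards [Lp.coeFn_add u v] with w' hw'
        rw [hw', Pi.add_apply, mul_add]
      map_smul' := fun c u => by
        rw [RingHom.id_apply, ← MemLp.toLp_const_smul]
        refine MemLp.toLp_congr _ _ (Eventually.of_forall fun w => ?_)
        simp only [Pi.smul_apply]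
        rw [smul_eq_mul, ← integral_const_mul]
        refine integral_congr_ae ?_
        filter_upwards [Lp.coeFn_smul c u] with w' hw'
        rw [hw', Pi.smul_apply, smul_eq_mul]; ring } M (fun u => by
      have h := Lp.norm_le_of_ae_bound (f := (hmem u).1.toLp _) (C := M * ‖u‖) (by positivity) (by
        filter_upwards [(hmem u).1.coeFn_toLp] with w hw
        rw [hw]; exact (hmem u).2 w)
      simpa [measureUnivNNReal] using h)
  have hT : ∀ u : Lp ℝ 2 P, (T u : Ω → ℝ) =ᵐ[P] fun w => ∫ w', K (Z w - Z w') * u w' ∂P :=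
    fun u => (hmem u).1.coeFn_toLp
  -- Positivity of the form of `T` makes `T + λ` coercive, and Lax–Milgram solves `(T + λ) g = Y`.
  let S : Lp ℝ 2 P →L[ℝ] Lp ℝ 2 P := T + lam • ContinuousLinearMap.id ℝ _
  let B : Lp ℝ 2 P →L[ℝ] Lp ℝ 2 P →L[ℝ] ℝ :=
    (isBoundedBilinearMap_inner (𝕜 := ℝ) (E := Lp ℝ 2 P)).toContinuousLinearMap.comp S
  have hB : ∀ u v, B u v = ⟪S u, v⟫ := fun u v => rfl
  have hTpos : ∀ u, 0 ≤ ⟪T u, u⟫ := by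
    intro u
    refine (hk.kernelForm_nonneg hZ (hint u)).trans (le_of_eq ?_)
    rw [kernelForm_eq_integral_mul hk hZ (hint u) (hint u), L2.inner_def]
    refine integral_congr_ae ?_
    filter_upwards [hT u] with w hw
    simp only [RCLike.inner_apply, conj_trivial]
    rw [hw]; ring
  have hcoer : IsCoercive B := by
    refine ⟨lam, hlam, fun u => ?_⟩
    rw [hB]
    simp only [S, _root_.add_apply, _root_.smul_apply,
      ContinuousLinearMap.id_apply, inner_add_left, real_inner_smul_left,
      real_inner_self_eq_norm_sq]
    have := hTpos u
    nlinarith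
  set g := hcoer.continuousLinearEquivOfBilin.symm (hY.toLp Y) with hg
  have hSg : S g = hY.toLp Y := by
    refine ext_inner_right ℝ fun v => ?_
    rw [← hB, ← hcoer.continuousLinearEquivOfBilin_apply, hg,
      ContinuousLinearEquiv.apply_symm_apply]
  refine ⟨g, Lp.memLp g, ?_⟩
  have h1 : S g = T g + lam • g := rfl
  rw [h1] at hSg
  filter_upwards [hY.coeFn_toLp, hT g, Lp.coeFn_add (T g) (lam • g), Lp.coeFn_smul lam g]
    with w h2 h3 h4 h5
  rw [← h2, ← hSg, h4, Pi.add_apply, h3, h5, Pi.smul_apply, smul_eq_mul]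

/-- The dual formula for the minimal value of the kernel ridge regression problem. -/
theorem objective_eq_of_dual {X : Ω → EuclideanSpace ℝ (Fin d)} {Y : Ω → ℝ}
    {β : EuclideanSpace ℝ (Fin d)} {lam : ℝ} (hk : IsSpectralDensity k K)
    (hZ : Measurable fun w => had β (X w)) (hY : MemLp Y 2 P) (hlam : 0 < lam)
    (hg : MemLp g 2 P)
    (hdual : ∀ᵐ w ∂P, Y w = (∫ w', K (had β (X w) - had β (X w')) * g w' ∂P) + lam * g w) :
    objective P X Y k β lam = lam * ∫ w, Y w * g w ∂P := by
  set Z := fun w => had β (X w) with hZdef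
  have hg1 : Integrable g P := hg.integrable one_le_two
  obtain ⟨f, hf, hfn⟩ := hk.exists_representer hZ hg1
  have hYg : Integrable (fun w => Y w * g w) P := hY.integrable_mul hg
  have hgg : Integrable (fun w => g w * g w) P := hg.integrable_mul hg
  have hfm := f.memLp_comp (P := P) hk hZ
  have hfg : Integrable (fun w => f.toFun (Z w) * g w) P := hfm.integrable_mul hg
  set Q := kernelForm P (fun p => K (Z p.1 - Z p.2)) g g with hQdef
  have hQ : Q = ∫ w, f.toFun (Z w) * g w ∂P := by
    rw [hQdef, kernelForm_eq_integral_mul hk hZ hg1 hg1]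
    simp only [hf]
  have hYQ : ∫ w, Y w * g w ∂P = Q + lam * ∫ w, g w * g w ∂P := by
    rw [hQ, ← integral_const_mul, ← integral_add hfg (hgg.const_mul _)]
    refine integral_congr_ae ?_
    filter_upwards [hdual] with w hw
    rw [hw, hf]; ring
  -- For the representer `f` of `g` the residual is `λ g`, so the risk is `λ² E[g²] + λ Q`, which is
  -- `λ E[Y g]`.
  have hopt : krrRisk P X Y f β lam = lam * ∫ w, Y w * g w ∂P := by
    have h1 : ∫ w, (Y w - f.toFun (had β (X w))) ^ 2 ∂P = lam ^ 2 * ∫ w, g w * g w ∂P := by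
      rw [← integral_const_mul]
      refine integral_congr_ae ?_
      filter_upwards [hdual] with w hw
      rw [hw, hf]; ring
    rw [krrRisk, h1, hfn, hYQ]; ring
  -- Weak duality: expand `(Y - f' - λ g)² ≥ 0` and bound `2 E[f' g]` by `‖f'‖² + Q`.
  have hlow : ∀ f' : FourierRKHS k, lam * ∫ w, Y w * g w ∂P ≤ krrRisk P X Y f' β lam := by
    intro f'
    have hfm' := f'.memLp_comp (P := P) hk hZ
    have hfg' : Integrable (fun w => f'.toFun (Z w) * g w) P := hfm'.integrable_mul hg
    have h1 := f'.two_mul_integral_comp_mul_le hk hZ hg1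
    have h2 : 2 * lam * (∫ w, Y w * g w ∂P) - 2 * lam * (∫ w, f'.toFun (Z w) * g w ∂P)
        - lam ^ 2 * ∫ w, g w * g w ∂P ≤ ∫ w, (Y w - f'.toFun (had β (X w))) ^ 2 ∂P := by
      have hsub : Integrable (fun w => 2 * lam * (Y w * g w)
          - 2 * lam * (f'.toFun (Z w) * g w)) P := (hYg.const_mul _).sub (hfg'.const_mul _)
      rw [← integral_const_mul, ← integral_const_mul, ← integral_const_mul,
        ← integral_sub (hYg.const_mul _) (hfg'.const_mul _),
        ← integral_sub hsub (hgg.const_mul _)]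
      refine integral_mono (hsub.sub (hgg.const_mul _))
        (hY.sub hfm').integrable_sq fun w => ?_
      have := sq_nonneg (Y w - f'.toFun (Z w) - lam * g w)
      simp only [hZdef] at this ⊢
      nlinarith
    have h3 := mul_le_mul_of_nonneg_left h1 hlam.le
    rw [krrRisk]
    rw [hYQ] at h2 ⊢
    rw [← hQdef] at h3
    nlinarith
  have : Nonempty (FourierRKHS k) := ⟨f⟩
  refine le_antisymm ?_ (le_ciInf hlow)
  rw [← hopt]
  exact ciInf_le ⟨_, Set.forall_mem_range.2 hlow⟩ f

end Representer

/-! ### Cauchy–Schwarz and Hilbert–Schmidt bounds. -/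

section CauchySchwarz

theorem sq_integral_mul_le {α : Type*} [MeasurableSpace α] {ρ : Measure α} {u v : α → ℝ}
    (hu : MemLp u 2 ρ) (hv : MemLp v 2 ρ) :
    (∫ x, u x * v x ∂ρ) ^ 2 ≤ (∫ x, u x ^ 2 ∂ρ) * ∫ x, v x ^ 2 ∂ρ := by
  have h1 := hu.integrable_sq
  have h2 := hv.integrable_sq
  have h3 : Integrable (fun x => u x * v x) ρ := hu.integrable_mul hv
  have h : ∀ c : ℝ, 0 ≤ (∫ x, u x ^ 2 ∂ρ) * (c * c) + 2 * (∫ x, u x * v x ∂ρ) * c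
      + ∫ x, v x ^ 2 ∂ρ := by
    intro c
    have h0 : 0 ≤ ∫ x, (c * u x + v x) ^ 2 ∂ρ := integral_nonneg fun x => sq_nonneg _
    have heq : ∫ x, (c * u x + v x) ^ 2 ∂ρ = (∫ x, u x ^ 2 ∂ρ) * (c * c)
        + 2 * (∫ x, u x * v x ∂ρ) * c + ∫ x, v x ^ 2 ∂ρ := by
      have h12 : Integrable (fun x => (c * c) * u x ^ 2 + (2 * c) * (u x * v x)) ρ :=
        (h1.const_mul _).add (h3.const_mul _)
      rw [show (fun x => (c * u x + v x) ^ 2)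
        = fun x => ((c * c) * u x ^ 2 + (2 * c) * (u x * v x)) + v x ^ 2 by funext x; ring,
        integral_add h12 h2, integral_add (h1.const_mul _) (h3.const_mul _),
        integral_const_mul, integral_const_mul]
      ring
    rwa [heq] at h0
  have := discrim_le_zero h
  rw [discrim] at this
  nlinarith

variable {Ω : Type*} [MeasurableSpace Ω] {P : Measure Ω} [IsProbabilityMeasure P]

theorem memLp_two_tensor {g g' : Ω → ℝ} (hg : MemLp g 2 P) (hg' : MemLp g' 2 P) :
    MemLp (fun p : Ω × Ω => g p.1 * g' p.2) 2 (P.prod P) := by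
  have hm : AEStronglyMeasurable (fun p : Ω × Ω => g p.1 * g' p.2) (P.prod P) :=
    hg.1.comp_fst.mul hg'.1.comp_snd
  rw [memLp_two_iff_integrable_sq hm]
  exact (hg.integrable_sq.mul_prod hg'.integrable_sq).congr
    (Eventually.of_forall fun p => (mul_pow _ _ _).symm)

theorem integrable_kernelForm_of_memLp {κ : Ω × Ω → ℝ} {g g' : Ω → ℝ}
    (hκ : MemLp κ 2 (P.prod P)) (hg : MemLp g 2 P) (hg' : MemLp g' 2 P) :
    Integrable (fun p : Ω × Ω => κ p * (g p.1 * g' p.2)) (P.prod P) :=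
  hκ.integrable_mul (memLp_two_tensor hg hg')

/-- The Hilbert–Schmidt bound for the bilinear form of a square-integrable kernel. -/
theorem sq_kernelForm_le {κ : Ω × Ω → ℝ} {g g' : Ω → ℝ}
    (hκ : MemLp κ 2 (P.prod P)) (hg : MemLp g 2 P) (hg' : MemLp g' 2 P) :
    kernelForm P κ g g' ^ 2
      ≤ (∫ p, κ p ^ 2 ∂(P.prod P)) * ((∫ w, g w ^ 2 ∂P) * ∫ w, g' w ^ 2 ∂P) := by
  refine (sq_integral_mul_le hκ (memLp_two_tensor hg hg')).trans (le_of_eq ?_)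
  congr 1
  rw [← integral_prod_mul]
  simp only [mul_pow]

theorem kernelForm_sub_kernel {κ κ' : Ω × Ω → ℝ} {g g' : Ω → ℝ} (hκ : MemLp κ 2 (P.prod P))
    (hκ' : MemLp κ' 2 (P.prod P)) (hg : MemLp g 2 P) (hg' : MemLp g' 2 P) :
    kernelForm P (fun p => κ p - κ' p) g g' = kernelForm P κ g g' - kernelForm P κ' g g' := by
  rw [kernelForm, kernelForm, kernelForm, ← integral_sub
    (integrable_kernelForm_of_memLp hκ hg hg') (integrable_kernelForm_of_memLp hκ' hg hg')]
  simp only [sub_mul]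

theorem kernelForm_sub_left {κ : Ω × Ω → ℝ} {g₁ g₂ g' : Ω → ℝ} (hκ : MemLp κ 2 (P.prod P))
    (h₁ : MemLp g₁ 2 P) (h₂ : MemLp g₂ 2 P) (hg' : MemLp g' 2 P) :
    kernelForm P κ (fun w => g₁ w - g₂ w) g' = kernelForm P κ g₁ g' - kernelForm P κ g₂ g' := by
  rw [kernelForm, kernelForm, kernelForm, ← integral_sub
    (integrable_kernelForm_of_memLp hκ h₁ hg') (integrable_kernelForm_of_memLp hκ h₂ hg')]
  congr 1; funext p; ring

theorem kernelForm_comm {κ : Ω × Ω → ℝ} (hsymm : ∀ p, κ p.swap = κ p) (g g' : Ω → ℝ) :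
    kernelForm P κ g g' = kernelForm P κ g' g := by
  rw [kernelForm, kernelForm, ← integral_prod_swap]
  congr 1; funext p
  rw [hsymm]; simp only [Prod.fst_swap, Prod.snd_swap]; ring

end CauchySchwarz

/-! ### Envelope estimate for the dual value. -/

section Envelope

variable {Ω : Type*} [MeasurableSpace Ω] {P : Measure Ω} [IsProbabilityMeasure P] {d : ℕ}
  {k K : EuclideanSpace ℝ (Fin d) → ℝ}

theorem IsSpectralDensity.neg (hk : IsSpectralDensity k K) (y : EuclideanSpace ℝ (Fin d)) :
    K (-y) = K y := by
  have h : (K (-y) : ℂ) = (starRingEnd ℂ) (K y : ℂ) := by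
    rw [hk.eq_integral, hk.eq_integral, ← integral_conj]
    simp only [inner_neg_right, map_mul, Complex.conj_ofReal, conj_echar]
  rw [Complex.conj_ofReal] at h
  exact_mod_cast h

theorem IsSpectralDensity.memLp_kernel (hk : IsSpectralDensity k K)
    {Z : Ω → EuclideanSpace ℝ (Fin d)} (hZ : Measurable Z) :
    MemLp (fun p : Ω × Ω => K (Z p.1 - Z p.2)) 2 (P.prod P) :=
  MemLp.of_bound (hk.continuous.measurable.comp ((hZ.comp measurable_fst).sub
    (hZ.comp measurable_snd))).aestronglyMeasurable (∫ ω, k ω)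
    (Eventually.of_forall fun _ => hk.abs_le _)

theorem IsSpectralDensity.kernel_swap (hk : IsSpectralDensity k K)
    (Z : Ω → EuclideanSpace ℝ (Fin d)) (p : Ω × Ω) :
    K (Z p.swap.1 - Z p.swap.2) = K (Z p.1 - Z p.2) := by
  rw [← hk.neg, neg_sub]; rfl

/-- Testing the dual equation against a square-integrable function. -/
theorem integral_mul_eq_of_dual {Z : Ω → EuclideanSpace ℝ (Fin d)} {Y g h : Ω → ℝ} {lam : ℝ}
    (hk : IsSpectralDensity k K) (hZ : Measurable Z) (hg : MemLp g 2 P) (hh : MemLp h 2 P)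
    (hdual : ∀ᵐ w ∂P, Y w = (∫ w', K (Z w - Z w') * g w' ∂P) + lam * g w) :
    ∫ w, Y w * h w ∂P
      = kernelForm P (fun p => K (Z p.1 - Z p.2)) h g + lam * ∫ w, g w * h w ∂P := by
  have hg1 : Integrable g P := hg.integrable one_le_two
  obtain ⟨f, hf, -⟩ := hk.exists_representer hZ hg1
  have hfh : Integrable (fun w => f.toFun (Z w) * h w) P :=
    (f.memLp_comp (P := P) hk hZ).integrable_mul hh
  have hgh : Integrable (fun w => g w * h w) P := hg.integrable_mul hh
  rw [kernelForm_eq_integral_mul hk hZ (hh.integrable one_le_two) hg1]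
  simp only [← hf]
  rw [← integral_const_mul, ← integral_add hfh (hgh.const_mul _)]
  refine integral_congr_ae ?_
  filter_upwards [hdual] with w hw
  rw [hw, hf]; ring

/-- First-order perturbation of the dual optimum with a quadratic error. -/
theorem abs_perturbation_le {Z Z' : Ω → EuclideanSpace ℝ (Fin d)} {Y g g' : Ω → ℝ} {lam : ℝ}
    (hlam : 0 < lam) (hk : IsSpectralDensity k K) (hZ : Measurable Z) (hZ' : Measurable Z')
    (hg : MemLp g 2 P) (hg' : MemLp g' 2 P)
    (hdual : ∀ᵐ w ∂P, Y w = (∫ w', K (Z w - Z w') * g w' ∂P) + lam * g w)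
    (hdual' : ∀ᵐ w ∂P, Y w = (∫ w', K (Z' w - Z' w') * g' w' ∂P) + lam * g' w) :
    |lam * (∫ w, Y w * g' w ∂P) - lam * (∫ w, Y w * g w ∂P)
      + lam * kernelForm P (fun p => K (Z' p.1 - Z' p.2) - K (Z p.1 - Z p.2)) g g|
      ≤ (∫ p, (K (Z' p.1 - Z' p.2) - K (Z p.1 - Z p.2)) ^ 2 ∂(P.prod P)) * ∫ w, g w ^ 2 ∂P := by
  set κ : Ω × Ω → ℝ := fun p => K (Z p.1 - Z p.2) with hκdef
  set κ' : Ω × Ω → ℝ := fun p => K (Z' p.1 - Z' p.2) with hκdef'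
  have hκ : MemLp κ 2 (P.prod P) := hk.memLp_kernel hZ
  have hκ' : MemLp κ' 2 (P.prod P) := hk.memLp_kernel hZ'
  have hδ : MemLp (fun p => κ' p - κ p) 2 (P.prod P) := hκ'.sub hκ
  set h : Ω → ℝ := fun w => g' w - g w with hhdef
  have hh : MemLp h 2 P := hg'.sub hg
  have e1 : ∫ w, Y w * g' w ∂P = kernelForm P κ g' g + lam * ∫ w, g w * g' w ∂P :=
    integral_mul_eq_of_dual hk hZ hg hg' hdual
  have e2 : ∫ w, Y w * g w ∂P = kernelForm P κ' g g' + lam * ∫ w, g' w * g w ∂P :=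
    integral_mul_eq_of_dual hk hZ' hg' hg hdual'
  have e3 : ∫ w, Y w * h w ∂P = kernelForm P κ h g + lam * ∫ w, g w * h w ∂P :=
    integral_mul_eq_of_dual hk hZ hg hh hdual
  have e4 : ∫ w, Y w * h w ∂P = kernelForm P κ' h g' + lam * ∫ w, g' w * h w ∂P :=
    integral_mul_eq_of_dual hk hZ' hg' hh hdual'
  have hpos : 0 ≤ kernelForm P κ' h h := hk.kernelForm_nonneg hZ' (hh.integrable one_le_two)
  have c1 : kernelForm P κ' g g' = kernelForm P κ' g' g := kernelForm_comm (hk.kernel_swap _) _ _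
  have c2 : kernelForm P κ' h g' = kernelForm P κ' g' h := kernelForm_comm (hk.kernel_swap _) _ _
  have c3 : kernelForm P κ' h g = kernelForm P κ' g h := kernelForm_comm (hk.kernel_swap _) _ _
  have l1 : kernelForm P κ' h h = kernelForm P κ' g' h - kernelForm P κ' g h :=
    kernelForm_sub_left hκ' hg' hg hh
  have s1 := kernelForm_sub_kernel hκ' hκ hh hg
  have s2 := kernelForm_sub_kernel hκ' hκ hg hg
  have l2 : kernelForm P κ h g = kernelForm P κ g' g - kernelForm P κ g g :=
    kernelForm_sub_left hκ hg' hg hg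
  have l3 : kernelForm P κ' h g = kernelForm P κ' g' g - kernelForm P κ' g g :=
    kernelForm_sub_left hκ' hg' hg hg
  have i1 : ∫ w, g' w * h w ∂P = (∫ w, g w * h w ∂P) + ∫ w, h w ^ 2 ∂P := by
    have hgh : Integrable (fun w => g w * h w) P := hg.integrable_mul hh
    rw [← integral_add hgh hh.integrable_sq]
    refine integral_congr_ae (Eventually.of_forall fun w => ?_)
    simp only [hhdef]; ring
  have i2 : ∫ w, g w * g' w ∂P = ∫ w, g' w * g w ∂P := by simp only [mul_comm]
  set D := ∫ p, (κ' p - κ p) ^ 2 ∂(P.prod P) with hD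
  set G := ∫ w, g w ^ 2 ∂P with hG
  set N := ∫ w, h w ^ 2 ∂P with hN
  set b := kernelForm P (fun p => κ' p - κ p) h g with hb
  have hD0 : 0 ≤ D := integral_nonneg fun p => sq_nonneg _
  have hG0 : 0 ≤ G := integral_nonneg fun p => sq_nonneg _
  have hN0 : 0 ≤ N := integral_nonneg fun p => sq_nonneg _
  have hcs : b ^ 2 ≤ D * (N * G) := sq_kernelForm_le hδ hh hg
  -- Both dual equations tested against `h = g' - g` give `b = -E[κ' h h'] - λ N`, and the form of
  -- `κ'` is nonnegative.
  have hcoer : lam * N ≤ -b := by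
    rw [i1, mul_add] at e4
    linarith
  -- The bounds `λ N ≤ |b|` and `b² ≤ D N G` give `λ² N ≤ D G`; inserting this back into `λ² b² ≤ λ²
  -- D N G` eliminates `N` and every power of `λ` on the right.
  have hbN : lam * |b| ≤ D * G := by
    have hb0 : |b| = -b := abs_of_nonpos (by have := mul_nonneg hlam.le hN0; linarith)
    have h1 : (lam * N) * N * lam ≤ D * G * N := by
      have : (lam * N) ^ 2 ≤ b ^ 2 := by
        rw [← neg_sq b]; exact pow_le_pow_left₀ (by positivity) hcoer 2
      nlinarith
    have h2 : lam ^ 2 * N ≤ D * G := by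
      rcases hN0.eq_or_lt with h0 | h0
      · rw [← h0, mul_zero]; positivity
      · exact le_of_mul_le_mul_right (by nlinarith) h0
    refine abs_le_of_sq_le_sq' ?_ (by positivity) |>.2
    rw [mul_pow, sq_abs]
    calc lam ^ 2 * b ^ 2 ≤ lam ^ 2 * (D * (N * G)) := by gcongr
      _ = (D * G) * (lam ^ 2 * N) := by ring
      _ ≤ (D * G) * (D * G) := by gcongr
      _ = (D * G) ^ 2 := by ring
  -- Each dual equation is tested against the other solution, so the symmetric terms cancel and the
  -- exact error is `-λ b`.
  have hfin : lam * (∫ w, Y w * g' w ∂P) - lam * (∫ w, Y w * g w ∂P)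
      + lam * kernelForm P (fun p => κ' p - κ p) g g = -(lam * b) := by
    rw [e1, e2, i2, s2, c1, s1, l2, l3]; ring
  rw [hfin, abs_neg, abs_mul, abs_of_pos hlam]
  exact hbN

end Envelope

/-! ### One-sided derivative of the Laplace transform of `μ`. -/

section Profile

/-- The Laplace transform `S ↦ ∫ exp (-tS) μ(dt)`. -/
noncomputable def laplaceProfile (μ : Measure ℝ) (S : ℝ) : ℝ := ∫ t, Real.exp (-(t * S)) ∂μ

theorem lOneKernel_eq {d : ℕ} (μ : Measure ℝ) (y : EuclideanSpace ℝ (Fin d)) :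
    lOneKernel μ y = laplaceProfile μ (∑ j, |y j|) := rfl

/-- The measure `t μ(dt)`. -/
noncomputable def sizeBiased (μ : Measure ℝ) : Measure ℝ :=
  μ.withDensity fun t => ENNReal.ofReal t

variable {μ : Measure ℝ} [IsFiniteMeasure μ] {a b : ℝ}

theorem ae_sizeBiased (hμ : ∀ᵐ t ∂μ, t ∈ Set.Icc a b) :
    ∀ᵐ t ∂(sizeBiased μ), t ∈ Set.Icc a b :=
  (withDensity_absolutelyContinuous μ _).ae_le hμ

theorem isFiniteMeasure_sizeBiased (ha : 0 < a) (hμ : ∀ᵐ t ∂μ, t ∈ Set.Icc a b) :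
    IsFiniteMeasure (sizeBiased μ) := by
  have h : Integrable (fun t : ℝ => t) μ := by
    refine Integrable.of_bound (by fun_prop) b ?_
    filter_upwards [hμ] with t ht
    rw [Real.norm_of_nonneg (ha.le.trans ht.1)]; exact ht.2
  exact isFiniteMeasure_withDensity_ofReal h.2

theorem integral_sizeBiased (ha : 0 < a) (hμ : ∀ᵐ t ∂μ, t ∈ Set.Icc a b) (f : ℝ → ℝ) :
    ∫ t, f t ∂(sizeBiased μ) = ∫ t, t * f t ∂μ := by
  have hm : Measurable fun t : ℝ => t.toNNReal := measurable_real_toNNReal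
  refine (integral_withDensity_eq_integral_smul hm f).trans ?_
  refine integral_congr_ae ?_
  filter_upwards [hμ] with t ht
  rw [NNReal.smul_def, Real.coe_toNNReal _ (ha.le.trans ht.1), smul_eq_mul]

theorem sizeBiased_ne_zero [NeZero μ] (ha : 0 < a) (hμ : ∀ᵐ t ∂μ, t ∈ Set.Icc a b) :
    sizeBiased μ ≠ 0 := by
  have hf := isFiniteMeasure_sizeBiased ha hμ
  intro h0
  have h1 := integral_sizeBiased ha hμ (fun _ => 1)
  rw [h0, integral_zero_measure] at h1
  have h2 : a * μ.real Set.univ ≤ ∫ t, t * 1 ∂μ := by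
    rw [mul_comm, ← smul_eq_mul, ← integral_const]
    refine integral_mono_ae (integrable_const _) ?_ ?_
    · refine Integrable.of_bound (by fun_prop) b ?_
      filter_upwards [hμ] with t ht
      rw [mul_one, Real.norm_of_nonneg (ha.le.trans ht.1)]; exact ht.2
    · filter_upwards [hμ] with t ht
      rw [mul_one]; exact ht.1
  have h3 : 0 < μ.real Set.univ := by
    simp [Measure.real, ENNReal.toReal_pos_iff, pos_iff_ne_zero, NeZero.ne μ]
  rw [← h1] at h2
  have := mul_pos ha h3
  linarith

theorem integrable_exp_neg_mul (ha : 0 < a) (hμ : ∀ᵐ t ∂μ, t ∈ Set.Icc a b) {S : ℝ}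
    (hS : 0 ≤ S) : Integrable (fun t => Real.exp (-(t * S))) μ := by
  refine Integrable.of_bound (by fun_prop) 1 ?_
  filter_upwards [hμ] with t ht
  rw [Real.norm_of_nonneg (Real.exp_nonneg _), Real.exp_le_one_iff]
  have := mul_nonneg (ha.le.trans ht.1) hS
  linarith

theorem abs_exp_sub_exp_le {t S x s : ℝ} (ht : 0 ≤ t) (hS : 0 ≤ S) (hx : 0 ≤ x) (hs : 0 ≤ s) :
    |Real.exp (-(t * (S + s * x))) - Real.exp (-(t * S))| ≤ t * (s * x) := by
  have h0 : 0 ≤ t * (s * x) := by positivity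
  have h1 : Real.exp (-(t * (S + s * x)))
      = Real.exp (-(t * S)) * Real.exp (-(t * (s * x))) := by
    rw [← Real.exp_add]; congr 1; ring
  have h2 : Real.exp (-(t * S)) ≤ 1 := Real.exp_le_one_iff.2 (by have := mul_nonneg ht hS; linarith)
  have h3 : Real.exp (-(t * (s * x))) ≤ 1 := Real.exp_le_one_iff.2 (by linarith)
  have h4 := Real.add_one_le_exp (-(t * (s * x)))
  have h5 := Real.exp_nonneg (-(t * S))
  rw [h1, abs_sub_comm, abs_of_nonneg (by nlinarith)]
  nlinarith

theorem abs_laplaceProfile_sub_le (ha : 0 < a) (hμ : ∀ᵐ t ∂μ, t ∈ Set.Icc a b) {S x s : ℝ}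
    (hS : 0 ≤ S) (hx : 0 ≤ x) (hs : 0 ≤ s) :
    |laplaceProfile μ (S + s * x) - laplaceProfile μ S| ≤ μ.real Set.univ * b * (s * x) := by
  rw [laplaceProfile, laplaceProfile, ← integral_sub
    (integrable_exp_neg_mul ha hμ (by positivity)) (integrable_exp_neg_mul ha hμ hS),
    mul_assoc, ← smul_eq_mul (μ.real Set.univ), ← integral_const, ← Real.norm_eq_abs]
  refine norm_integral_le_of_norm_le (integrable_const _) ?_
  filter_upwards [hμ] with t ht
  rw [Real.norm_eq_abs]
  refine (abs_exp_sub_exp_le (ha.le.trans ht.1) hS hx hs).trans ?_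
  exact mul_le_mul_of_nonneg_right ht.2 (by positivity)

theorem tendsto_laplaceProfile_slope (ha : 0 < a) (hμ : ∀ᵐ t ∂μ, t ∈ Set.Icc a b) {S x : ℝ}
    (hS : 0 ≤ S) (hx : 0 ≤ x) :
    Tendsto (fun s : ℝ => (laplaceProfile μ (S + s * x) - laplaceProfile μ S) / s) (𝓝[>] 0)
      (𝓝 (-(x * laplaceProfile (sizeBiased μ) S))) := by
  have h1 : ∀ s ∈ Set.Ioi (0 : ℝ), (laplaceProfile μ (S + s * x) - laplaceProfile μ S) / s
      = ∫ t, (Real.exp (-(t * (S + s * x))) - Real.exp (-(t * S))) / s ∂μ := by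
    intro s hs
    have hs' : 0 ≤ s := le_of_lt hs
    rw [laplaceProfile, laplaceProfile, ← integral_sub
      (integrable_exp_neg_mul ha hμ (by positivity)) (integrable_exp_neg_mul ha hμ hS),
      integral_div]
  have h2 : -(x * laplaceProfile (sizeBiased μ) S)
      = ∫ t, Real.exp (-(t * S)) * -(t * x) ∂μ := by
    rw [laplaceProfile, integral_sizeBiased ha hμ, ← integral_const_mul, ← integral_neg]
    congr 1; funext t; ring
  rw [h2]
  refine Tendsto.congr' (f₁ := fun s => ∫ t, (Real.exp (-(t * (S + s * x)))
    - Real.exp (-(t * S))) / s ∂μ) ?_ ?_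
  · filter_upwards [self_mem_nhdsWithin] with s hs using (h1 s hs).symm
  refine tendsto_integral_filter_of_dominated_convergence (fun _ => b * x) ?_ ?_
    (integrable_const _) ?_
  · exact Eventually.of_forall fun s => by fun_prop
  · filter_upwards [self_mem_nhdsWithin] with s hs
    have hs' : (0 : ℝ) < s := hs
    filter_upwards [hμ] with t ht
    rw [norm_div, Real.norm_eq_abs, Real.norm_of_nonneg hs'.le, div_le_iff₀ hs']
    refine (abs_exp_sub_exp_le (ha.le.trans ht.1) hS hx hs'.le).trans ?_
    have := mul_le_mul_of_nonneg_right ht.2 (mul_nonneg hs'.le hx)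
    linarith
  · refine Eventually.of_forall fun t => ?_
    have hd : HasDerivAt (fun s : ℝ => Real.exp (-(t * (S + s * x))))
        (Real.exp (-(t * S)) * -(t * x)) 0 := by
      have h : HasDerivAt (fun s : ℝ => -(t * (S + s * x))) (-(t * x)) 0 := by
        have := ((((hasDerivAt_id (0 : ℝ)).mul_const x).const_add S).const_mul t).fun_neg
        simpa using this
      simpa using h.exp
    have hsl := (hasDerivAt_iff_tendsto_slope_zero.1 hd).mono_left
      (nhdsGT_le_nhdsNE (0 : ℝ))
    refine hsl.congr fun s => ?_
    rw [zero_add, zero_mul, add_zero, smul_eq_mul, div_eq_inv_mul]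

end Profile

/-! ### Derivative of the objective along `e_i` where `β_i = 0`. -/

section DirectionalDerivative

variable {Ω : Type*} [MeasurableSpace Ω] {P : Measure Ω} [IsProbabilityMeasure P] {d : ℕ}
  {X : Ω → EuclideanSpace ℝ (Fin d)} {μ : Measure ℝ} {a b : ℝ}

theorem measurable_had (hX : Measurable X) (β : EuclideanSpace ℝ (Fin d)) :
    Measurable fun w => had β (X w) := by
  unfold had
  exact (WithLp.measurable_toLp 2 _).comp (measurable_pi_lambda _ fun j => by fun_prop)

theorem had_apply (β x : EuclideanSpace ℝ (Fin d)) (j : Fin d) : had β x j = β j * x j := rfl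

/-- The `i`-th term vanishes at `s = 0`, so nothing inside its absolute value can cancel and the
increment is linear in `s ≥ 0`. This reduces the derivative of the kernel to that of a one-variable
Laplace transform. -/
theorem sum_abs_had_add_single {β : EuclideanSpace ℝ (Fin d)} {i : Fin d} (hβ : β i = 0)
    {s : ℝ} (hs : 0 ≤ s) (x x' : EuclideanSpace ℝ (Fin d)) :
    ∑ j, |(had (β + s • EuclideanSpace.single i 1) x
      - had (β + s • EuclideanSpace.single i 1) x') j|
      = (∑ j, |(had β x - had β x') j|) + s * |x i - x' i| := by
  rw [← Finset.add_sum_erase _ _ (Finset.mem_univ i),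
    ← Finset.add_sum_erase Finset.univ (fun j => |(had β x - had β x') j|) (Finset.mem_univ i)]
  have h1 : ∀ j ∈ Finset.univ.erase i, |(had (β + s • EuclideanSpace.single i 1) x
      - had (β + s • EuclideanSpace.single i 1) x') j| = |(had β x - had β x') j| := by
    intro j hj
    have := Finset.ne_of_mem_erase hj
    simp [had_apply, this]
  rw [Finset.sum_congr rfl h1]
  simp only [PiLp.sub_apply, had_apply, PiLp.add_apply, PiLp.smul_apply, hβ, zero_mul, sub_zero,
    abs_zero, zero_add, PiLp.single_apply, if_true, smul_eq_mul, mul_one]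
  rw [← mul_sub, abs_mul, abs_of_nonneg hs]; ring

theorem memLp_sub_coord (hX : MemLp X 2 P) (i : Fin d) :
    MemLp (fun p : Ω × Ω => |X p.1 i - X p.2 i|) 2 (P.prod P) := by
  have hi : MemLp (fun w => X w i) 2 P := by
    refine hX.mono ((EuclideanSpace.proj (𝕜 := ℝ) i).continuous.comp_aestronglyMeasurable hX.1)
      (Eventually.of_forall fun w => PiLp.norm_apply_le (X w) i)
  exact ((hi.comp_fst P).sub (hi.comp_snd P)).abs

/-- The directional derivative of the objective at a point whose `i`-th coordinate vanishes. -/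
theorem hasDirDeriv_objective [IsFiniteMeasure μ] [NeZero μ] {Y g : Ω → ℝ} (ha : 0 < a)
    (hab : a ≤ b) (hμ : ∀ᵐ t ∂μ, t ∈ Set.Icc a b) (hXm : Measurable X) (hX : MemLp X 2 P)
    (hY : MemLp Y 2 P) {β : EuclideanSpace ℝ (Fin d)} {i : Fin d} (hβ : β i = 0) {lam : ℝ}
    (hlam : 0 < lam) (hg : MemLp g 2 P)
    (hdual : ∀ᵐ w ∂P, Y w
      = (∫ w', lOneKernel μ (had β (X w) - had β (X w')) * g w' ∂P) + lam * g w) :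
    HasDirDeriv (fun β' => objective P X Y (lOneDensity d μ) β' lam) β (EuclideanSpace.single i 1)
      (lam * kernelForm P (fun p => |X p.1 i - X p.2 i|
        * lOneKernel (sizeBiased μ) (had β (X p.1) - had β (X p.2))) g g) := by
  have hk := isSpectralDensity_lOneDensity (d := d) ha hab hμ (NeZero.ne μ)
  set v : EuclideanSpace ℝ (Fin d) := EuclideanSpace.single i 1 with hv
  set G := ∫ w, g w ^ 2 ∂P with hG
  set Δ : Ω × Ω → ℝ := fun p => |X p.1 i - X p.2 i| with hΔ
  have hΔm : MemLp Δ 2 (P.prod P) := memLp_sub_coord hX i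
  set δ : ℝ → Ω × Ω → ℝ := fun s p => lOneKernel μ (had (β + s • v) (X p.1)
    - had (β + s • v) (X p.2)) - lOneKernel μ (had β (X p.1) - had β (X p.2)) with hδ
  set c := μ.real Set.univ * b with hc
  have hb : 0 < b := ha.trans_le hab
  have hδeq : ∀ s, 0 ≤ s → ∀ p : Ω × Ω, δ s p
      = laplaceProfile μ ((∑ j, |(had β (X p.1) - had β (X p.2)) j|) + s * Δ p)
        - laplaceProfile μ (∑ j, |(had β (X p.1) - had β (X p.2)) j|) := by
    intro s hs p
    simp only [hδ, lOneKernel_eq, hv, sum_abs_had_add_single hβ hs, hΔ]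
  have hδle : ∀ s, 0 ≤ s → ∀ p : Ω × Ω, |δ s p| ≤ c * (s * Δ p) := by
    intro s hs p
    rw [hδeq s hs]
    exact abs_laplaceProfile_sub_le ha hμ (Finset.sum_nonneg fun j _ => abs_nonneg _)
      (abs_nonneg _) hs
  have hδm : ∀ s, Measurable (δ s) := by
    intro s
    have h := fun β' : EuclideanSpace ℝ (Fin d) => hk.continuous.measurable.comp
      (((measurable_had hXm β').comp measurable_fst).sub
        ((measurable_had hXm β').comp measurable_snd))
    exact (h (β + s • v)).sub (h β)
  have hlim : Tendsto (fun s => kernelForm P (fun p => δ s p / s) g g) (𝓝[>] 0)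
      (𝓝 (kernelForm P (fun p => -(Δ p
        * lOneKernel (sizeBiased μ) (had β (X p.1) - had β (X p.2)))) g g)) := by
    refine tendsto_integral_filter_of_dominated_convergence
      (fun p => c * ‖Δ p * (g p.1 * g p.2)‖) ?_ ?_
      ((integrable_kernelForm_of_memLp hΔm hg hg).norm.const_mul c) ?_
    · refine Eventually.of_forall fun s => ?_
      exact ((hδm s).div_const s).aestronglyMeasurable.mul (memLp_two_tensor hg hg).1
    · filter_upwards [self_mem_nhdsWithin] with s hs
      have hs' : (0 : ℝ) < s := hs
      refine Eventually.of_forall fun p => ?_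
      rw [norm_mul, norm_mul (Δ p), ← mul_assoc]
      refine mul_le_mul_of_nonneg_right ?_ (norm_nonneg _)
      rw [norm_div, Real.norm_of_nonneg hs'.le, div_le_iff₀ hs', Real.norm_eq_abs,
        Real.norm_of_nonneg (abs_nonneg _ : 0 ≤ Δ p)]
      have := hδle s hs'.le p
      linarith
    · refine Eventually.of_forall fun p => Tendsto.mul_const _ ?_
      have h := tendsto_laplaceProfile_slope ha hμ
        (Finset.sum_nonneg fun j _ => abs_nonneg _ :
          0 ≤ ∑ j, |(had β (X p.1) - had β (X p.2)) j|) (abs_nonneg _ : 0 ≤ Δ p)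
      refine h.congr' ?_
      filter_upwards [self_mem_nhdsWithin] with s hs
      rw [hδeq s (le_of_lt hs)]
  -- The kernel increment is at most `c s |X_i - X_i'|`, so the quadratic error of the envelope
  -- estimate, divided by `s`, is `O(s)`; only second moments of `X` are needed.
  have herr : ∀ s, 0 < s → |(objective P X Y (lOneDensity d μ) (β + s • v) lam
      - objective P X Y (lOneDensity d μ) β lam) / s
      + lam * kernelForm P (fun p => δ s p / s) g g|
      ≤ s * (c ^ 2 * (∫ p, Δ p ^ 2 ∂(P.prod P)) * G) := by
    intro s hs
    obtain ⟨g', hg', hdual'⟩ := hk.exists_dual (measurable_had hXm (β + s • v)) hY hlam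
    have h := abs_perturbation_le hlam hk (measurable_had hXm β)
      (measurable_had hXm (β + s • v)) hg hg' hdual hdual'
    rw [objective_eq_of_dual hk (measurable_had hXm _) hY hlam hg hdual,
      objective_eq_of_dual hk (measurable_had hXm _) hY hlam hg' hdual']
    have hdiv : kernelForm P (fun p => δ s p / s) g g = kernelForm P (δ s) g g / s := by
      rw [kernelForm, kernelForm, ← integral_div]
      congr 1; funext p; ring
    rw [hdiv, ← mul_div_assoc, ← add_div, abs_div, abs_of_pos hs, div_le_iff₀ hs]
    refine h.trans ?_
    have hint : ∫ p, δ s p ^ 2 ∂(P.prod P) ≤ ∫ p, (c * s) ^ 2 * Δ p ^ 2 ∂(P.prod P) := by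
      refine integral_mono_of_nonneg (Eventually.of_forall fun p => sq_nonneg _)
        (hΔm.integrable_sq.const_mul _) (Eventually.of_forall fun p => ?_)
      simp only
      rw [← mul_pow, ← sq_abs]
      refine pow_le_pow_left₀ (abs_nonneg _) ((hδle s hs.le p).trans (le_of_eq ?_)) 2
      ring
    rw [integral_const_mul] at hint
    calc _ ≤ (c * s) ^ 2 * (∫ p, Δ p ^ 2 ∂(P.prod P)) * G :=
          mul_le_mul_of_nonneg_right hint (integral_nonneg fun w => sq_nonneg _)
      _ = _ := by ring
  have hlim2 : Tendsto (fun s => (objective P X Y (lOneDensity d μ) (β + s • v) lam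
      - objective P X Y (lOneDensity d μ) β lam) / s
      + lam * kernelForm P (fun p => δ s p / s) g g) (𝓝[>] 0) (𝓝 0) := by
    have h0 : Tendsto (fun s : ℝ => s * (c ^ 2 * (∫ p, Δ p ^ 2 ∂(P.prod P)) * G)) (𝓝[>] 0)
        (𝓝 0) := by
      have : Continuous fun s : ℝ => s * (c ^ 2 * (∫ p, Δ p ^ 2 ∂(P.prod P)) * G) := by fun_prop
      have h := this.tendsto 0
      rw [zero_mul] at h
      exact h.mono_left nhdsWithin_le_nhds
    refine squeeze_zero_norm' ?_ h0
    filter_upwards [self_mem_nhdsWithin] with s hs using herr s hs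
  have hfin := hlim2.sub (hlim.const_mul lam)
  unfold HasDirDeriv
  have hval : (0 : ℝ) - lam * kernelForm P (fun p => -(Δ p
        * lOneKernel (sizeBiased μ) (had β (X p.1) - had β (X p.2)))) g g
      = lam * kernelForm P (fun p => Δ p
        * lOneKernel (sizeBiased μ) (had β (X p.1) - had β (X p.2))) g g := by
    simp only [kernelForm, neg_mul, integral_neg]; ring
  rw [hval] at hfin
  refine hfin.congr fun s => ?_
  ring

end DirectionalDerivative

/-! ### Independence of `X_i` from the other coordinates, and the main effect. -/

section Independence

variable {Ω : Type*} [MeasurableSpace Ω] {P : Measure Ω} [IsProbabilityMeasure P] {d : ℕ}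
  {X : Ω → EuclideanSpace ℝ (Fin d)} {Y : Ω → ℝ}

/-- Under both hypotheses the joint law is a threefold product, so it may be re-bracketed. -/
theorem indepFun_prodMk_of_prodMk {α β γ : Type*} [MeasurableSpace α] [MeasurableSpace β]
    [MeasurableSpace γ] {A : Ω → α} {B : Ω → β} {C : Ω → γ} (hA : Measurable A)
    (hB : Measurable B) (hC : Measurable C) (hAB : IndepFun A B P)
    (hABC : IndepFun (fun w => (A w, B w)) C P) : IndepFun A (fun w => (B w, C w)) P := by
  have hBC : IndepFun B C P := hABC.comp measurable_snd measurable_id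
  rw [indepFun_iff_map_prod_eq_prod_map_map (by fun_prop) (by fun_prop)] at hAB hABC hBC ⊢
  rw [hAB] at hABC
  have h1 : (fun w => (A w, (B w, C w)))
      = MeasurableEquiv.prodAssoc ∘ fun w => ((A w, B w), C w) := rfl
  have := Measure.isProbabilityMeasure_map (μ := P) hA.aemeasurable
  have := Measure.isProbabilityMeasure_map (μ := P) hB.aemeasurable
  have := Measure.isProbabilityMeasure_map (μ := P) hC.aemeasurable
  rw [h1, ← Measure.map_map MeasurableEquiv.prodAssoc.measurable (by fun_prop), hABC,
    Measure.prodAssoc_prod, hBC]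

theorem sigmaCoord_le (hX : Measurable X) (S : Set (Fin d)) :
    sigmaCoord X S ≤ ‹MeasurableSpace Ω› :=
  Measurable.comap_le (measurable_pi_lambda _ fun j => by fun_prop)

/-- A coordinate independent of the other relevant and of the irrelevant coordinates is
independent of every family of other coordinates. -/
theorem indep_coord_sigmaCoord (hX : Measurable X) {T : Set (Fin d)} {i : Fin d} (hi : i ∈ T)
    (hind : IndepFun (fun w (j : T) => X w j) (fun w (j : (Tᶜ : Set (Fin d))) => X w j) P)
    (hmut : iIndepFun (fun (j : T) w => X w j) P) {S : Set (Fin d)} (hiS : i ∉ S) :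
    Indep (MeasurableSpace.comap (fun w => X w i) inferInstance) (sigmaCoord X S) P := by
  classical
  set i' : T := ⟨i, hi⟩ with hi'
  set E : Finset T := Finset.univ.erase i' with hE
  set A : Ω → ℝ := fun w => X w i with hA
  set B : Ω → (E → ℝ) := fun w j => X w (j : T) with hB
  set C : Ω → ((Tᶜ : Set (Fin d)) → ℝ) := fun w j => X w j with hC
  have hAm : Measurable A := by fun_prop
  have hBm : Measurable B := measurable_pi_lambda _ fun j => by fun_prop
  have hCm : Measurable C := measurable_pi_lambda _ fun j => by fun_prop
  have hAB : IndepFun A B P := by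
    have h := hmut.indepFun_finset {i'} E (by simp [hE]) (fun j => by fun_prop)
    have hφ : Measurable fun u : ({i'} : Finset T) → ℝ => u ⟨i', Finset.mem_singleton_self _⟩ :=
      measurable_pi_apply _
    exact h.comp hφ measurable_id
  have hABC : IndepFun (fun w => (A w, B w)) C P :=
    hind.comp (φ := fun u : T → ℝ => (u i', fun j : E => u (j : T)))
      ((measurable_pi_apply _).prodMk (measurable_pi_lambda _ fun j => measurable_pi_apply _))
      measurable_id
  have h := indepFun_prodMk_of_prodMk hAm hBm hCm hAB hABC
  have hmem : ∀ j : S, ∀ hj : (j : Fin d) ∈ T, (⟨j, hj⟩ : T) ∈ E := by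
    intro j hj
    rw [hE, Finset.mem_erase]
    refine ⟨fun h0 => hiS ?_, Finset.mem_univ _⟩
    have : (j : Fin d) = i := congrArg Subtype.val h0
    exact this ▸ j.2
  -- Reads `X_S` off the relevant coordinates other than `i` and the irrelevant ones; `i ∉ S`
  -- ensures that the excluded coordinate is never asked for.
  let φ : (E → ℝ) × ((Tᶜ : Set (Fin d)) → ℝ) → (S → ℝ) := fun u j =>
    if hj : (j : Fin d) ∈ T then u.1 ⟨⟨j, hj⟩, hmem j hj⟩ else u.2 ⟨j, hj⟩
  have hφ : Measurable φ := by
    refine measurable_pi_lambda _ fun j => ?_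
    by_cases hj : (j : Fin d) ∈ T
    · simp only [φ, hj, dif_pos]; fun_prop
    · simp only [φ, hj, dif_neg, not_false_iff]; fun_prop
  have h2 := h.comp measurable_id hφ
  rw [IndepFun_iff_Indep] at h2
  have h3 : (φ ∘ fun w => (B w, C w)) = fun w (j : S) => X w j := by
    funext w j
    by_cases hj : (j : Fin d) ∈ T
    · simp [φ, hj, hB]
    · simp [φ, hj, hC]
  rw [h3] at h2
  exact h2

/-- Applied to functions of `X_{supp β}`, this shows that only their mean is visible at the
frequencies of `X_i`. -/
theorem integral_mul_echar_of_indep {Ω : Type*} {m mΩ : MeasurableSpace Ω} {P : Measure Ω}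
    {A : Ω → ℝ} (hA : Measurable A) (hm : m ≤ mΩ) (hind : Indep (MeasurableSpace.comap A inferInstance) m P)
    {F : Ω → ℝ} (hF : Measurable[m] F) (ζ : ℝ) :
    ∫ w, (F w : ℂ) * echar (-(ζ * A w)) ∂P
      = ((∫ w, F w ∂P : ℝ) : ℂ) * ∫ w, echar (-(ζ * A w)) ∂P := by
  have h : IndepFun F A P := by
    rw [IndepFun_iff_Indep]
    exact (indep_of_indep_of_le_right hind hF.comap_le).symm
  have h2 := h.integral_fun_comp_mul_comp (f := fun x : ℝ => (x : ℂ))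
    (g := fun x : ℝ => echar (-(ζ * x))) (hF.mono hm le_rfl).aemeasurable hA.aemeasurable
    (by fun_prop) (by fun_prop)
  rw [h2, integral_complex_ofReal]

/-- Coordinates outside the support are multiplied by zero, so they can be replaced by zero. -/
theorem measurable_had_sigmaCoord (X : Ω → EuclideanSpace ℝ (Fin d))
    (β : EuclideanSpace ℝ (Fin d)) :
    Measurable[sigmaCoord X (supp β)] fun w => had β (X w) := by
  classical
  let φ : (supp β → ℝ) → EuclideanSpace ℝ (Fin d) := fun u =>
    WithLp.toLp 2 fun j => if hj : j ∈ supp β then β j * u ⟨j, hj⟩ else 0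
  have hφ : Measurable φ := by
    refine (WithLp.measurable_toLp 2 _).comp (measurable_pi_lambda _ fun j => ?_)
    by_cases hj : j ∈ supp β
    · simp only [hj, dif_pos]; fun_prop
    · simp only [hj, dif_neg, not_false_iff]; fun_prop
  have h : (fun w => had β (X w)) = φ ∘ fun w (j : supp β) => X w j := by
    funext w
    ext j
    by_cases hj : j ∈ supp β
    · simp [φ, had_apply, hj]
    · have h0 : β j = 0 := by simpa [supp] using hj
      simp [φ, had_apply, hj, h0]
  rw [h]
  exact hφ.comp (comap_measurable _)

/-- If `E[Y | X_i]` is not zero then `E[Y exp (-2πiζX_i)]` is nonzero for some `ζ`. -/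
theorem exists_integral_mul_echar_ne_zero (hX : Measurable X) (hY : Integrable Y P) {i : Fin d}
    (hmain : ¬ (condCoord P X Y {i} =ᵐ[P] 0)) :
    ∃ ζ : ℝ, ∫ w, (Y w : ℂ) * echar (-(ζ * X w i)) ∂P ≠ 0 := by
  by_contra hcon
  push Not at hcon
  apply hmain
  have hA : Measurable fun w => X w i := by fun_prop
  have hmeas : ∀ U : Ω → ℝ, Integrable U P →
      IsFiniteMeasure ((P.withDensity fun w => ENNReal.ofReal (U w)).map fun w => X w i) := by
    intro U hU
    have := isFiniteMeasure_withDensity_ofReal hU.2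
    infer_instance
  -- Densities are positive measures, so the positive and negative parts of `Y` are treated
  -- separately. `charFun` uses `exp(itx)`, hence the frequency `-t/(2π)`.
  have hchar : ∀ U : Ω → ℝ, Integrable U P → ∀ t : ℝ,
      charFun ((P.withDensity fun w => ENNReal.ofReal (U w)).map fun w => X w i) t
        = ∫ w, ((max (U w) 0 : ℝ) : ℂ) * echar (-(-(t / (2 * Real.pi)) * X w i)) ∂P := by
    intro U hU t
    rw [charFun_apply_real, integral_map hA.aemeasurable (by fun_prop)]
    have hm : AEMeasurable (fun w => (U w).toNNReal) P := hU.1.aemeasurable.real_toNNReal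
    refine (integral_withDensity_eq_integral_smul₀ hm _).trans ?_
    refine integral_congr_ae (Eventually.of_forall fun w => ?_)
    simp only [NNReal.smul_def, Real.coe_toNNReal', Complex.real_smul]
    congr 1
    rw [echar]; congr 1; push_cast
    have : (Real.pi : ℂ) ≠ 0 := by exact_mod_cast Real.pi_ne_zero
    field_simp
  have hneg : Integrable (fun w => -Y w) P := hY.neg
  have i1 := hmeas Y hY
  have i2 := hmeas _ hneg
  have hmax : ∀ U : Ω → ℝ, Integrable U P → ∀ ζ : ℝ,
      Integrable (fun w => ((max (U w) 0 : ℝ) : ℂ) * echar (-(ζ * X w i))) P := by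
    intro U hU ζ
    exact ((hU.pos_part).ofReal (𝕜 := ℂ)).mul_bdd (c := 1)
      (by fun_prop) (Eventually.of_forall fun w => (norm_echar _).le)
  -- If every transform of `Y` along `X_i` vanished, the pushforwards of `Y⁺ P` and `Y⁻ P` under
  -- `X_i` would have equal characteristic functions and hence coincide.
  have heq := Measure.ext_of_charFun
    (μ := (P.withDensity fun w => ENNReal.ofReal (Y w)).map fun w => X w i)
    (ν := (P.withDensity fun w => ENNReal.ofReal (-Y w)).map fun w => X w i) (by
      funext t
      rw [hchar Y hY, hchar _ hneg, ← sub_eq_zero, ← integral_sub (hmax _ hY _) (hmax _ hneg _),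
        ← hcon (-(t / (2 * Real.pi)))]
      refine integral_congr_ae (Eventually.of_forall fun w => ?_)
      simp only
      rw [← sub_mul, ← Complex.ofReal_sub]
      congr 2
      rcases le_total 0 (Y w) with h | h
      · rw [max_eq_left h, max_eq_right (by linarith)]; ring
      · rw [max_eq_right h, max_eq_left (by linarith)]; ring)
  -- Equality of the two pushforwards says that `Y` integrates to zero over each event determined by
  -- `X_i`, which characterizes zero as the conditional expectation.
  refine (ae_eq_condExp_of_forall_setIntegral_eq (sigmaCoord_le hX {i}) hY
    (fun s _ _ => integrableOn_zero) ?_ stronglyMeasurable_zero.aestronglyMeasurable).symm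
  rintro s ⟨s', hs', rfl⟩ -
  have hs2 : ((fun w (j : ({i} : Set (Fin d))) => X w j) ⁻¹' s')
      = (fun w => X w i) ⁻¹' ((fun x : ℝ => fun _ : ({i} : Set (Fin d)) => x) ⁻¹' s') := by
    ext w
    simp only [Set.mem_preimage]
    have : (fun j : ({i} : Set (Fin d)) => X w j) = fun _ => X w i := by
      funext j; rw [show (j : Fin d) = i from j.2]
    rw [this]
  have hms : MeasurableSet ((fun x : ℝ => fun _ : ({i} : Set (Fin d)) => x) ⁻¹' s') :=
    (measurable_pi_lambda _ fun _ => measurable_id) hs'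
  rw [hs2]
  have h1 := congrArg (fun ν => ν ((fun x : ℝ => fun _ : ({i} : Set (Fin d)) => x) ⁻¹' s')) heq
  simp only at h1
  rw [Measure.map_apply hA hms, Measure.map_apply hA hms, withDensity_apply _ (hA hms),
    withDensity_apply _ (hA hms)] at h1
  rw [integral_eq_lintegral_pos_part_sub_lintegral_neg_part hY.integrableOn, h1]
  simp

end Independence

/-! ### The joint transform and its continuity in the frequency `ω`. -/

section JointTransform

variable {Ω : Type*} [MeasurableSpace Ω] {P : Measure Ω} [IsProbabilityMeasure P] {d : ℕ}
  {X : Ω → EuclideanSpace ℝ (Fin d)} {Y h : Ω → ℝ} {i : Fin d}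

/-- `E[h exp (-2πi⟨ω, β ∘ X⟩) exp (-2πiζX_i)]`. -/
noncomputable def jointTransform (P : Measure Ω) (X : Ω → EuclideanSpace ℝ (Fin d)) (i : Fin d)
    (β : EuclideanSpace ℝ (Fin d)) (h : Ω → ℝ) (ω : EuclideanSpace ℝ (Fin d)) (ζ : ℝ) : ℂ :=
  ∫ w, (h w : ℂ) * echar (-(⟪ω, had β (X w)⟫ + ζ * X w i)) ∂P

theorem norm_had_le (β x : EuclideanSpace ℝ (Fin d)) : ‖had β x‖ ≤ ‖β‖ * ‖x‖ := by
  refine abs_le_of_sq_le_sq' ?_ (by positivity) |>.2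
  rw [mul_pow, EuclideanSpace.norm_sq_eq, EuclideanSpace.norm_sq_eq x, Finset.mul_sum]
  refine Finset.sum_le_sum fun j _ => ?_
  rw [had_apply, norm_mul, mul_pow]
  exact mul_le_mul_of_nonneg_right
    (pow_le_pow_left₀ (norm_nonneg _) (PiLp.norm_apply_le β j) 2) (sq_nonneg _)

theorem integrable_mul_echar (hh : Integrable h P) {φ : Ω → ℝ} (hφ : Measurable φ) :
    Integrable (fun w => (h w : ℂ) * echar (φ w)) P :=
  (hh.ofReal (𝕜 := ℂ)).mul_bdd (c := 1) (measurable_echar.comp hφ).aestronglyMeasurable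
    (Eventually.of_forall fun _ => (norm_echar _).le)

theorem integral_abs_mul_norm_le (hh : MemLp h 2 P) (hX : MemLp X 2 P) :
    Integrable (fun w => |h w| * ‖X w‖) P ∧
    ∫ w, |h w| * ‖X w‖ ∂P ≤ √((∫ w, h w ^ 2 ∂P) * ∫ w, ‖X w‖ ^ 2 ∂P) := by
  have h1 : MemLp (fun w => |h w|) 2 P := hh.abs
  have h2 : MemLp (fun w => ‖X w‖) 2 P := hX.norm
  refine ⟨h1.integrable_mul h2, Real.le_sqrt_of_sq_le ?_⟩
  have := sq_integral_mul_le h1 h2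
  simpa only [sq_abs] using this

/-- A Lipschitz bound for the character, integrated by Cauchy–Schwarz. It depends on `β` and `h`
only through `‖β‖` and `E[h²]`, so one radius of frequencies serves all bounded `β`. -/
theorem norm_jointTransform_sub_le (hXm : Measurable X) (hX : MemLp X 2 P) (hh : MemLp h 2 P)
    (β ω : EuclideanSpace ℝ (Fin d)) (ζ : ℝ) :
    ‖jointTransform P X i β h ω ζ - ∫ w, (h w : ℂ) * echar (-(ζ * X w i)) ∂P‖
      ≤ 2 * Real.pi * ‖ω‖ * ‖β‖ * √((∫ w, h w ^ 2 ∂P) * ∫ w, ‖X w‖ ^ 2 ∂P) := by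
  have hh1 := hh.integrable one_le_two
  have hZ := measurable_had hXm β
  obtain ⟨hint, hle⟩ := integral_abs_mul_norm_le hh hX
  rw [jointTransform, ← integral_sub
    (integrable_mul_echar hh1 (φ := fun w => -(⟪ω, had β (X w)⟫ + ζ * X w i)) (by fun_prop))
    (integrable_mul_echar hh1 (φ := fun w => -(ζ * X w i)) (by fun_prop))]
  calc _ ≤ ∫ w, 2 * Real.pi * ‖ω‖ * ‖β‖ * (|h w| * ‖X w‖) ∂P := by
        refine norm_integral_le_of_norm_le (hint.const_mul _) (Eventually.of_forall fun w => ?_)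
        have h1 : (h w : ℂ) * echar (-(⟪ω, had β (X w)⟫ + ζ * X w i))
            - (h w : ℂ) * echar (-(ζ * X w i))
            = (h w : ℂ) * ((echar (-⟪ω, had β (X w)⟫) - 1) * echar (-(ζ * X w i))) := by
          rw [neg_add, echar_add]; ring
        rw [h1, norm_mul, norm_mul, norm_echar, mul_one, Complex.norm_real, Real.norm_eq_abs]
        have h2 : ‖echar (-⟪ω, had β (X w)⟫) - 1‖ ≤ 2 * Real.pi * (‖ω‖ * (‖β‖ * ‖X w‖)) := by
          refine (norm_echar_sub_one_le _).trans ?_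
          rw [abs_neg]
          have h3 := (abs_real_inner_le_norm ω (had β (X w))).trans
            (mul_le_mul_of_nonneg_left (norm_had_le β (X w)) (norm_nonneg ω))
          exact mul_le_mul_of_nonneg_left h3 (by positivity)
        calc |h w| * ‖echar (-⟪ω, had β (X w)⟫) - 1‖
            ≤ |h w| * (2 * Real.pi * (‖ω‖ * (‖β‖ * ‖X w‖))) :=
              mul_le_mul_of_nonneg_left h2 (abs_nonneg _)
          _ = _ := by ring
    _ ≤ _ := by
        rw [integral_const_mul]
        exact mul_le_mul_of_nonneg_left hle (by positivity)

theorem continuous_integral_mul_echar (hXm : Measurable X) (hY : Integrable Y P) :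
    Continuous fun ζ : ℝ => ∫ w, (Y w : ℂ) * echar (-(ζ * X w i)) ∂P := by
  refine continuous_of_dominated (bound := fun w => |Y w|) (fun ζ => ?_) (fun ζ => ?_) hY.abs ?_
  · exact (integrable_mul_echar hY (φ := fun w => -(ζ * X w i)) (by fun_prop)).1
  · refine Eventually.of_forall fun w => ?_
    rw [norm_mul, norm_echar, mul_one, Complex.norm_real, Real.norm_eq_abs]
  · exact Eventually.of_forall fun w => by fun_prop

/-- A main effect is visible on a whole interval of frequencies, away from zero. -/
theorem exists_interval_le_norm_integral (hXm : Measurable X) (hY : Integrable Y P)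
    (hY0 : ∫ w, Y w ∂P = 0) (hmain : ¬ (condCoord P X Y {i} =ᵐ[P] 0)) :
    ∃ c : ℝ, 0 < c ∧ ∃ ζ₁ η : ℝ, 0 < η ∧ ∀ ζ ∈ Set.Icc (ζ₁ - η) (ζ₁ + η), ζ ≠ 0 ∧
      4 * c ≤ ‖∫ w, (Y w : ℂ) * echar (-(ζ * X w i)) ∂P‖ := by
  obtain ⟨ζ₁, hζ₁⟩ := exists_integral_mul_echar_ne_zero hXm hY hmain
  set u : ℝ → ℂ := fun ζ => ∫ w, (Y w : ℂ) * echar (-(ζ * X w i)) ∂P with hu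
  have hcont : Continuous fun ζ => ‖u ζ‖ := (continuous_integral_mul_echar hXm hY).norm
  have hpos : 0 < ‖u ζ₁‖ := norm_pos_iff.2 hζ₁
  obtain ⟨η, hη, hball⟩ := Metric.nhds_basis_closedBall.mem_iff.1
    (hcont.continuousAt.eventually (lt_mem_nhds (half_lt_self hpos)))
  rw [Real.closedBall_eq_Icc] at hball
  -- The transform keeps half its size near `ζ₁`. The constant `4c` is half of `‖u ζ₁‖` and leaves
  -- room for later losses of a few `c`.
  refine ⟨‖u ζ₁‖ / 8, by positivity, ζ₁, η, hη, fun ζ hζ => ?_⟩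
  have h1 : ‖u ζ₁‖ / 2 < ‖u ζ‖ := hball hζ
  refine ⟨fun h0 => ?_, by linarith⟩
  -- Centering of `Y` keeps the interval away from the singularity at `ζ = 0`.
  have h2 : u 0 = 0 := by
    simp only [hu, zero_mul, neg_zero, echar_zero, mul_one]
    rw [integral_complex_ofReal, hY0, Complex.ofReal_zero]
  rw [h0, h2, norm_zero] at h1
  linarith

end JointTransform

/-! ### Orthogonality of the regression residual. -/

section Residual

variable {Ω : Type*} {m mΩ : MeasurableSpace Ω} {P : Measure Ω} [IsProbabilityMeasure P]
  {Y ψ : Ω → ℝ}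

theorem integral_mul_condExp_eq (hm : m ≤ mΩ) (hψ : StronglyMeasurable[m] ψ)
    (hY : Integrable Y P) (hψY : Integrable (fun w => ψ w * Y w) P) :
    ∫ w, ψ w * P[Y | m] w ∂P = ∫ w, ψ w * Y w ∂P := by
  rw [← integral_condExp hm (f := fun w => ψ w * Y w)]
  exact integral_congr_ae (condExp_mul_of_stronglyMeasurable_left hψ hψY hY).symm

theorem integral_sq_sub_condExp_le (hm : m ≤ mΩ) (hY : MemLp Y 2 P) :
    ∫ w, (Y w - P[Y | m] w) ^ 2 ∂P ≤ ∫ w, Y w ^ 2 ∂P := by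
  have hE : MemLp (P[Y | m]) 2 P := hY.condExp one_le_two
  have hEY : Integrable (fun w => P[Y | m] w * Y w) P := hE.integrable_mul hY
  have h := integral_mul_condExp_eq hm stronglyMeasurable_condExp
    (hY.integrable one_le_two) hEY
  have heq : ∫ w, (Y w - P[Y | m] w) ^ 2 ∂P
      = (∫ w, Y w ^ 2 ∂P) - (∫ w, P[Y | m] w * Y w ∂P) := by
    have h2 : Integrable (fun w => P[Y | m] w * P[Y | m] w) P := hE.integrable_mul hE
    have h3 : Integrable (fun w => Y w ^ 2 - P[Y | m] w * Y w) P := hY.integrable_sq.sub hEY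
    have h4 : Integrable (fun w => P[Y | m] w * P[Y | m] w - P[Y | m] w * Y w) P := h2.sub hEY
    rw [show (fun w => (Y w - P[Y | m] w) ^ 2) = fun w => (Y w ^ 2 - P[Y | m] w * Y w)
      + (P[Y | m] w * P[Y | m] w - P[Y | m] w * Y w) by funext w; ring,
      integral_add h3 h4, integral_sub hY.integrable_sq hEY, integral_sub h2 hEY, h]
    ring
  have h5 : 0 ≤ ∫ w, P[Y | m] w * Y w ∂P := by
    rw [← h]; exact integral_nonneg fun w => mul_self_nonneg _
  linarith

/-- The residual is orthogonal to bounded `m`-measurable functions, here the real and imaginary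
parts of the character. This cancellation makes the leading term finite. -/
theorem integral_residual_mul_echar_eq_zero (hm : m ≤ mΩ) (hY : Integrable Y P) {φ : Ω → ℝ}
    (hφ : Measurable[m] φ) :
    ∫ w, ((Y w - P[Y | m] w : ℝ) : ℂ) * echar (φ w) ∂P = 0 := by
  have hφ' : Measurable φ := hφ.mono hm le_rfl
  have hres : Integrable (fun w => Y w - P[Y | m] w) P := hY.sub integrable_condExp
  have key : ∀ T : ℂ → ℝ, Continuous T → (∀ z, |T z| ≤ ‖z‖) →
      ∫ w, T (echar (φ w)) * (Y w - P[Y | m] w) ∂P = 0 := by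
    intro T hT hTb
    have hb : ∀ w, ‖T (echar (φ w))‖ ≤ 1 := fun w => (hTb _).trans (norm_echar _).le
    have hTm : Measurable[m] fun w => T (echar (φ w)) :=
      (hT.measurable.comp measurable_echar).comp hφ
    have hTm' := (hTm.mono hm le_rfl).aestronglyMeasurable (μ := P)
    have h1 : Integrable (fun w => T (echar (φ w)) * Y w) P :=
      hY.bdd_mul hTm' (Eventually.of_forall hb)
    have h2 : Integrable (fun w => T (echar (φ w)) * P[Y | m] w) P :=
      integrable_condExp.bdd_mul hTm' (Eventually.of_forall hb)
    simp_rw [mul_sub]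
    rw [integral_sub h1 h2, integral_mul_condExp_eq hm hTm.stronglyMeasurable hY h1, sub_self]
  have hi := integrable_mul_echar hres hφ'
  apply Complex.ext
  · rw [← Complex.reCLM_apply, ← ContinuousLinearMap.integral_comp_comm _ hi, Complex.zero_re,
      ← key Complex.re Complex.continuous_re Complex.abs_re_le_norm]
    refine integral_congr_ae (Eventually.of_forall fun w => ?_)
    simp only [Complex.reCLM_apply, Complex.re_ofReal_mul]; ring
  · rw [← Complex.imCLM_apply, ← ContinuousLinearMap.integral_comp_comm _ hi, Complex.zero_im,
      ← key Complex.im Complex.continuous_im Complex.abs_im_le_norm]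
    refine integral_congr_ae (Eventually.of_forall fun w => ?_)
    simp only [Complex.imCLM_apply, Complex.im_ofReal_mul]; ring

end Residual

/-! ### Finiteness and positivity of the leading term. -/

section LeadingTerm

variable {Ω : Type*} [MeasurableSpace Ω] {P : Measure Ω} [IsProbabilityMeasure P] {d : ℕ}
  {X : Ω → EuclideanSpace ℝ (Fin d)} {Y : Ω → ℝ} {i : Fin d} {β : EuclideanSpace ℝ (Fin d)}
  {μ : Measure ℝ} {a b : ℝ}

theorem leadingTerm_eq (P : Measure Ω) (X : Ω → EuclideanSpace ℝ (Fin d)) (Y : Ω → ℝ)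
    (μ : Measure ℝ) (i : Fin d) (β : EuclideanSpace ℝ (Fin d)) :
    leadingTerm P X Y μ i β = ∫⁻ t, (∫⁻ ω : EuclideanSpace ℝ (Fin d), (∫⁻ ζ : ℝ,
      ‖jointTransform P X i β (fun w => Y w - condCoord P X Y (supp β) w) ω ζ‖ₑ ^ 2
        * ENNReal.ofReal (1 / (2 * Real.pi ^ 2 * ζ ^ 2)))
      * ENNReal.ofReal (t * laplaceDensity t ω)) ∂μ := by
  unfold leadingTerm jointTransform
  refine lintegral_congr fun t => lintegral_congr fun ω => ?_
  congr 1
  refine lintegral_congr fun ζ => ?_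
  congr 4
  funext w
  rw [neg_add, echar_add, echar_neg, echar_neg, mul_assoc]

theorem memLp_residual (hY : MemLp Y 2 P) (S : Set (Fin d)) :
    MemLp (fun w => Y w - condCoord P X Y S w) 2 P :=
  hY.sub (hY.condExp one_le_two)

/-- The residual transform is controlled both by a constant and linearly in `ζ`. -/
theorem sq_norm_jointTransform_residual_le (hXm : Measurable X) (hX : MemLp X 2 P)
    (hY : MemLp Y 2 P) :
    ∃ H : ℝ, ∀ ω ζ, ‖jointTransform P X i β (fun w => Y w - condCoord P X Y (supp β) w) ω ζ‖ ^ 2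
      * (1 / (2 * Real.pi ^ 2 * ζ ^ 2)) ≤ H * (1 + ζ ^ 2)⁻¹ := by
  set h : Ω → ℝ := fun w => Y w - condCoord P X Y (supp β) w with hh
  have hh2 : MemLp h 2 P := memLp_residual hY _
  have hh1 : Integrable h P := hh2.integrable one_le_two
  obtain ⟨hint, -⟩ := integral_abs_mul_norm_le hh2 hX
  set H₁ := ∫ w, |h w| ∂P with hH₁
  set H₂ := ∫ w, |h w| * ‖X w‖ ∂P with hH₂
  have hH₁0 : 0 ≤ H₁ := integral_nonneg fun w => abs_nonneg _
  have hH₂0 : 0 ≤ H₂ := integral_nonneg fun w => mul_nonneg (abs_nonneg _) (norm_nonneg _)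
  -- `H₁` is the trivial bound on the transform, decisive for large `ζ`. The bound `2π|ζ| H₂` is
  -- decisive near zero, and after division by `2π²ζ²` its square leaves `2 H₂²`.
  refine ⟨H₁ ^ 2 + 2 * H₂ ^ 2, fun ω ζ => ?_⟩
  have hZ := measurable_had hXm β
  have b1 : ‖jointTransform P X i β h ω ζ‖ ≤ H₁ := norm_integral_mul_echar_le h _
  -- The transform vanishes at `ζ = 0`, so the difference of characters in `ζ X_i` yields the linear
  -- bound.
  have hzero : ∫ w, (h w : ℂ) * echar (-⟪ω, had β (X w)⟫) ∂P = 0 := by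
    refine integral_residual_mul_echar_eq_zero (sigmaCoord_le hXm _)
      (hY.integrable one_le_two) ?_
    have hm := measurable_had_sigmaCoord X β
    exact ((by fun_prop : Measurable fun y : EuclideanSpace ℝ (Fin d) => -⟪ω, y⟫)).comp hm
  have b2 : ‖jointTransform P X i β h ω ζ‖ ≤ 2 * Real.pi * |ζ| * H₂ := by
    rw [← sub_zero (jointTransform P X i β h ω ζ), ← hzero, jointTransform, ← integral_sub
      (integrable_mul_echar hh1 (φ := fun w => -(⟪ω, had β (X w)⟫ + ζ * X w i)) (by fun_prop))
      (integrable_mul_echar hh1 (φ := fun w => -⟪ω, had β (X w)⟫) (by fun_prop)),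
      ← integral_const_mul]
    refine norm_integral_le_of_norm_le (hint.const_mul _) (Eventually.of_forall fun w => ?_)
    have h1 : (h w : ℂ) * echar (-(⟪ω, had β (X w)⟫ + ζ * X w i))
        - (h w : ℂ) * echar (-⟪ω, had β (X w)⟫)
        = (h w : ℂ) * (echar (-⟪ω, had β (X w)⟫) * (echar (-(ζ * X w i)) - 1)) := by
      rw [neg_add, echar_add]; ring
    rw [h1, norm_mul, norm_mul, norm_echar, one_mul, Complex.norm_real, Real.norm_eq_abs]
    have h2 : ‖echar (-(ζ * X w i)) - 1‖ ≤ 2 * Real.pi * (|ζ| * ‖X w‖) := by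
      refine (norm_echar_sub_one_le _).trans ?_
      rw [abs_neg, abs_mul]
      have := PiLp.norm_apply_le (X w) i
      rw [Real.norm_eq_abs] at this
      gcongr
    calc |h w| * ‖echar (-(ζ * X w i)) - 1‖ ≤ |h w| * (2 * Real.pi * (|ζ| * ‖X w‖)) :=
          mul_le_mul_of_nonneg_left h2 (abs_nonneg _)
      _ = _ := by ring
  set N := ‖jointTransform P X i β h ω ζ‖ with hN
  have hN0 : 0 ≤ N := norm_nonneg _
  have hπ : 1 ≤ Real.pi ^ 2 := by nlinarith [Real.pi_gt_three]
  -- At `ζ = 0` the weight is zero, by the convention `1 / 0 = 0`.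
  rcases eq_or_ne ζ 0 with h0 | h0
  · subst h0
    simp; positivity
  have hζ : 0 < ζ ^ 2 := by positivity
  have s1 : N ^ 2 ≤ H₁ ^ 2 := pow_le_pow_left₀ hN0 b1 2
  have s2 : N ^ 2 ≤ 4 * Real.pi ^ 2 * ζ ^ 2 * H₂ ^ 2 := by
    calc N ^ 2 ≤ (2 * Real.pi * |ζ| * H₂) ^ 2 := pow_le_pow_left₀ hN0 b2 2
      _ = _ := by rw [mul_pow, mul_pow, mul_pow, sq_abs]; ring
  rw [mul_one_div, ← div_eq_mul_inv, div_le_div_iff₀ (by positivity) (by positivity)]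
  have s3 : H₁ ^ 2 * ζ ^ 2 ≤ H₁ ^ 2 * ζ ^ 2 * Real.pi ^ 2 :=
    le_mul_of_one_le_right (by positivity) hπ
  have s4 : N ^ 2 * ζ ^ 2 ≤ H₁ ^ 2 * ζ ^ 2 := mul_le_mul_of_nonneg_right s1 hζ.le
  have s5 : 0 ≤ H₁ ^ 2 * ζ ^ 2 * Real.pi ^ 2 := by positivity
  nlinarith

theorem leadingTerm_lt_top [IsFiniteMeasure μ] (ha : 0 < a) (hμ : ∀ᵐ t ∂μ, t ∈ Set.Icc a b)
    (hXm : Measurable X) (hX : MemLp X 2 P) (hY : MemLp Y 2 P) :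
    leadingTerm P X Y μ i β < ∞ := by
  obtain ⟨H, hH⟩ := sq_norm_jointTransform_residual_le (i := i) (β := β) hXm hX hY
  rw [leadingTerm_eq]
  set h : Ω → ℝ := fun w => Y w - condCoord P X Y (supp β) w with hh
  set L := ∫⁻ ζ : ℝ, ENNReal.ofReal (H * (1 + ζ ^ 2)⁻¹) with hL
  have hLtop : L < ∞ := (integrable_inv_one_add_sq.const_mul H).lintegral_lt_top
  have hinner : ∀ ω, ∫⁻ ζ : ℝ, ‖jointTransform P X i β h ω ζ‖ₑ ^ 2
      * ENNReal.ofReal (1 / (2 * Real.pi ^ 2 * ζ ^ 2)) ≤ L := by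
    intro ω
    refine lintegral_mono fun ζ => ?_
    rw [← ofReal_norm, ← ENNReal.ofReal_pow (norm_nonneg _), ← ENNReal.ofReal_mul (by positivity)]
    exact ENNReal.ofReal_le_ofReal (hH ω ζ)
  refine lt_of_le_of_lt (b := ∫⁻ _t, L * ENNReal.ofReal b ∂μ) (lintegral_mono_ae ?_) ?_
  · filter_upwards [hμ] with t ht
    have ht0 : 0 < t := ha.trans_le ht.1
    calc _ ≤ ∫⁻ ω : EuclideanSpace ℝ (Fin d), L * ENNReal.ofReal (t * laplaceDensity t ω) :=
          lintegral_mono fun ω => mul_le_mul_left (hinner ω) _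
      _ = L * ENNReal.ofReal t := by
          simp_rw [ENNReal.ofReal_mul ht0.le]
          rw [lintegral_const_mul' _ _ hLtop.ne, lintegral_const_mul' _ _ ENNReal.ofReal_ne_top,
            lintegral_laplaceDensity ht0, mul_one]
      _ ≤ L * ENNReal.ofReal b := mul_le_mul_right (ENNReal.ofReal_le_ofReal ht.2) _
  · rw [lintegral_const]
    exact ENNReal.mul_lt_top (ENNReal.mul_lt_top hLtop ENNReal.ofReal_lt_top)
      (measure_lt_top _ _)

theorem le_prod_of_norm_le_one (ha : 0 < a) (hb : 0 < b) {ω : EuclideanSpace ℝ (Fin d)} (hω : ‖ω‖ ≤ 1) :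
    (2 * a / (4 * Real.pi ^ 2 + b ^ 2)) ^ d
      ≤ ∏ j, 2 * a / (4 * Real.pi ^ 2 * ω j ^ 2 + b ^ 2) := by
  calc (2 * a / (4 * Real.pi ^ 2 + b ^ 2)) ^ d
      = ∏ _j : Fin d, 2 * a / (4 * Real.pi ^ 2 + b ^ 2) := by
        rw [Finset.prod_const, Finset.card_univ, Fintype.card_fin]
    _ ≤ _ := by
        refine Finset.prod_le_prod (fun j _ => by positivity) (fun j _ => ?_)
        have h1 : ω j ^ 2 ≤ 1 := by
          rw [← sq_abs, ← Real.norm_eq_abs]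
          exact pow_le_one₀ (norm_nonneg _) ((PiLp.norm_apply_le ω j).trans hω)
        have h2 : 4 * Real.pi ^ 2 * ω j ^ 2 ≤ 4 * Real.pi ^ 2 :=
          mul_le_of_le_one_right (by positivity) h1
        gcongr

/-- A lower bound at `ω = 0` persists for `‖ω‖ ≤ ρ` with loss `c`; at `ω = 0` the transform no
longer involves `β`. -/
theorem le_norm_jointTransform (hXm : Measurable X) (hX : MemLp X 2 P) {h : Ω → ℝ}
    (hh : MemLp h 2 P) {V B ρ c m ζ : ℝ} (hV : ∫ w, h w ^ 2 ∂P ≤ V) (hB : ‖β‖ ≤ B)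
    (hρ : ρ * (2 * Real.pi * B * √(V * ∫ w, ‖X w‖ ^ 2 ∂P)) ≤ c)
    (hm : m ≤ ‖∫ w, (h w : ℂ) * echar (-(ζ * X w i)) ∂P‖)
    {ω : EuclideanSpace ℝ (Fin d)} (hω : ‖ω‖ ≤ ρ) :
    m - c ≤ ‖jointTransform P X i β h ω ζ‖ := by
  have h1 := norm_jointTransform_sub_le (i := i) hXm hX hh β ω ζ
  have h2 : 2 * Real.pi * ‖ω‖ * ‖β‖ * √((∫ w, h w ^ 2 ∂P) * ∫ w, ‖X w‖ ^ 2 ∂P) ≤ c := by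
    refine le_trans ?_ hρ
    have h3 : √((∫ w, h w ^ 2 ∂P) * ∫ w, ‖X w‖ ^ 2 ∂P) ≤ √(V * ∫ w, ‖X w‖ ^ 2 ∂P) :=
      Real.sqrt_le_sqrt (mul_le_mul_of_nonneg_right hV (integral_nonneg fun w => sq_nonneg _))
    have hρ0 : 0 ≤ ρ := (norm_nonneg ω).trans hω
    have hB0 : 0 ≤ B := (norm_nonneg β).trans hB
    calc 2 * Real.pi * ‖ω‖ * ‖β‖ * √((∫ w, h w ^ 2 ∂P) * ∫ w, ‖X w‖ ^ 2 ∂P)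
        ≤ 2 * Real.pi * ρ * B * √(V * ∫ w, ‖X w‖ ^ 2 ∂P) := by gcongr
      _ = _ := by ring
  have h4 := norm_sub_norm_le (∫ w, (h w : ℂ) * echar (-(ζ * X w i)) ∂P)
    (jointTransform P X i β h ω ζ)
  rw [norm_sub_rev] at h4
  linarith

theorem exists_radius (M : ℝ) {c : ℝ} (hM : 0 ≤ M) (hc : 0 < c) :
    ∃ ρ : ℝ, 0 < ρ ∧ ρ ≤ 1 ∧ ρ * M ≤ c := by
  refine ⟨min 1 (c / (M + 1)), by positivity, min_le_left _ _, ?_⟩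
  calc min 1 (c / (M + 1)) * M ≤ c / (M + 1) * (M + 1) :=
        mul_le_mul (min_le_right _ _) (by linarith) hM (by positivity)
    _ = c := by field_simp

/-- A uniform positive lower bound for the leading term on bounded sets. -/
theorem exists_pos_le_leadingTerm [IsProbabilityMeasure μ] (ha : 0 < a) (hab : a ≤ b)
    (hμ : ∀ᵐ t ∂μ, t ∈ Set.Icc a b) (hXm : Measurable X) (hX : MemLp X 2 P) (hY : MemLp Y 2 P)
    (hY0 : ∫ w, Y w ∂P = 0)
    (hind : ∀ S : Set (Fin d), i ∉ S →
      Indep (MeasurableSpace.comap (fun w => X w i) inferInstance) (sigmaCoord X S) P)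
    (hmain : ¬ (condCoord P X Y {i} =ᵐ[P] 0)) {B : ℝ} (hB0 : 0 ≤ B) :
    ∃ L : ℝ≥0∞, 0 < L ∧ ∀ β : EuclideanSpace ℝ (Fin d), β i = 0 → ‖β‖ ≤ B →
      L ≤ leadingTerm P X Y μ i β := by
  have hY1 : Integrable Y P := hY.integrable one_le_two
  have hb : 0 < b := ha.trans_le hab
  obtain ⟨c, hc, ζ₁, η, hη, hu⟩ := exists_interval_le_norm_integral hXm hY1 hY0 hmain
  set V := ∫ w, Y w ^ 2 ∂P with hV
  obtain ⟨ρ, hρ0, hρ1, hρ⟩ := exists_radius (2 * Real.pi * B * √(V * ∫ w, ‖X w‖ ^ 2 ∂P))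
    (by positivity) hc
  set q := (2 * a / (4 * Real.pi ^ 2 + b ^ 2)) ^ d with hq
  have hq0 : 0 < q := by positivity
  set Lζ := ENNReal.ofReal ((3 * c) ^ 2 * (1 / (2 * Real.pi ^ 2 * (|ζ₁| + η) ^ 2)))
    * volume (Set.Icc (ζ₁ - η) (ζ₁ + η)) with hLζ
  have hζη : 0 < |ζ₁| + η := by positivity
  have hLζ0 : Lζ ≠ 0 := by
    refine mul_ne_zero (by rw [Ne, ENNReal.ofReal_eq_zero, not_le]; positivity) ?_
    rw [Real.volume_Icc, Ne, ENNReal.ofReal_eq_zero, not_le]; linarith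
  refine ⟨Lζ * ENNReal.ofReal (a * q)
    * volume (Metric.closedBall (0 : EuclideanSpace ℝ (Fin d)) ρ), ?_, fun β hβ hβB => ?_⟩
  · refine pos_iff_ne_zero.2 (mul_ne_zero (mul_ne_zero hLζ0 ?_)
      (Metric.measure_closedBall_pos volume _ hρ0).ne')
    rw [Ne, ENNReal.ofReal_eq_zero, not_le]; positivity
  rw [leadingTerm_eq]
  set h : Ω → ℝ := fun w => Y w - condCoord P X Y (supp β) w with hh
  have hh2 : MemLp h 2 P := memLp_residual hY _
  have hcond : Integrable (condCoord P X Y (supp β)) P := integrable_condExp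
  have hiβ : i ∉ supp β := fun h0 => h0 hβ
  have hle := sigmaCoord_le hXm (supp β)
  have hV' : ∫ w, h w ^ 2 ∂P ≤ V := integral_sq_sub_condExp_le hle hY
  -- `E[Y | X_{supp β}]` is independent of `X_i` and has mean zero, so it drops out and the bound at
  -- `ω = 0` is the same for all `β`.
  have hbase : ∀ ζ : ℝ, ∫ w, (h w : ℂ) * echar (-(ζ * X w i)) ∂P
      = ∫ w, (Y w : ℂ) * echar (-(ζ * X w i)) ∂P := by
    intro ζ
    have h1 := integral_mul_echar_of_indep (A := fun w => X w i) (by fun_prop) hle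
      (hind _ hiβ) (F := condCoord P X Y (supp β)) stronglyMeasurable_condExp.measurable ζ
    have h2 : ∫ w, condCoord P X Y (supp β) w ∂P = 0 := by
      rw [← hY0]; exact integral_condExp hle
    rw [h2, Complex.ofReal_zero, zero_mul] at h1
    have h3 := integral_sub
      (integrable_mul_echar hY1 (φ := fun w => -(ζ * X w i)) (by fun_prop))
      (integrable_mul_echar hcond (φ := fun w => -(ζ * X w i)) (by fun_prop))
    rw [h1, sub_zero] at h3
    rw [← h3]
    refine integral_congr_ae (Eventually.of_forall fun w => ?_)
    simp only [hh]; push_cast; ring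
  have hjoint : ∀ ω : EuclideanSpace ℝ (Fin d), ‖ω‖ ≤ ρ → ∀ ζ ∈ Set.Icc (ζ₁ - η) (ζ₁ + η),
      3 * c ≤ ‖jointTransform P X i β h ω ζ‖ := by
    intro ω hω ζ hζ
    have h1 := le_norm_jointTransform (m := 4 * c) (ζ := ζ) hXm hX hh2 hV' hβB hρ
      (by rw [hbase]; exact (hu ζ hζ).2) hω
    linarith
  have hinner : ∀ ω : EuclideanSpace ℝ (Fin d), ‖ω‖ ≤ ρ → Lζ ≤ ∫⁻ ζ : ℝ,
      ‖jointTransform P X i β h ω ζ‖ₑ ^ 2 * ENNReal.ofReal (1 / (2 * Real.pi ^ 2 * ζ ^ 2)) := by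
    intro ω hω
    rw [hLζ, ← setLIntegral_const]
    refine (setLIntegral_mono' measurableSet_Icc fun ζ hζ => ?_).trans
      (setLIntegral_le_lintegral _ _)
    rw [← ofReal_norm, ← ENNReal.ofReal_pow (norm_nonneg _), ← ENNReal.ofReal_mul (by positivity)]
    refine ENNReal.ofReal_le_ofReal ?_
    have hζ0 := (hu ζ hζ).1
    have hζ2 : ζ ^ 2 ≤ (|ζ₁| + η) ^ 2 := by
      rw [← sq_abs]
      refine pow_le_pow_left₀ (abs_nonneg _) ?_ 2
      have h1 := neg_abs_le ζ₁
      have h2 := le_abs_self ζ₁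
      exact abs_le.2 ⟨by linarith [hζ.1], by linarith [hζ.2]⟩
    have hj := hjoint ω hω ζ hζ
    gcongr
  rw [← mul_one (_ * volume (Metric.closedBall (0 : EuclideanSpace ℝ (Fin d)) ρ)),
    ← measure_univ (μ := μ), ← lintegral_const]
  refine lintegral_mono_ae ?_
  filter_upwards [hμ] with t ht
  rw [← setLIntegral_const]
  refine (setLIntegral_mono' Metric.isClosed_closedBall.measurableSet fun ω hω => ?_).trans
    (setLIntegral_le_lintegral _ _)
  have hω' : ‖ω‖ ≤ ρ := by simpa using hω
  have hqt : q ≤ laplaceDensity t ω :=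
    (le_prod_of_norm_le_one ha hb (hω'.trans hρ1)).trans (le_laplaceDensity ha ht ω)
  exact mul_le_mul' (hinner ω hω') (ENNReal.ofReal_le_ofReal
    (mul_le_mul ht.1 hqt hq0.le (ha.le.trans ht.1)))

end LeadingTerm

/-! ### Lower bounds for integrals and measures with a density. -/

section MeasureBounds

theorem const_mul_measureReal_le_integral {α : Type*} [MeasurableSpace α] {ρ : Measure α}
    {f : α → ℝ} (hf : Integrable f ρ) (h0 : ∀ z, 0 ≤ f z) {S : Set α} (hS : MeasurableSet S)
    (hSfin : ρ S ≠ ∞) {c : ℝ} (hc : ∀ z ∈ S, c ≤ f z) : c * ρ.real S ≤ ∫ z, f z ∂ρ := by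
  rw [mul_comm, ← smul_eq_mul, ← setIntegral_const]
  exact (setIntegral_mono_on (integrableOn_const hSfin) hf.integrableOn hS hc).trans
    (setIntegral_le_integral hf (Eventually.of_forall h0))

variable {V : Type*} [MeasureSpace V]

theorem const_mul_measureReal_le_withDensity {k : V → ℝ} (hk : Integrable k) {A : Set V}
    (hA : MeasurableSet A) {c : ℝ} (hc0 : 0 ≤ c) (hc : ∀ ω ∈ A, c ≤ k ω) :
    c * (volume : Measure V).real A
      ≤ (volume.withDensity fun ω => ENNReal.ofReal (k ω)).real A := by
  have hfin : IsFiniteMeasure (volume.withDensity fun ω => ENNReal.ofReal (k ω)) :=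
    isFiniteMeasure_withDensity_ofReal hk.2
  rw [measureReal_def, measureReal_def, ← ENNReal.toReal_ofReal hc0, ← ENNReal.toReal_mul]
  refine ENNReal.toReal_mono (measure_ne_top _ _) ?_
  rw [withDensity_apply _ hA, ← setLIntegral_const]
  exact setLIntegral_mono' hA fun ω hω => ENNReal.ofReal_le_ofReal (hc ω hω)

theorem integral_withDensity_ofReal {k : V → ℝ} (hk : Measurable k) (hk0 : ∀ ω, 0 ≤ k ω)
    (f : V → ℂ) : ∫ ω, f ω ∂(volume.withDensity fun ω => ENNReal.ofReal (k ω))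
      = ∫ ω, (k ω : ℂ) * f ω := by
  refine (integral_withDensity_eq_integral_smul hk.real_toNNReal f).trans ?_
  refine integral_congr_ae (Eventually.of_forall fun ω => ?_)
  simp only [NNReal.smul_def, Real.coe_toNNReal _ (hk0 ω), Complex.real_smul]

end MeasureBounds

/-! ### Exponential approximation of the absolute value. -/

section Truncation

/-- The error `x - (1 - exp (-τx)) / τ` of the exponential approximation of `x`. -/
noncomputable def expError (τ x : ℝ) : ℝ := x - (1 - Real.exp (-(τ * x))) / τ

theorem expError_nonneg {τ x : ℝ} (hτ : 0 < τ) : 0 ≤ expError τ x := by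
  have := Real.add_one_le_exp (-(τ * x))
  rw [expError, sub_nonneg, div_le_iff₀ hτ]
  linarith

theorem expError_le_self {τ x : ℝ} (hτ : 0 < τ) (hx : 0 ≤ x) : expError τ x ≤ x := by
  have h : Real.exp (-(τ * x)) ≤ 1 := Real.exp_le_one_iff.2 (by have := mul_nonneg hτ.le hx; linarith)
  have : 0 ≤ (1 - Real.exp (-(τ * x))) / τ := div_nonneg (by linarith) hτ.le
  rw [expError]; linarith

/-- Gives pointwise convergence as `τ → 0`; together with the dominating bound `expError τ x ≤ x` it
makes the error vanish in `L²` with only second moments. -/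
theorem expError_le_mul_sq {τ x : ℝ} (hτ : 0 < τ) (hx : 0 ≤ x) :
    expError τ x ≤ τ * x ^ 2 := by
  have hy : 0 ≤ τ * x := mul_nonneg hτ.le hx
  have h1 := Real.add_one_le_exp (τ * x)
  have h2 : Real.exp (-(τ * x)) * Real.exp (τ * x) = 1 := by
    rw [← Real.exp_add]; simp
  have h3 := Real.exp_nonneg (-(τ * x))
  have h4 : Real.exp (-(τ * x)) * (1 + τ * x) ≤ 1 := by nlinarith
  have h5 : Real.exp (-(τ * x)) ≤ 1 - τ * x + (τ * x) ^ 2 := by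
    have : 1 ≤ (1 - τ * x + (τ * x) ^ 2) * (1 + τ * x) := by nlinarith [pow_nonneg hy 3]
    exact le_of_mul_le_mul_right (h4.trans this) (by linarith)
  rw [expError, sub_le_iff_le_add, ← sub_le_iff_le_add', le_div_iff₀ hτ]
  nlinarith

theorem tendsto_integral_sq_expError {α : Type*} [MeasurableSpace α] {ρ : Measure α} {D : α → ℝ}
    (hD : MemLp D 2 ρ) (hD0 : ∀ p, 0 ≤ D p) :
    Tendsto (fun τ => ∫ p, expError τ (D p) ^ 2 ∂ρ) (𝓝[>] 0) (𝓝 0) := by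
  have hz : ∫ _ : α, (0 : ℝ) ∂ρ = 0 := integral_zero α ℝ
  conv => rhs; rw [← hz]
  refine tendsto_integral_filter_of_dominated_convergence (fun p => D p ^ 2) ?_ ?_
    hD.integrable_sq ?_
  · refine Eventually.of_forall fun τ => ?_
    have hc : Continuous fun x => expError τ x ^ 2 := by unfold expError; fun_prop
    exact hc.comp_aestronglyMeasurable hD.1
  · filter_upwards [self_mem_nhdsWithin] with τ hτ
    refine Eventually.of_forall fun p => ?_
    rw [Real.norm_of_nonneg (sq_nonneg _)]
    exact pow_le_pow_left₀ (expError_nonneg hτ) (expError_le_self hτ (hD0 p)) 2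
  · refine Eventually.of_forall fun p => ?_
    have h1 : Tendsto (fun τ : ℝ => (τ * D p ^ 2) ^ 2) (𝓝[>] 0) (𝓝 0) := by
      have h : Continuous fun τ : ℝ => (τ * D p ^ 2) ^ 2 := by fun_prop
      have h2 := h.tendsto 0
      simp only [zero_mul, ne_eq, OfNat.ofNat_ne_zero, not_false_eq_true, zero_pow] at h2
      exact h2.mono_left nhdsWithin_le_nhds
    refine squeeze_zero' (Eventually.of_forall fun τ => sq_nonneg _) ?_ h1
    filter_upwards [self_mem_nhdsWithin] with τ hτ
    exact pow_le_pow_left₀ (expError_nonneg hτ) (expError_le_mul_sq hτ (hD0 p)) 2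

end Truncation

/-! ### The ridge residual for small regularization. -/

section SmallRegularization

variable {Ω : Type*} [MeasurableSpace Ω] {P : Measure Ω} [IsProbabilityMeasure P] {d : ℕ}
  {X : Ω → EuclideanSpace ℝ (Fin d)} {Y g : Ω → ℝ} {i : Fin d} {β : EuclideanSpace ℝ (Fin d)}
  {μ : Measure ℝ} {a b lam : ℝ} {k K : EuclideanSpace ℝ (Fin d) → ℝ}
  {Z : Ω → EuclideanSpace ℝ (Fin d)}

theorem kernelForm_const_mul (κ : Ω × Ω → ℝ) (g : Ω → ℝ) (c : ℝ) :
    kernelForm P κ (fun w => c * g w) (fun w => c * g w) = c ^ 2 * kernelForm P κ g g := by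
  rw [kernelForm, kernelForm, ← integral_const_mul]
  congr 1; funext p; ring

/-- The residual `r = λg` of the ridge problem: energy and kernel-form estimates. -/
theorem residual_bounds (hk : IsSpectralDensity k K) (hZ : Measurable Z) (hY : MemLp Y 2 P)
    (hlam : 0 < lam) (hg : MemLp g 2 P)
    (hdual : ∀ᵐ w ∂P, Y w = (∫ w', K (Z w - Z w') * g w' ∂P) + lam * g w) :
    ∫ w, (lam * g w) ^ 2 ∂P ≤ ∫ w, Y w ^ 2 ∂P ∧
    kernelForm P (fun p => K (Z p.1 - Z p.2)) (fun w => lam * g w) (fun w => lam * g w)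
      ≤ lam * ∫ w, Y w ^ 2 ∂P := by
  have h1 := integral_mul_eq_of_dual hk hZ hg hg hdual
  have h2 := hk.kernelForm_nonneg hZ (hg.integrable one_le_two)
  have h3 := sq_integral_mul_le hY hg
  have h4 : ∫ w, g w * g w ∂P = ∫ w, g w ^ 2 ∂P := by simp only [sq]
  rw [h4] at h1
  rw [kernelForm_const_mul]
  simp_rw [mul_pow]
  rw [integral_const_mul]
  set Q := kernelForm P (fun p => K (Z p.1 - Z p.2)) g g with hQ
  set G := ∫ w, g w ^ 2 ∂P with hG
  set V := ∫ w, Y w ^ 2 ∂P with hV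
  set U := ∫ w, Y w * g w ∂P with hU
  have hG0 : 0 ≤ G := integral_nonneg fun w => sq_nonneg _
  have hV0 : 0 ≤ V := integral_nonneg fun w => sq_nonneg _
  -- The dual equation tested against `g` reads `U = Q + λ G`; hence `λ G ≤ U`, while Cauchy–Schwarz
  -- gives `U² ≤ V G`.
  have hGV : lam ^ 2 * G ≤ V := by
    rcases hG0.eq_or_lt with h0 | h0
    · rw [← h0, mul_zero]; exact hV0
    · refine le_of_mul_le_mul_right ?_ h0
      have h5 : (lam * G) ^ 2 ≤ U ^ 2 :=
        pow_le_pow_left₀ (by positivity) (by linarith) 2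
      calc lam ^ 2 * G * G = (lam * G) ^ 2 := by ring
        _ ≤ V * G := h5.trans h3
  refine ⟨hGV, ?_⟩
  have hUV : lam * U ≤ V := by
    refine abs_le_of_sq_le_sq' ?_ hV0 |>.2
    calc (lam * U) ^ 2 = lam ^ 2 * U ^ 2 := by ring
      _ ≤ lam ^ 2 * (V * G) := by gcongr
      _ = V * (lam ^ 2 * G) := by ring
      _ ≤ V * V := by gcongr
      _ = V ^ 2 := by ring
  have h6 : 0 ≤ lam * G := by positivity
  calc lam ^ 2 * Q = lam * (lam * Q) := by ring
    _ ≤ lam * (lam * U) := by gcongr; linarith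
    _ ≤ lam * V := by gcongr

/-- The fitted function of the ridge problem does not see `X_i` when `β_i = 0`. -/
theorem norm_integral_residual_ge (hk : IsSpectralDensity k K) (hXm : Measurable X)
    (hY : MemLp Y 2 P) (hY0 : ∫ w, Y w ∂P = 0)
    (hind : ∀ S : Set (Fin d), i ∉ S →
      Indep (MeasurableSpace.comap (fun w => X w i) inferInstance) (sigmaCoord X S) P)
    (hβ : β i = 0) (hg : MemLp g 2 P)
    (hdual : ∀ᵐ w ∂P, Y w = (∫ w', K (had β (X w) - had β (X w')) * g w' ∂P) + lam * g w)
    (ζ : ℝ) :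
    ‖∫ w, (Y w : ℂ) * echar (-(ζ * X w i)) ∂P‖ - |∫ w, lam * g w ∂P|
      ≤ ‖∫ w, ((lam * g w : ℝ) : ℂ) * echar (-(ζ * X w i)) ∂P‖ := by
  have hY1 := hY.integrable one_le_two
  have hr : Integrable (fun w => lam * g w) P := (hg.integrable one_le_two).const_mul lam
  obtain ⟨f, hf, -⟩ := hk.exists_representer (measurable_had hXm β) (hg.integrable one_le_two)
  have hFm : Measurable[sigmaCoord X (supp β)] fun w => f.toFun (had β (X w)) :=
    f.continuous_toFun.measurable.comp (measurable_had_sigmaCoord X β)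
  have hF : Integrable (fun w => f.toFun (had β (X w))) P :=
    (f.memLp_comp hk (measurable_had hXm β)).integrable one_le_two
  have hYF : ∀ᵐ w ∂P, Y w = f.toFun (had β (X w)) + lam * g w := by
    filter_upwards [hdual] with w hw
    rw [hf]; exact hw
  -- Since `Y` is centered, the fit and the residual have opposite means.
  have hmean : ∫ w, f.toFun (had β (X w)) ∂P = -∫ w, lam * g w ∂P := by
    have h := integral_congr_ae hYF
    rw [hY0, integral_add hF hr] at h
    linarith
  have h1 := integral_mul_echar_of_indep (A := fun w => X w i) (by fun_prop)
    (sigmaCoord_le hXm (supp β)) (hind _ fun h0 => h0 hβ) hFm ζ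
  have hm : Measurable fun w => -(ζ * X w i) := by fun_prop
  have h2 : ∫ w, (Y w : ℂ) * echar (-(ζ * X w i)) ∂P
      = (∫ w, (f.toFun (had β (X w)) : ℂ) * echar (-(ζ * X w i)) ∂P)
        + ∫ w, ((lam * g w : ℝ) : ℂ) * echar (-(ζ * X w i)) ∂P := by
    rw [← integral_add (integrable_mul_echar hF hm) (integrable_mul_echar hr hm)]
    refine integral_congr_ae ?_
    filter_upwards [hYF] with w hw
    rw [hw]; push_cast; ring
  have h3 : ‖∫ w, (f.toFun (had β (X w)) : ℂ) * echar (-(ζ * X w i)) ∂P‖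
      ≤ |∫ w, lam * g w ∂P| := by
    rw [h1, hmean, norm_mul, Complex.norm_real, Real.norm_eq_abs, abs_neg]
    refine mul_le_of_le_one_right (abs_nonneg _) ?_
    have := norm_integral_mul_echar_le (P := P) (fun _ => (1 : ℝ)) (fun w => -(ζ * X w i))
    simpa using this
  have h4 := norm_add_le (∫ w, (f.toFun (had β (X w)) : ℂ) * echar (-(ζ * X w i)) ∂P)
    (∫ w, ((lam * g w : ℝ) : ℂ) * echar (-(ζ * X w i)) ∂P)
  rw [← h2] at h4
  linarith

theorem lOneDensity_sizeBiased_le [IsFiniteMeasure μ] (ha : 0 < a)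
    (hμ : ∀ᵐ t ∂μ, t ∈ Set.Icc a b) (ω : EuclideanSpace ℝ (Fin d)) :
    lOneDensity d (sizeBiased μ) ω ≤ b * lOneDensity d μ ω := by
  have hi := ae_integrable_laplaceDensity_apply (d := d) ha hμ ω
  rw [lOneDensity, integral_sizeBiased ha hμ, lOneDensity, ← integral_const_mul]
  refine integral_mono_of_nonneg ?_ (hi.const_mul b) ?_
  · filter_upwards [hμ] with t ht
    have ht0 : 0 ≤ t := ha.le.trans ht.1
    exact mul_nonneg ht0 (laplaceDensity_nonneg ht0 ω)
  · filter_upwards [hμ] with t ht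
    exact mul_le_mul_of_nonneg_right ht.2 (laplaceDensity_nonneg (ha.le.trans ht.1) ω)

/-- The spectral density for `t μ(dt)` is at most `b k` because `t ≤ b`. Thus the `O(λ)` bound on
the form of `K` passes to the kernel in the derivative. -/
theorem kernelForm_sizeBiased_le [IsFiniteMeasure μ] [NeZero μ] (ha : 0 < a) (hab : a ≤ b)
    (hμ : ∀ᵐ t ∂μ, t ∈ Set.Icc a b) (hZ : Measurable Z) {r : Ω → ℝ} (hr : Integrable r P) :
    kernelForm P (fun p => lOneKernel (sizeBiased μ) (Z p.1 - Z p.2)) r r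
      ≤ b * kernelForm P (fun p => lOneKernel μ (Z p.1 - Z p.2)) r r := by
  have := isFiniteMeasure_sizeBiased ha hμ
  have hk := isSpectralDensity_lOneDensity (d := d) ha hab hμ (NeZero.ne μ)
  have hk1 := isSpectralDensity_lOneDensity (d := d) ha hab (ae_sizeBiased hμ)
    (sizeBiased_ne_zero ha hμ)
  obtain ⟨h1, h2⟩ := hk.integral_normSq_featureTransform hr hZ
  obtain ⟨h3, h4⟩ := hk1.integral_normSq_featureTransform hr hZ
  rw [← h2, ← h4, ← integral_const_mul]
  refine integral_mono h3 (h1.const_mul b) fun ω => ?_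
  have h5 := mul_le_mul_of_nonneg_left (lOneDensity_sizeBiased_le (d := d) ha hμ ω)
    (sq_nonneg ‖featureTransform P Z r ω‖)
  simp only
  linarith

/-- The spectral representation of the product of a kernel and `exp (-τ|X_i - X_i'|)`. -/
theorem le_kernelForm_exp_mul (hk : IsSpectralDensity k K) (hXm : Measurable X) {r : Ω → ℝ}
    (hr : Integrable r P) {τ : ℝ} (hτ : 0 < τ) (β : EuclideanSpace ℝ (Fin d))
    {S : Set (EuclideanSpace ℝ (Fin d))} {I : Set ℝ} (hS : MeasurableSet S)
    (hI : MeasurableSet I) {c k₀ q₀ : ℝ} (hc : 0 ≤ c) (hk₀ : 0 ≤ k₀) (hq₀ : 0 ≤ q₀)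
    (hkS : ∀ ω ∈ S, k₀ ≤ k ω) (hqI : ∀ ζ ∈ I, q₀ ≤ laplaceDensity₁ τ ζ)
    (hle : ∀ ω ∈ S, ∀ ζ ∈ I, c ≤ ‖jointTransform P X i β r ω ζ‖) :
    c ^ 2 * ((k₀ * volume.real S) * (q₀ * volume.real I))
      ≤ kernelForm P (fun p => Real.exp (-(τ * |X p.1 i - X p.2 i|))
        * K (had β (X p.1) - had β (X p.2))) r r := by
  have hZ := measurable_had hXm β
  set ν₁ : Measure (EuclideanSpace ℝ (Fin d)) :=
    volume.withDensity fun ω => ENNReal.ofReal (k ω) with hν₁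
  set ν₂ : Measure ℝ := volume.withDensity fun ζ => ENNReal.ofReal (laplaceDensity₁ τ ζ) with hν₂
  have hq1 := integrable_laplaceDensity₁ hτ
  have hqm : Measurable (laplaceDensity₁ τ) := by unfold laplaceDensity₁; fun_prop
  have f1 : IsFiniteMeasure ν₁ := isFiniteMeasure_withDensity_ofReal hk.integrable.2
  have f2 : IsFiniteMeasure ν₂ := isFiniteMeasure_withDensity_ofReal hq1.2
  -- A product of kernels has a product spectral measure: here `k dω` times the Laplace density in
  -- `ζ`. Restricting the spectral integral to `S × I` gives the lower bound.
  let θ : Ω → EuclideanSpace ℝ (Fin d) × ℝ → ℝ := fun w z => ⟪z.1, had β (X w)⟫ + z.2 * X w i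
  have hθ : Measurable (Function.uncurry θ) := by
    refine Measurable.add ?_ ?_
    · exact Measurable.inner (measurable_fst.comp measurable_snd) (hZ.comp measurable_fst)
    · refine (measurable_snd.comp measurable_snd).mul ?_
      exact (by fun_prop : Measurable fun w => X w i).comp measurable_fst
  rw [kernelForm_self_eq_integral_normSq (ν := ν₁.prod ν₂) (θ := θ) hr hθ]
  · have h1 : c ^ 2 * (ν₁.prod ν₂).real (S ×ˢ I)
        ≤ ∫ z, ‖∫ w, (r w : ℂ) * echar (-θ w z) ∂P‖ ^ 2 ∂(ν₁.prod ν₂) := by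
      refine const_mul_measureReal_le_integral (integrable_normSq_integral_mul_echar hr hθ)
        (fun z => sq_nonneg _) (hS.prod hI) (measure_ne_top _ _) ?_
      rintro ⟨ω, ζ⟩ ⟨hω, hζ⟩
      exact pow_le_pow_left₀ hc (hle ω hω ζ hζ) 2
    refine le_trans ?_ h1
    rw [measureReal_prod_prod]
    have h2 := const_mul_measureReal_le_withDensity hk.integrable hS hk₀ hkS
    have h3 := const_mul_measureReal_le_withDensity hq1 hI hq₀ hqI
    gcongr
  · intro p
    have h1 := integral_prod_mul (μ := ν₁) (ν := ν₂)
      (fun ω => echar ⟪ω, had β (X p.1) - had β (X p.2)⟫)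
      (fun ζ => echar (ζ * (X p.1 i - X p.2 i)))
    rw [hν₁, integral_withDensity_ofReal hk.measurable fun ω => (hk.pos ω).le, ← hk.eq_integral,
      hν₂, integral_withDensity_ofReal hqm fun ζ => laplaceDensity₁_nonneg hτ.le ζ] at h1
    have h2 := integral_laplaceDensity₁_mul_exp hτ (X p.1 i - X p.2 i)
    unfold echar at h1
    rw [h2] at h1
    rw [Complex.ofReal_mul, mul_comm, ← h1]
    refine integral_congr_ae (Eventually.of_forall fun z => ?_)
    simp only [θ]
    have h3 : ⟪z.1, had β (X p.1)⟫ + z.2 * X p.1 i - (⟪z.1, had β (X p.2)⟫ + z.2 * X p.2 i)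
        = ⟪z.1, had β (X p.1) - had β (X p.2)⟫ + z.2 * (X p.1 i - X p.2 i) := by
      rw [inner_sub_right]; ring
    rw [h3, echar_add]; rfl

end SmallRegularization

/-! ### Uniform strict descent along `e_i`. -/

section UniformDescent

variable {Ω : Type*} [MeasurableSpace Ω] {P : Measure Ω} [IsProbabilityMeasure P] {d : ℕ}
  {X : Ω → EuclideanSpace ℝ (Fin d)} {Y : Ω → ℝ} {i : Fin d} {μ : Measure ℝ} {a b : ℝ}
  {k K : EuclideanSpace ℝ (Fin d) → ℝ}

/-- Replacing `|X_i - X_i'|` by its exponential approximation in a kernel form. -/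
theorem kernelForm_abs_mul_le (hk : IsSpectralDensity k K) (hXm : Measurable X)
    (hX : MemLp X 2 P) {r : Ω → ℝ} (hr : MemLp r 2 P) (β : EuclideanSpace ℝ (Fin d)) {τ V s : ℝ}
    (hτ : 0 < τ) (hV : ∫ w, r w ^ 2 ∂P ≤ V) (hs : 0 ≤ s)
    (hτs : ∫ p, expError τ |X p.1 i - X p.2 i| ^ 2 ∂(P.prod P) ≤ s ^ 2) :
    kernelForm P (fun p => |X p.1 i - X p.2 i| * K (had β (X p.1) - had β (X p.2))) r r
      ≤ (∫ ω, k ω) * s * V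
        + (kernelForm P (fun p => K (had β (X p.1) - had β (X p.2))) r r
          - kernelForm P (fun p => Real.exp (-(τ * |X p.1 i - X p.2 i|))
            * K (had β (X p.1) - had β (X p.2))) r r) / τ := by
  set κ : Ω × Ω → ℝ := fun p => K (had β (X p.1) - had β (X p.2)) with hκ
  set Δ : Ω × Ω → ℝ := fun p => |X p.1 i - X p.2 i| with hΔ
  set M := ∫ ω, k ω with hM
  have hM0 : 0 ≤ M := integral_nonneg fun ω => (hk.pos ω).le
  have hκ2 : MemLp κ 2 (P.prod P) := hk.memLp_kernel (measurable_had hXm β)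
  have hκb : ∀ p, ‖κ p‖ ≤ M := fun p => hk.abs_le _
  have hΔ2 : MemLp Δ 2 (P.prod P) := memLp_sub_coord hX i
  have hmul : ∀ D : Ω × Ω → ℝ, MemLp D 2 (P.prod P) →
      MemLp (fun p => D p * κ p) 2 (P.prod P) := by
    intro D hD
    refine MemLp.of_le_mul (c := M) hD (hD.1.mul hκ2.1) (Eventually.of_forall fun p => ?_)
    rw [norm_mul, mul_comm]
    exact mul_le_mul_of_nonneg_right (hκb p) (norm_nonneg _)
  have hcE : Continuous fun x : ℝ => Real.exp (-(τ * x)) := by fun_prop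
  have hE : MemLp (fun p => Real.exp (-(τ * Δ p))) 2 (P.prod P) := by
    refine MemLp.of_bound (hcE.comp_aestronglyMeasurable hΔ2.1) 1
      (Eventually.of_forall fun p => ?_)
    rw [Real.norm_of_nonneg (Real.exp_nonneg _), Real.exp_le_one_iff]
    have := mul_nonneg hτ.le (abs_nonneg _ : 0 ≤ Δ p)
    linarith
  have hcX : Continuous fun x : ℝ => expError τ x := by unfold expError; fun_prop
  have herr : MemLp (fun p => expError τ (Δ p)) 2 (P.prod P) := by
    refine hΔ2.mono (hcX.comp_aestronglyMeasurable hΔ2.1) (Eventually.of_forall fun p => ?_)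
    rw [Real.norm_of_nonneg (expError_nonneg hτ), Real.norm_of_nonneg (abs_nonneg _ : 0 ≤ Δ p)]
    exact expError_le_self hτ (abs_nonneg _)
  have e1 := kernelForm_sub_kernel (hmul _ hΔ2) (hmul _ herr) hr hr
  have e2 := kernelForm_sub_kernel hκ2 (hmul _ hE) hr hr
  -- By definition `x - expError τ x` is `(1 - exp(-τx)) / τ`.
  have e3 : kernelForm P (fun p => Δ p * κ p - expError τ (Δ p) * κ p) r r
      = kernelForm P (fun p => κ p - Real.exp (-(τ * Δ p)) * κ p) r r / τ := by
    rw [kernelForm, kernelForm, ← integral_div]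
    congr 1; funext p
    rw [expError]; field_simp; ring
  have hV0 : 0 ≤ V := (integral_nonneg fun w => sq_nonneg _).trans hV
  have hsmall : kernelForm P (fun p => expError τ (Δ p) * κ p) r r ≤ M * s * V := by
    refine abs_le_of_sq_le_sq' ((sq_kernelForm_le (hmul _ herr) hr hr).trans ?_)
      (by positivity) |>.2
    have h1 : ∫ p, (expError τ (Δ p) * κ p) ^ 2 ∂(P.prod P) ≤ M ^ 2 * s ^ 2 := by
      calc ∫ p, (expError τ (Δ p) * κ p) ^ 2 ∂(P.prod P)
          ≤ ∫ p, M ^ 2 * expError τ (Δ p) ^ 2 ∂(P.prod P) := by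
            refine integral_mono (hmul _ herr).integrable_sq
              (herr.integrable_sq.const_mul _) fun p => ?_
            simp only
            rw [mul_pow, mul_comm]
            refine mul_le_mul_of_nonneg_right ?_ (sq_nonneg _)
            rw [← sq_abs]
            exact pow_le_pow_left₀ (abs_nonneg _) (hκb p) 2
        _ ≤ M ^ 2 * s ^ 2 := by
            rw [integral_const_mul]
            exact mul_le_mul_of_nonneg_left hτs (sq_nonneg _)
    have h2 : 0 ≤ ∫ w, r w ^ 2 ∂P := integral_nonneg fun w => sq_nonneg _
    calc _ ≤ (M ^ 2 * s ^ 2) * (V * V) :=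
          mul_le_mul h1 (mul_le_mul hV hV h2 hV0) (mul_nonneg h2 h2) (by positivity)
      _ = (M * s * V) ^ 2 := by ring
  rw [e3, e2] at e1
  linarith

/-- Uniform strict descent in the direction `e_i` for small regularization. -/
theorem exists_uniform_descent [IsProbabilityMeasure μ] (ha : 0 < a) (hab : a ≤ b)
    (hμ : ∀ᵐ t ∂μ, t ∈ Set.Icc a b) (hXm : Measurable X) (hX : MemLp X 2 P) (hY : MemLp Y 2 P)
    (hY0 : ∫ w, Y w ∂P = 0)
    (hind : ∀ S : Set (Fin d), i ∉ S →
      Indep (MeasurableSpace.comap (fun w => X w i) inferInstance) (sigmaCoord X S) P)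
    (hmain : ¬ (condCoord P X Y {i} =ᵐ[P] 0)) {B : ℝ} (hB0 : 0 ≤ B) :
    ∃ ε : ℝ, 0 < ε ∧ ∃ lam0 : ℝ, 0 < lam0 ∧ ∀ lam : ℝ, 0 < lam → lam < lam0 →
      ∀ β : EuclideanSpace ℝ (Fin d), β i = 0 → ‖β‖ ≤ B → ∃ D : ℝ,
        HasDirDeriv (fun b => objective P X Y (lOneDensity d μ) b lam) β
          (EuclideanSpace.single i 1) D ∧ lam * D ≤ -ε := by
  have hb : 0 < b := ha.trans_le hab
  have hμ0 : NeZero μ := ⟨IsProbabilityMeasure.ne_zero μ⟩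
  have hfin1 := isFiniteMeasure_sizeBiased ha hμ
  have hμ1 := ae_sizeBiased hμ
  have hne1 := sizeBiased_ne_zero ha hμ
  have hk := isSpectralDensity_lOneDensity (d := d) ha hab hμ (NeZero.ne μ)
  have hk1 := isSpectralDensity_lOneDensity (d := d) ha hab hμ1 hne1
  have hY1 : Integrable Y P := hY.integrable one_le_two
  obtain ⟨c, hc, ζ₁, η, hη, hu⟩ := exists_interval_le_norm_integral hXm hY1 hY0 hmain
  set V := ∫ w, Y w ^ 2 ∂P with hV
  have hV0 : 0 ≤ V := integral_nonneg fun w => sq_nonneg _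
  obtain ⟨ρ, hρ0, hρ1, hρ⟩ := exists_radius (2 * Real.pi * B * √(V * ∫ w, ‖X w‖ ^ 2 ∂P))
    (by positivity) hc
  set S := Metric.closedBall (0 : EuclideanSpace ℝ (Fin d)) ρ with hS
  set I := Set.Icc (ζ₁ - η) (ζ₁ + η) with hI
  have hSm : MeasurableSet S := Metric.isClosed_closedBall.measurableSet
  have hSn : ∀ ω ∈ S, ‖ω‖ ≤ ρ := fun ω hω => by simpa [hS] using hω
  have hSpos : 0 < volume.real S := ENNReal.toReal_pos
    (Metric.measure_closedBall_pos volume _ hρ0).ne' (isCompact_closedBall _ _).measure_lt_top.ne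
  have hIpos : 0 < volume.real I := by
    rw [hI, Real.volume_real_Icc]
    exact lt_max_of_lt_left (by linarith)
  set q := (2 * a / (4 * Real.pi ^ 2 + b ^ 2)) ^ d with hq
  have hq0 : 0 < q := by positivity
  have hkS : ∀ ω ∈ S, q ≤ lOneDensity d μ ω := by
    intro ω hω
    have h1 := le_lOneDensity (d := d) ha hμ ω
    rw [probReal_univ, one_mul] at h1
    exact (le_prod_of_norm_le_one ha hb ((hSn ω hω).trans hρ1)).trans h1
  set m₁ := (sizeBiased μ).real Set.univ with hm₁
  have hm₁0 : 0 < m₁ := by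
    simpa [hm₁, Measure.real, ENNReal.toReal_pos_iff, pos_iff_ne_zero] using hne1
  have hk1S : ∀ ω ∈ S, m₁ * q ≤ lOneDensity d (sizeBiased μ) ω := fun ω hω =>
    (mul_le_mul_of_nonneg_left (le_prod_of_norm_le_one ha hb ((hSn ω hω).trans hρ1))
      hm₁0.le).trans (le_lOneDensity (d := d) ha hμ1 ω)
  set M₁ := ∫ ω, lOneDensity d (sizeBiased μ) ω with hM₁
  have hM₁0 : 0 ≤ M₁ := integral_nonneg fun ω => (hk1.pos ω).le
  set w₀ := 2 / (4 * Real.pi ^ 2 * (|ζ₁| + η) ^ 2 + 1) with hw₀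
  have hw₀0 : 0 < w₀ := by positivity
  -- The exponential form will be at least `τ c₄`: the factor `τ` comes from the Laplace density,
  -- bounded below by `τ w₀` on `I` when `τ ≤ 1`. It cancels the later division by `τ`, so `c₄` can
  -- be fixed before `τ`.
  set c₄ := c ^ 2 * ((m₁ * q * volume.real S) * (w₀ * volume.real I)) with hc₄
  have hc₄0 : 0 < c₄ := by positivity
  -- Chosen so that the truncation error `M₁ s V` is at most `c₄ / 4`.
  set s := c₄ / (4 * (M₁ * V + 1)) with hs
  have hs0 : 0 < s := by positivity
  have hτex : ∀ᶠ τ in 𝓝[>] (0 : ℝ), (∫ p, expError τ |X p.1 i - X p.2 i| ^ 2 ∂(P.prod P)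
      < s ^ 2) ∧ τ ≤ 1 ∧ 0 < τ := by
    have h1 := (tendsto_integral_sq_expError (memLp_sub_coord (P := P) hX i)
      fun p => abs_nonneg _).eventually_lt_const (by positivity : (0 : ℝ) < s ^ 2)
    have h2 : ∀ᶠ τ in 𝓝[>] (0 : ℝ), τ ∈ Set.Ioc (0 : ℝ) 1 := Ioc_mem_nhdsGT one_pos
    filter_upwards [h1, h2] with τ h3 h4 using ⟨h3, h4.2, h4.1⟩
  obtain ⟨τ, hτs, hτ1, hτ0⟩ := hτex.exists
  have hqI : ∀ ζ ∈ I, τ * w₀ ≤ laplaceDensity₁ τ ζ := by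
    intro ζ hζ
    have hζ2 : ζ ^ 2 ≤ (|ζ₁| + η) ^ 2 := by
      rw [← sq_abs]
      refine pow_le_pow_left₀ (abs_nonneg _) ?_ 2
      have h1 := neg_abs_le ζ₁
      have h2 := le_abs_self ζ₁
      exact abs_le.2 ⟨by linarith [hζ.1], by linarith [hζ.2]⟩
    have hτ2 : τ ^ 2 ≤ 1 := pow_le_one₀ hτ0.le hτ1
    rw [hw₀, laplaceDensity₁, ← mul_div_assoc, mul_comm τ 2]
    gcongr
  -- The first threshold on `λ` forces the mean of the residual to be small; the second makes `b λ
  -- V` at most `c₄ τ / 4`.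
  refine ⟨c₄ / 2, by positivity,
    min (c ^ 2 * q * volume.real S / (V + 1)) (c₄ * τ / (4 * (b * V + 1))), by positivity,
    fun lam hlam hlam0 β hβ hβB => ?_⟩
  have hlam1 : lam * (V + 1) < c ^ 2 * q * volume.real S :=
    (lt_div_iff₀ (by positivity)).1 (hlam0.trans_le (min_le_left _ _))
  have hlam2 : lam * (4 * (b * V + 1)) < c₄ * τ :=
    (lt_div_iff₀ (by positivity)).1 (hlam0.trans_le (min_le_right _ _))
  have hZ := measurable_had hXm β
  obtain ⟨g, hg, hdual⟩ := hk.exists_dual (P := P) hZ hY hlam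
  refine ⟨_, hasDirDeriv_objective ha hab hμ hXm hX hY hβ hlam hg hdual, ?_⟩
  obtain ⟨hrV, hrQ⟩ := residual_bounds hk hZ hY hlam hg hdual
  set r : Ω → ℝ := fun w => lam * g w with hr
  have hr2 : MemLp r 2 P := hg.const_mul lam
  have hr1 : Integrable r P := hr2.integrable one_le_two
  -- A larger mean would keep the feature transform of `r` above `c` on the ball `S`, and the form
  -- of `K` would be at least `c² q vol(S)`, against its bound `λ V`.
  have hmean : |∫ w, r w ∂P| ≤ 2 * c := by
    by_contra hcon
    push Not at hcon
    have h1 : ∀ ω ∈ S, c ≤ ‖featureTransform P (fun w => had β (X w)) r ω‖ := by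
      intro ω hω
      have h2 := le_norm_jointTransform (i := i) (m := 2 * c) (ζ := 0) hXm hX hr2 hrV hβB hρ (by
        simp only [zero_mul, neg_zero, echar_zero, mul_one]
        rw [integral_complex_ofReal, Complex.norm_real]
        exact hcon.le) (hSn ω hω)
      simp only [jointTransform, zero_mul, add_zero] at h2
      unfold featureTransform
      linarith
    obtain ⟨h3, h4⟩ := hk.integral_normSq_featureTransform hr1 hZ
    have h5 := const_mul_measureReal_le_integral h3
      (fun ω => mul_nonneg (sq_nonneg _) (hk.pos ω).le) hSm
      (isCompact_closedBall _ _).measure_lt_top.ne (c := c ^ 2 * q) (fun ω hω =>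
        mul_le_mul (pow_le_pow_left₀ hc.le (h1 ω hω) 2) (hkS ω hω) hq0.le (sq_nonneg _))
    rw [h4] at h5
    have h6 := h5.trans hrQ
    have h7 : lam * (V + 1) = lam * V + lam := by ring
    linarith
  -- From the `4c` of the main effect, `2c` is lost to the mean of `r` and `c` to moving `ω` within
  -- the ball.
  have hjoint : ∀ ω ∈ S, ∀ ζ ∈ I, c ≤ ‖jointTransform P X i β r ω ζ‖ := by
    intro ω hω ζ hζ
    have h1 := norm_integral_residual_ge hk hXm hY hY0 hind hβ hg hdual ζ
    have h2 := (hu ζ hζ).2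
    have h3 := le_norm_jointTransform (i := i) (m := 2 * c) (ζ := ζ) hXm hX hr2 hrV hβB hρ
      (by linarith) (hSn ω hω)
    linarith
  have hexp := le_kernelForm_exp_mul (i := i) hk1 hXm hr1 hτ0 β hSm measurableSet_Icc hc.le
    (by positivity) (by positivity) hk1S hqI hjoint
  have habs := kernelForm_abs_mul_le (i := i) hk1 hXm hX hr2 β hτ0 hrV hs0.le hτs.le
  have hK1 := kernelForm_sizeBiased_le ha hab hμ hZ hr1
  rw [kernelForm_const_mul] at habs
  -- The derivative carries one factor `λ`, so `λ D = λ² E[… g g'] = E[… r r']`.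
  rw [← mul_assoc, ← sq]
  refine habs.trans ?_
  have h1 : M₁ * s * V ≤ c₄ / 4 := by
    rw [hs]
    calc M₁ * (c₄ / (4 * (M₁ * V + 1))) * V = c₄ / 4 * (M₁ * V / (M₁ * V + 1)) := by
          field_simp
      _ ≤ c₄ / 4 * 1 := by
          refine mul_le_mul_of_nonneg_left ?_ (by positivity)
          rw [div_le_one (by positivity)]; linarith
      _ = c₄ / 4 := mul_one _
  have h2 : kernelForm P (fun p => lOneKernel (sizeBiased μ) (had β (X p.1) - had β (X p.2))) r r
      ≤ c₄ * τ / 4 := by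
    have h3 := mul_le_mul_of_nonneg_left hrQ hb.le
    have h6 : lam * (4 * (b * V + 1)) = 4 * (b * (lam * V)) + 4 * lam := by ring
    have h7 := hK1.trans h3
    linarith
  have h4 : τ * c₄ ≤ kernelForm P (fun p => Real.exp (-(τ * |X p.1 i - X p.2 i|))
      * lOneKernel (sizeBiased μ) (had β (X p.1) - had β (X p.2))) r r := by
    refine le_trans (le_of_eq ?_) hexp
    rw [hc₄]; ring
  -- The numerator is at most `c₄ τ / 4 - c₄ τ`; adding the truncation error `c₄ / 4` to the
  -- quotient leaves `-c₄ / 2`.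
  have h5 : (kernelForm P (fun p => lOneKernel (sizeBiased μ)
        (had β (X p.1) - had β (X p.2))) r r
      - kernelForm P (fun p => Real.exp (-(τ * |X p.1 i - X p.2 i|))
        * lOneKernel (sizeBiased μ) (had β (X p.1) - had β (X p.2))) r r) / τ
      ≤ -(3 * c₄ / 4) := by
    rw [div_le_iff₀ hτ0]
    linarith
  linarith

end UniformDescent

/-! ### Conclusion. -/

theorem exists_Icc_of_support {μ : Measure ℝ} [IsProbabilityMeasure μ]
    (hμc : IsCompact μ.support) (hμpos : μ.support ⊆ Set.Ioi 0) :
    ∃ a b : ℝ, 0 < a ∧ a ≤ b ∧ ∀ᵐ t ∂μ, t ∈ Set.Icc a b := by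
  have hne : μ.support.Nonempty := Measure.nonempty_support (IsProbabilityMeasure.ne_zero μ)
  obtain ⟨a, ha, hamin⟩ := hμc.exists_isLeast hne
  obtain ⟨b, hb, hbmax⟩ := hμc.exists_isGreatest hne
  refine ⟨a, b, hμpos ha, hamin hb, ?_⟩
  filter_upwards [Measure.support_mem_ae (μ := μ)] with t ht using ⟨hamin ht, hbmax ht⟩

end CompositionalKernel

theorem mainTheorem2 {Ω : Type*} [MeasurableSpace Ω] (P : Measure Ω) [IsProbabilityMeasure P]
    {d : ℕ} (X : Ω → EuclideanSpace ℝ (Fin d)) (Y : Ω → ℝ)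
    (hXm : Measurable X) (hX : MemLp X 2 P) (hY : MemLp Y 2 P) (hY0 : ∫ w, Y w ∂P = 0)
    (μ : Measure ℝ) [IsProbabilityMeasure μ]
    (hμc : IsCompact μ.support) (hμpos : μ.support ⊆ Set.Ioi 0)
    (hcore : IsSufficient P X Y (coreSet P X Y))
    (hind : IndepFun (fun w (j : coreSet P X Y) => X w j)
      (fun w (j : ((coreSet P X Y)ᶜ : Set (Fin d))) => X w j) P)
    (hmut : iIndepFun (fun (j : coreSet P X Y) w => X w j) P)
    (i : Fin d) (hi : i ∈ coreSet P X Y)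
    (hmain : ¬ (condCoord P X Y {i} =ᵐ[P] 0)) :
    (∀ C : Set (EuclideanSpace ℝ (Fin d)), IsCompact C → C ⊆ {β | β i = 0} →
      (∀ β ∈ C, leadingTerm P X Y μ i β < ∞) ∧
      0 < (⨅ β ∈ C, leadingTerm P X Y μ i β) ∧
      ∃ ε : ℝ, 0 < ε ∧ ∃ lam0 : ℝ, 0 < lam0 ∧ ∀ lam : ℝ, 0 < lam → lam < lam0 → ∀ β ∈ C, ∃ D : ℝ,
        HasDirDeriv (fun b => objective P X Y (lOneDensity d μ) b lam) β
          (EuclideanSpace.single i 1) D ∧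
        lam * D ≤ -ε) ∧
    (∀ C : Set (EuclideanSpace ℝ (Fin d)), IsCompact C →
      ∃ lam0 : ℝ, 0 < lam0 ∧ ∀ lam : ℝ, 0 < lam → lam < lam0 →
        ∀ β, IsDirStationary (fun b => objective P X Y (lOneDensity d μ) b lam) β →
          i ∈ supp β ∨ β ∉ C) := by
  obtain ⟨a, b, ha, hab, hμ⟩ := exists_Icc_of_support hμc hμpos
  have hindS : ∀ S : Set (Fin d), i ∉ S →
      Indep (MeasurableSpace.comap (fun w => X w i) inferInstance) (sigmaCoord X S) P :=
    -- Both independence assumptions enter the proof only through this consequence.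
    fun S hS => indep_coord_sigmaCoord hXm hi hind hmut hS
  have hbd : ∀ C : Set (EuclideanSpace ℝ (Fin d)), IsCompact C →
      ∃ B : ℝ, 0 ≤ B ∧ ∀ β ∈ C, ‖β‖ ≤ B := by
    intro C hC
    obtain ⟨B, hB⟩ := hC.isBounded.exists_norm_le
    exact ⟨max B 0, le_max_right _ _, fun β hβ => (hB β hβ).trans (le_max_left _ _)⟩
  refine ⟨fun C hC hC0 => ?_, fun C hC => ?_⟩
  · obtain ⟨B, hB0, hB⟩ := hbd C hC
    refine ⟨fun β _ => leadingTerm_lt_top ha hμ hXm hX hY, ?_, ?_⟩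
    · obtain ⟨L, hL0, hL⟩ := exists_pos_le_leadingTerm ha hab hμ hXm hX hY hY0 hindS hmain hB0
      exact hL0.trans_le (le_iInf₂ fun β hβ => hL β (hC0 hβ) (hB β hβ))
    · obtain ⟨ε, hε, lam0, hlam0, h⟩ :=
        exists_uniform_descent ha hab hμ hXm hX hY hY0 hindS hmain hB0
      exact ⟨ε, hε, lam0, hlam0, fun lam h1 h2 β hβ => h lam h1 h2 β (hC0 hβ) (hB β hβ)⟩
  · obtain ⟨B, hB0, hB⟩ := hbd C hC
    obtain ⟨ε, hε, lam0, hlam0, h⟩ :=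
      exists_uniform_descent ha hab hμ hXm hX hY hY0 hindS hmain hB0
    refine ⟨lam0, hlam0, fun lam h1 h2 β hβ => ?_⟩
    by_contra hcon
    push Not at hcon
    obtain ⟨hiβ, hβC⟩ := hcon
    have hβi : β i = 0 := by simpa [supp] using hiβ
    obtain ⟨D, hD, hDε⟩ := h lam h1 h2 β hβi (hB β hβC)
    obtain ⟨D', hD', hD'0⟩ := hβ (EuclideanSpace.single i 1)
    -- The one-sided limit is unique, so the nonnegative derivative given by stationarity is the
    -- strictly negative one.
    have heq : D = D' := tendsto_nhds_unique hD hD'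
    have := mul_nonneg h1.le (heq ▸ hD'0)
    linarith
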